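/- Let $f : \{0,1\}^n \to \{\pm 1\}$. Call $f$ monotone if $f(x) \le f(y)$ whenever $x_i \le y_i$ for all $i$. The size of a decision tree is its number of leaves. All logarithms are to base $2$. Theorem. There are universal constants $C_1, C_2, c$ and a single (deterministic) algorithm with the following property. The algorithm is given $n$, $s$, an accuracy parameter $\varepsilon \in (0,\frac12)$ and a confidence parameter $\delta \in (0,1)$ (the latter two through the integers $\lceil 1/\varepsilon\rceil$ and $\lceil 1/\delta\rceil$), and access to random examples $(x, f(x))$, with $x$ drawn independently and uniformly from $\{0,1\}^n$, of an unknown monotone function $f : \{0,1\}^n \to \{\pm 1\}$ that is computed by a decision tree of size at most $s$. Whatever examples it receives, it halts and outputs a decision tree $T$ after at most $$c\,\bigl(n + K + \log(1/\delta)\bigr)^{c} \quad\text{steps, where}\quad K = \min\bigl(s^{C_1\log(s/\varepsilon)\log(1/\varepsilon)},\; s^{C_2\sqrt{\log s}/\varepsilon}\bigr);$$ and with probability at least $1-\delta$ over the random examples, $\Pr_{x \sim \{0,1\}^n}[T(x) \ne f(x)] \le \varepsilon$. That is, size-$s$ monotone decision trees can be properly learned (with decision trees as hypotheses) under the uniform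 distribution from random examples only, in time $\mathrm{poly}\bigl(n, \min(s^{O(\log(s/\varepsilon)\log(1/\varepsilon))}, s^{O(\sqrt{\log s}/\varepsilon)}), \log(1/\delta)\bigr)$. Time is counted on a random access machine whose unit-cost operations on natural numbers are addition, truncated subtraction, comparison with zero, and direct and indirect memory access, and which pays for every symbol of an example it draws. -/

import Mathlib

/-! ### Decision trees over `{0,1}ⁿ`

Bits are Booleans (`false` is `0`, `true` is `1`). The output value `-1` is represented by `false`
and `+1` by `true`, so that the order `-1 ≤ 1` is the order of `Bool`, and the order of
`Fin n → Bool` is the coordinatewise order. -/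

/-- Decision trees over `n` Boolean variables. `node i T₀ T₁` queries the variable `x i`, and goes on
with `T₀` if `x i = 0` and with `T₁` if `x i = 1`. -/
inductive DTree (n : ℕ) : Type
  | leaf (b : Bool) : DTree n
  | node (i : Fin n) (T₀ T₁ : DTree n) : DTree n

namespace DTree

variable {n : ℕ}

/-- The function computed by a decision tree. -/
def eval : DTree n → (Fin n → Bool) → Bool
  | leaf b, _ => b
  | node i T₀ T₁, x => if x i then T₁.eval x else T₀.eval x

/-- The size of a decision tree: its number of leaves. -/
def size : DTree n → ℕ
  | leaf _ => 1
  | node _ T₀ T₁ => T₀.size + T₁.size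

/-- The representation of a decision tree that a learner has to write on its output: the list of its
nodes in preorder, a leaf being written `0` (label `-1`) or `1` (label `+1`), and a query to the
`i`-th variable (counted from zero) being written `i + 2`. -/
def encode : DTree n → List ℕ
  | leaf b => [b.toNat]
  | node i T₀ T₁ => ((i : ℕ) + 2) :: (T₀.encode ++ T₁.encode)

end DTree

/-- `Pr[f x ≠ g x]` for `x` uniform in `{0,1}ⁿ`. -/
noncomputable def boolError {n : ℕ} (f g : (Fin n → Bool) → Bool) : ℝ :=
  ((Finset.univ.filter fun x => f x ≠ g x).card : ℝ) / 2 ^ n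

/-! ### A random access machine with an example oracle

Programs work on natural numbers held in registers `r₀, r₁, …` and arrays `A₀, A₁, …` (a fixed
program mentions only finitely many of them by name). The only arithmetic operations are addition and
truncated subtraction; every operation costs one unit of time. Since a number can at most double in
one such operation, this is the usual random access machine with unit costs, which is
polynomially equivalent to Turing machines. -/

/-- Expressions: constants, register contents, array entries, sums, truncated differences. -/
inductive RExpr : Type
  | const (c : ℕ) : RExpr
  | reg (r : ℕ) : RExpr
  | get (a : ℕ) (i : RExpr) : RExpr
  | add (e₁ e₂ : RExpr) : RExpr
  | sub (e₁ e₂ : RExpr) : RExpr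

/-- Programs. `draw a` requests one labelled example and writes it into the array `a`, `emit e`
appends the value of `e` to the output; a condition is true when its value is nonzero. -/
inductive RProg : Type
  | skip : RProg
  | assign (r : ℕ) (e : RExpr) : RProg
  | store (a : ℕ) (i e : RExpr) : RProg
  | draw (a : ℕ) : RProg
  | emit (e : RExpr) : RProg
  | seq (P Q : RProg) : RProg
  | ite (e : RExpr) (P Q : RProg) : RProg
  | while (e : RExpr) (P : RProg) : RProg

/-- Configurations: registers, arrays, number of examples drawn so far, output written so far. -/
structure RState : Type where
  reg : ℕ → ℕ
  arr : ℕ → ℕ → ℕ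
  drawn : ℕ
  out : List ℕ

namespace RExpr

/-- The value of an expression. -/
def eval (σ : RState) : RExpr → ℕ
  | const c => c
  | reg r => σ.reg r
  | get a i => σ.arr a (i.eval σ)
  | add e₁ e₂ => e₁.eval σ + e₂.eval σ
  | sub e₁ e₂ => e₁.eval σ - e₂.eval σ

/-- The time needed to evaluate an expression: one unit for each of its nodes. -/
def cost : RExpr → ℕ
  | const _ => 1
  | reg _ => 1
  | get _ i => i.cost + 1
  | add e₁ e₂ => e₁.cost + e₂.cost + 1
  | sub e₁ e₂ => e₁.cost + e₂.cost + 1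

end RExpr

namespace RState

/-- Write the value `v` into the register `r`. -/
def setReg (σ : RState) (r v : ℕ) : RState :=
  { σ with reg := Function.update σ.reg r v }

/-- Write the value `v` into the entry `i` of the array `a`. -/
def setArr (σ : RState) (a i v : ℕ) : RState :=
  { σ with arr := Function.update σ.arr a (Function.update (σ.arr a) i v) }

/-- Append the value `v` to the output. -/
def emit (σ : RState) (v : ℕ) : RState :=
  { σ with out := σ.out ++ [v] }

/-- Take the next example `(x, y)` of the sequence `ex`: the bits of `x` are written into the entries
`0, …, n - 1` of the array `a`, and the label `y` into the entry `n`. -/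
def draw {n : ℕ} (ex : ℕ → (Fin n → Bool) × Bool) (σ : RState) (a : ℕ) : RState :=
  { σ with
    arr := Function.update σ.arr a fun j =>
      if h : j < n then ((ex σ.drawn).1 ⟨j, h⟩).toNat
      else if j = n then (ex σ.drawn).2.toNat
      else σ.arr a j
    drawn := σ.drawn + 1 }

/-- The initial configuration on the input `v`, which is held in the first registers; everything else
is zero. -/
def init (v : List ℕ) : RState where
  reg r := v.getD r 0
  arr _ _ := 0
  drawn := 0
  out := []

end RState

/-- `RProg.Run ex P σ t τ`: started in the configuration `σ` with the sequence `ex` of labelled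
examples, the program `P` halts in the configuration `τ` after exactly `t` units of time. Drawing an
example costs one unit for each of its `n + 1` symbols, and one for the request. -/
inductive RProg.Run {n : ℕ} (ex : ℕ → (Fin n → Bool) × Bool) :
    RProg → RState → ℕ → RState → Prop
  | skip (σ : RState) : Run ex .skip σ 1 σ
  | assign (r : ℕ) (e : RExpr) (σ : RState) :
      Run ex (.assign r e) σ (e.cost + 1) (σ.setReg r (e.eval σ))
  | store (a : ℕ) (i e : RExpr) (σ : RState) :
      Run ex (.store a i e) σ (i.cost + e.cost + 1) (σ.setArr a (i.eval σ) (e.eval σ))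
  | draw (a : ℕ) (σ : RState) : Run ex (.draw a) σ (n + 2) (σ.draw ex a)
  | emit (e : RExpr) (σ : RState) : Run ex (.emit e) σ (e.cost + 1) (σ.emit (e.eval σ))
  | seq {P Q : RProg} {σ τ υ : RState} {t u : ℕ} :
      Run ex P σ t τ → Run ex Q τ u υ → Run ex (.seq P Q) σ (t + u) υ
  | ite_true {e : RExpr} {P Q : RProg} {σ τ : RState} {t : ℕ} :
      e.eval σ ≠ 0 → Run ex P σ t τ → Run ex (.ite e P Q) σ (e.cost + 1 + t) τ
  | ite_false {e : RExpr} {P Q : RProg} {σ τ : RState} {t : ℕ} :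
      e.eval σ = 0 → Run ex Q σ t τ → Run ex (.ite e P Q) σ (e.cost + 1 + t) τ
  | while_true {e : RExpr} {P : RProg} {σ τ υ : RState} {t u : ℕ} :
      e.eval σ ≠ 0 → Run ex P σ t τ → Run ex (.while e P) τ u υ →
      Run ex (.while e P) σ (e.cost + 1 + t + u) υ
  | while_false {e : RExpr} {P : RProg} {σ : RState} :
      e.eval σ = 0 → Run ex (.while e P) σ (e.cost + 1) σ

/-- On the input `v`, with examples of the target `f` at the points `ω 0, ω 1, …`, the program `P`
halts after exactly `t` units of time and has then output the decision tree `T`. -/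
def RProg.Outputs (P : RProg) (v : List ℕ) {n : ℕ} (f : (Fin n → Bool) → Bool)
    (ω : ℕ → Fin n → Bool) (t : ℕ) (T : DTree n) : Prop :=
  ∃ τ : RState, P.Run (fun k => (ω k, f (ω k))) (RState.init v) t τ ∧ τ.out = T.encode

/-- The law of an infinite sequence of independent uniform points of `{0,1}ⁿ`. -/
noncomputable def uniformSeq (n : ℕ) : MeasureTheory.Measure (ℕ → Fin n → Bool) :=
  MeasureTheory.Measure.infinitePi fun _ : ℕ => (PMF.uniformOfFintype (Fin n → Bool)).toMeasure

/-- `min (s ^ (C₁ log (s/ε) log (1/ε))) (s ^ (C₂ √(log s) / ε))`, with logarithms to base `2`. -/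
noncomputable def sizeBound (C₁ C₂ : ℝ) (s : ℕ) (ε : ℝ) : ℝ :=
  min ((s : ℝ) ^ (C₁ * (Real.logb 2 (s / ε) * Real.logb 2 (1 / ε))))
    ((s : ℝ) ^ (C₂ * (√(Real.logb 2 s) / ε)))

/-! For a monotone function the influence of a variable is twice its degree-one correlation `coef`,
which random examples reveal. The learner grows a complete tree of some depth `d`. At each node it
queries a variable whose estimated correlation with the restricted function is largest, and it
labels leaves by majority. The small tree for `f` occurs only in the analysis.

The analysis is a potential argument. The potential is the sum over the current leaves of
(probability of the path) times `linWeight` of the restricted function. A query of `i` lowers it by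
exactly `prob * coef i` (`weight_split`). An OSSS-type inequality (`covariance_le`, `minority_le`)
says that some `coef` is at least the error of the best constant divided by `log s`. So each level
costs potential at least (current error) / `log s`, up to noise. The error of the best constants
never grows with depth, hence `r` levels give `r * error ≤ log s * potential`
(`ErrorBound.mul_pathError_le`).

Two bounds on the initial potential give the two terms of the minimum. `linWeight_indic_le_sqrt`
bounds it by `√(log s) / 2`, so depth about `(log s)^(3/2) / ε` suffices. `linWeight_indic_le`
bounds it by `k * error + s / 2 ^ k`, so with `k` about `log (s/ε)` the error halves every `2 * k *
log s` levels, and about `log (1/ε)` halvings suffice. The running time is polynomial in `n`, `2 ^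
d` and `log (1/δ)`.

Estimates come from blocks of examples. Hoeffding's inequality and a union bound over all subcubes
(`accurateSample_probability`) make every estimate that the learner could ask for accurate at once,
so its adaptivity is harmless. The accuracy `2 ^ (-8 * d)` is tiny against the probability of any
consistent path, which is at least `2 ^ (-d)`. The program is a depth-first traversal with an
explicit stack. `IsGrowing.grow` shows that it writes a tree on any sample, and a near-greedy one on
accurate samples. -/

/-! ### Analysis of Boolean functions -/

section BooleanAnalysis

variable {n : ℕ} {α : Type*}

/-- The average of a real function over the cube. -/
noncomputable def cubeMean (g : (Fin n → Bool) → ℝ) : ℝ := (∑ x, g x) / 2 ^ n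

/-- The restriction of `g` that sets the `i`-th variable to `b`. -/
def fixVar (g : (Fin n → Bool) → α) (i : Fin n) (b : Bool) : (Fin n → Bool) → α :=
  fun x => g (Function.update x i b)

lemma fixVar_def (g : (Fin n → Bool) → α) (i : Fin n) (b : Bool) :
    fixVar g i b = fun x => g (Function.update x i b) := rfl

/-- A bit as a sign. -/
def bitSign (b : Bool) : ℝ := if b then 1 else -1

/-- A bit as a real number. -/
def bitVal (b : Bool) : ℝ := if b then 1 else 0

/-- The correlation of `g` with the `i`-th variable. -/
noncomputable def coef (g : (Fin n → Bool) → ℝ) (i : Fin n) : ℝ :=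
  cubeMean fun x => g x * bitSign (x i)

/-- The sum of all degree-one correlations of `g`. -/
noncomputable def linWeight (g : (Fin n → Bool) → ℝ) : ℝ := ∑ i, coef g i

/-- The indicator of the event that `f` has the value `1`. -/
noncomputable def indic (f : (Fin n → Bool) → Bool) : (Fin n → Bool) → ℝ := fun x => bitVal (f x)

lemma cubeMean_add (g h : (Fin n → Bool) → ℝ) :
    cubeMean (fun x => g x + h x) = cubeMean g + cubeMean h := by
  simp [cubeMean, Finset.sum_add_distrib, add_div]

lemma cubeMean_sub (g h : (Fin n → Bool) → ℝ) :
    cubeMean (fun x => g x - h x) = cubeMean g - cubeMean h := by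
  simp [cubeMean, Finset.sum_sub_distrib, sub_div]

lemma cubeMean_mul_left (c : ℝ) (g : (Fin n → Bool) → ℝ) :
    cubeMean (fun x => c * g x) = c * cubeMean g := by
  simp [cubeMean, ← Finset.mul_sum, mul_div_assoc]

lemma cubeMean_const (c : ℝ) : cubeMean (fun _ : Fin n → Bool => c) = c := by
  simp [cubeMean]

lemma cubeMean_mono {g h : (Fin n → Bool) → ℝ} (H : ∀ x, g x ≤ h x) :
    cubeMean g ≤ cubeMean h := by
  unfold cubeMean
  gcongr with x
  exact H x

lemma cubeMean_nonneg {g : (Fin n → Bool) → ℝ} (H : ∀ x, 0 ≤ g x) : 0 ≤ cubeMean g := by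
  simpa [cubeMean_const] using cubeMean_mono H

lemma fixVar_fixVar (g : (Fin n → Bool) → α) (i : Fin n) (b c : Bool) :
    fixVar (fixVar g i b) i c = fixVar g i b := by
  funext x
  simp [fixVar]

lemma cubeMean_split (g : (Fin n → Bool) → ℝ) (i : Fin n) :
    cubeMean g = (cubeMean (fixVar g i false) + cubeMean (fixVar g i true)) / 2 := by
  have key : ∀ x : Fin n → Bool, g (Function.update x i false) + g (Function.update x i true)
      = g x + g (Function.update x i (!x i)) := by
    intro x
    cases h : x i
    · have : Function.update x i false = x := by rw [← h]; simp
      simp [this]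
    · have : Function.update x i true = x := by rw [← h]; simp
      simp [this, add_comm]
  -- Flipping the `i`-th bit is an involution of the cube, so it preserves sums.
  have flip : ∑ x, g (Function.update x i (!x i)) = ∑ x, g x := by
    apply Finset.sum_bijective (fun x : Fin n → Bool => Function.update x i (!x i))
    · apply Function.Involutive.bijective
      intro x
      simp
    · simp
    · simp
  have := Finset.sum_congr rfl fun (x : Fin n → Bool) (_ : x ∈ Finset.univ) => key x
  rw [Finset.sum_add_distrib, Finset.sum_add_distrib, flip] at this
  simp only [cubeMean, fixVar]
  rw [← add_div, this]
  ring

lemma coef_eq (g : (Fin n → Bool) → ℝ) (i : Fin n) :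
    coef g i = (cubeMean (fixVar g i true) - cubeMean (fixVar g i false)) / 2 := by
  unfold coef
  rw [cubeMean_split _ i]
  have h0 : fixVar (fun x => g x * bitSign (x i)) i false = fun x => (-1) * fixVar g i false x := by
    funext x; simp [fixVar, bitSign]
  have h1 : fixVar (fun x => g x * bitSign (x i)) i true = fixVar g i true := by
    funext x; simp [fixVar, bitSign]
  rw [h0, h1, cubeMean_mul_left]
  ring

lemma coef_fixVar_self (g : (Fin n → Bool) → ℝ) (i : Fin n) (b : Bool) :
    coef (fixVar g i b) i = 0 := by
  simp [coef_eq, fixVar_fixVar]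

lemma coef_split (g : (Fin n → Bool) → ℝ) {i j : Fin n} (h : j ≠ i) :
    coef g j = (coef (fixVar g i false) j + coef (fixVar g i true) j) / 2 := by
  unfold coef
  rw [cubeMean_split _ i]
  simp [fixVar_def, h]

lemma linWeight_split (g : (Fin n → Bool) → ℝ) (i : Fin n) :
    linWeight g
      = coef g i + (linWeight (fixVar g i false) + linWeight (fixVar g i true)) / 2 := by
  have key : ∀ j, coef g j
      = (if j = i then coef g i else 0)
        + (coef (fixVar g i false) j + coef (fixVar g i true) j) / 2 := by
    intro j
    by_cases h : j = i
    · subst h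
      simp [coef_fixVar_self]
    · simp [h, coef_split g h]
  unfold linWeight
  rw [Finset.sum_congr rfl fun j _ => key j, Finset.sum_add_distrib, ← Finset.sum_div,
    Finset.sum_add_distrib]
  simp

lemma linWeight_const (c : ℝ) : linWeight (fun _ : Fin n → Bool => c) = 0 := by
  unfold linWeight
  apply Finset.sum_eq_zero
  intro i _
  simp [coef_eq, fixVar_def]

/-! ### Indicators and their restrictions; the role of monotonicity. -/

lemma bitVal_nonneg (b : Bool) : 0 ≤ bitVal b := by cases b <;> simp [bitVal]

lemma bitVal_le_one (b : Bool) : bitVal b ≤ 1 := by cases b <;> simp [bitVal]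

lemma indic_fixVar (f : (Fin n → Bool) → Bool) (i : Fin n) (b : Bool) :
    indic (fixVar f i b) = fixVar (indic f) i b := rfl

lemma cubeMean_indic_nonneg (f : (Fin n → Bool) → Bool) : 0 ≤ cubeMean (indic f) :=
  cubeMean_nonneg fun _ => bitVal_nonneg _

lemma cubeMean_indic_le_one (f : (Fin n → Bool) → Bool) : cubeMean (indic f) ≤ 1 := by
  have h : cubeMean (indic f) ≤ cubeMean fun _ => 1 := cubeMean_mono fun x => bitVal_le_one (f x)
  rwa [cubeMean_const] at h

lemma monotone_fixVar {f : (Fin n → Bool) → Bool} (hf : Monotone f) (i : Fin n) (b : Bool) :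
    Monotone (fixVar f i b) := by
  intro x y h
  apply hf
  intro j
  by_cases hj : j = i
  · subst hj; simp
  · simpa [hj] using h j

/-- Here monotonicity enters: the discrete derivative has one sign, so its mean absolute value (the
influence) is visible in the degree-one correlation. -/
lemma indic_fixVar_le {f : (Fin n → Bool) → Bool} (hf : Monotone f) (i : Fin n)
    (x : Fin n → Bool) : fixVar (indic f) i false x ≤ fixVar (indic f) i true x := by
  have : f (Function.update x i false) ≤ f (Function.update x i true) := by
    apply hf
    intro j
    by_cases hj : j = i
    · subst hj; simp
    · simp [hj]
  simp only [fixVar, indic]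
  revert this
  cases f (Function.update x i false) <;> cases f (Function.update x i true) <;> simp [bitVal]

lemma coef_indic_nonneg {f : (Fin n → Bool) → Bool} (hf : Monotone f) (i : Fin n) :
    0 ≤ coef (indic f) i := by
  rw [coef_eq]
  linarith [cubeMean_mono (indic_fixVar_le hf i)]

/-! ### Induction over functions computed by small decision trees -/

namespace DTree

/-- The decision tree for the restricted function. -/
def fixVar : DTree n → Fin n → Bool → DTree n
  | leaf c, _, _ => leaf c
  | node j T₀ T₁, i, b =>
    if j = i then (if b then T₁.fixVar i b else T₀.fixVar i b)
    else node j (T₀.fixVar i b) (T₁.fixVar i b)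

lemma size_pos (T : DTree n) : 1 ≤ T.size := by
  induction T with
  | leaf _ => simp [size]
  | node _ _ _ h _ => simp only [size]; omega

lemma size_fixVar (T : DTree n) (i : Fin n) (b : Bool) : (T.fixVar i b).size ≤ T.size := by
  induction T with
  | leaf _ => simp [fixVar]
  | node j T₀ T₁ h₀ h₁ =>
    simp only [fixVar]
    split_ifs <;> simp only [size] <;> omega

lemma eval_fixVar (T : DTree n) (i : Fin n) (b : Bool) :
    (T.fixVar i b).eval = _root_.fixVar T.eval i b := by
  induction T with
  | leaf _ => rfl
  | node j T₀ T₁ h₀ h₁ =>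
    funext x
    simp only [fixVar, fixVar_def]
    by_cases hj : j = i
    · subst hj
      cases b <;> simp [h₀, h₁, eval, fixVar_def]
    · simp [hj, h₀, h₁, eval, fixVar_def]

end DTree

/-- An induction principle for the functions computed by decision trees of size at most `s`. -/
theorem DTree.eval_induction {P : ((Fin n → Bool) → Bool) → ℕ → Prop}
    (const : ∀ b s, 1 ≤ s → P (fun _ => b) s)
    (split : ∀ f i s₀ s₁, 1 ≤ s₀ → 1 ≤ s₁ → P (_root_.fixVar f i false) s₀ →
      P (_root_.fixVar f i true) s₁ → P f (s₀ + s₁))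
    (s : ℕ) : ∀ T : DTree n, T.size ≤ s → P T.eval s := by
  induction s using Nat.strong_induction_on with
  | _ s ih =>
    intro T hT
    cases T with
    | leaf b => exact const b s hT
    | node i T₀ T₁ =>
      simp only [size] at hT
      have h₀ := T₀.size_pos
      have h₁ := T₁.size_pos
      -- The slack between `T.size` and `s` all goes to the right subtree. A subtree may query `i`
      -- again, so the hypothesis is applied to its restriction, which is no larger.
      have e : s = T₀.size + (s - T₀.size) := by omega
      rw [e]
      have r : ∀ b, _root_.fixVar (node i T₀ T₁).eval i b
          = ((if b then T₁ else T₀).fixVar i b).eval := by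
        intro b
        rw [eval_fixVar]
        funext x
        cases b <;> simp [_root_.fixVar, eval]
      apply split _ i _ _ h₀ (by omega)
      · rw [r]
        exact ih _ (by omega) _ (size_fixVar _ _ _)
      · rw [r]
        exact ih _ (by omega) _ ((size_fixVar _ _ _).trans (by simp; omega))

/-- AM-GM in the form `4ab ≤ (a + b)²`. It lets `log s` play the role of average depth in the
inductions: at every split it exceeds the mean over the two parts by at least one. -/
lemma half_logb_add_le {a b : ℕ} (ha : 1 ≤ a) (hb : 1 ≤ b) :
    1 + (Real.logb 2 a + Real.logb 2 b) / 2 ≤ Real.logb 2 ((a + b : ℕ) : ℝ) := by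
  have ha' : (1 : ℝ) ≤ a := by exact_mod_cast ha
  have hb' : (1 : ℝ) ≤ b := by exact_mod_cast hb
  have h : Real.logb 2 ((2 : ℝ) ^ 2 * (a * b)) ≤ Real.logb 2 (((a + b : ℕ) : ℝ) ^ 2) := by
    apply Real.logb_le_logb_of_le (by norm_num) (by positivity)
    push_cast
    nlinarith [sq_nonneg ((a : ℝ) - b)]
  rw [Real.logb_mul (by norm_num) (by positivity), Real.logb_mul (by positivity) (by positivity),
    Real.logb_pow, Real.logb_pow, Real.logb_self_eq_one (by norm_num)] at h
  push_cast at h ⊢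
  linarith

lemma half_sqrt_add_le (u v : ℝ) : (√u + √v) / 2 ≤ √((max u 0 + max v 0) / 2) := by
  apply Real.le_sqrt_of_sq_le
  have hu : √u ^ 2 = max u 0 := by
    rcases le_total u 0 with h | h
    · simp [Real.sqrt_eq_zero_of_nonpos h, h]
    · simp [Real.sq_sqrt h, h]
  have hv : √v ^ 2 = max v 0 := by
    rcases le_total v 0 with h | h
    · simp [Real.sqrt_eq_zero_of_nonpos h, h]
    · simp [Real.sq_sqrt h, h]
  nlinarith [sq_nonneg (√u - √v)]

lemma logb_natCast_nonneg (s : ℕ) : 0 ≤ Real.logb 2 (s : ℝ) := by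
  rcases Nat.eq_zero_or_pos s with h | h
  · simp [h]
  · exact Real.logb_nonneg (by norm_num) (by exact_mod_cast h)

/-- The total degree-one weight of a `±1`-valued function is bounded by the square root of the
average depth of its decision trees. -/
lemma linWeight_sign_le (s : ℕ) (T : DTree n) (hT : T.size ≤ s) (a : ℝ) :
    a * cubeMean (fun x => bitSign (T.eval x)) + linWeight (fun x => bitSign (T.eval x))
      ≤ √(a ^ 2 + Real.logb 2 s) := by
  revert a
  refine DTree.eval_induction (P := fun f s => ∀ a : ℝ,
    a * cubeMean (fun x => bitSign (f x)) + linWeight (fun x => bitSign (f x))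
      ≤ √(a ^ 2 + Real.logb 2 s)) ?_ ?_ s T hT
  · intro b s hs a
    rw [cubeMean_const, linWeight_const]
    apply Real.le_sqrt_of_sq_le
    have := logb_natCast_nonneg s
    cases b <;> simp [bitSign, this]
  · intro f i s₀ s₁ h₀ h₁ ih₀ ih₁ a
    have e := linWeight_split (fun x => bitSign (f x)) i
    rw [coef_eq] at e
    have e' := cubeMean_split (fun x => bitSign (f x)) i
    -- The tilt `a` absorbs the correlation of the root variable: `a * mean + coef i` is the average
    -- of `(a - 1) * mean₀` and `(a + 1) * mean₁`. Since `(a ± 1)²` averages to `a² + 1`, concavity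
    -- of the square root closes the induction.
    have i₀ := ih₀ (a - 1)
    have i₁ := ih₁ (a + 1)
    have l₀ := logb_natCast_nonneg s₀
    have l₁ := logb_natCast_nonneg s₁
    have k := half_sqrt_add_le ((a - 1) ^ 2 + Real.logb 2 s₀) ((a + 1) ^ 2 + Real.logb 2 s₁)
    rw [max_eq_left (by positivity), max_eq_left (by positivity)] at k
    have k' : √(((a - 1) ^ 2 + Real.logb 2 s₀ + ((a + 1) ^ 2 + Real.logb 2 s₁)) / 2)
        ≤ √(a ^ 2 + Real.logb 2 ((s₀ + s₁ : ℕ) : ℝ)) := by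
      apply Real.sqrt_le_sqrt
      linarith [half_logb_add_le h₀ h₁]
    rw [e, e']
    simp only [fixVar_def] at *
    linarith

lemma linWeight_indic_le_sqrt (s : ℕ) (T : DTree n) (hT : T.size ≤ s) :
    linWeight (indic T.eval) ≤ √(Real.logb 2 s) / 2 := by
  have h := linWeight_sign_le s T hT 0
  have e : linWeight (fun x => bitSign (T.eval x)) = 2 * linWeight (indic T.eval) := by
    unfold linWeight
    rw [Finset.mul_sum]
    refine Finset.sum_congr rfl fun i _ => ?_
    have : (fun x => bitSign (T.eval x)) = fun x => 2 * indic T.eval x - 1 := by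
      funext x
      cases h : T.eval x <;> simp [bitSign, indic, bitVal, h]
      norm_num
    rw [this, coef_eq, coef_eq]
    simp only [fixVar_def]
    rw [cubeMean_sub, cubeMean_sub, cubeMean_mul_left, cubeMean_mul_left]
    ring
  rw [e] at h
  simp at h
  linarith

/-- The probability that `f` differs from its less likely value. -/
noncomputable def minority (f : (Fin n → Bool) → Bool) : ℝ :=
  min (cubeMean (indic f)) (1 - cubeMean (indic f))

/-- Each of the first `k` levels of the tree contributes at most the mean of `f` (or of its
negation), since the root correlation is `(p₁ - p₀) / 2`. Subtrees below level `k` are charged their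
size, weighted by `2 ^ (-k)`. The two bounds are proved separately because a minimum does not pass
to averages in this direction. -/
lemma linWeight_indic_le (s : ℕ) (T : DTree n) (hT : T.size ≤ s) (k : ℕ) :
    linWeight (indic T.eval) ≤ k * minority T.eval + s / 2 ^ k := by
  have main : ∀ k : ℕ, linWeight (indic T.eval) ≤ k * cubeMean (indic T.eval) + s / 2 ^ k ∧
      linWeight (indic T.eval) ≤ k * (1 - cubeMean (indic T.eval)) + s / 2 ^ k := by
    refine DTree.eval_induction (P := fun f s => ∀ k : ℕ,
      linWeight (indic f) ≤ k * cubeMean (indic f) + s / 2 ^ k ∧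
      linWeight (indic f) ≤ k * (1 - cubeMean (indic f)) + s / 2 ^ k) ?_ ?_ s T hT
    · intro b s hs k
      have h₁ : (0 : ℝ) ≤ s / 2 ^ k := by positivity
      have e : indic (fun _ : Fin n → Bool => b) = fun _ => bitVal b := rfl
      rw [e, linWeight_const, cubeMean_const]
      have h₂ : 0 ≤ (k : ℝ) * bitVal b := mul_nonneg (by positivity) (bitVal_nonneg b)
      have h₃ : 0 ≤ (k : ℝ) * (1 - bitVal b) :=
        mul_nonneg (by positivity) (by linarith [bitVal_le_one b])
      constructor <;> linarith
    · intro f i s₀ s₁ h₀ h₁ ih₀ ih₁ k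
      have e := linWeight_split (indic f) i
      rw [coef_eq] at e
      have e' := cubeMean_split (indic f) i
      have p₀ := cubeMean_indic_nonneg (fixVar f i false)
      have p₁ := cubeMean_indic_nonneg (fixVar f i true)
      have q₀ := cubeMean_indic_le_one (fixVar f i false)
      have q₁ := cubeMean_indic_le_one (fixVar f i true)
      have r₀ : (1 : ℝ) ≤ s₀ := by exact_mod_cast h₀
      have r₁ : (1 : ℝ) ≤ s₁ := by exact_mod_cast h₁
      simp only [indic_fixVar] at *
      rw [e, e']
      rcases k with _ | k
      · obtain ⟨a₀, -⟩ := ih₀ 0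
        obtain ⟨a₁, -⟩ := ih₁ 0
        push_cast
        simp only [Nat.cast_zero, pow_zero, zero_mul, zero_add, div_one] at a₀ a₁ ⊢
        constructor <;> linarith
      · obtain ⟨a₀, b₀⟩ := ih₀ k
        obtain ⟨a₁, b₁⟩ := ih₁ k
        have w : ((s₀ + s₁ : ℕ) : ℝ) / 2 ^ (k + 1) = ((s₀ : ℝ) / 2 ^ k + s₁ / 2 ^ k) / 2 := by
          push_cast
          rw [pow_succ]
          field_simp
        rw [w]
        push_cast
        constructor <;> nlinarith
  rcases min_choice (cubeMean (indic T.eval)) (1 - cubeMean (indic T.eval)) with h | h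
  · rw [minority, h]
    exact (main k).1
  · rw [minority, h]
    exact (main k).2

/-- An OSSS-type inequality. `F` stays fixed while the tree of the second function is unfolded, so
the influence hypothesis survives the induction unchanged. Resampling the root variable in `F`
independently costs a quarter of `E[(F₁ - F₀)(G₁ - G₀)]`, at most `A / 2`, which the growth of `log
s` pays for. -/
lemma covariance_le (F : (Fin n → Bool) → ℝ) (A : ℝ) (hA : 0 ≤ A)
    (hF : ∀ i, cubeMean (fun x => |fixVar F i true x - fixVar F i false x|) ≤ 2 * A)
    (s : ℕ) (T : DTree n) (hT : T.size ≤ s) :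
    cubeMean (fun x => F x * indic T.eval x) - cubeMean F * cubeMean (indic T.eval)
      ≤ A / 2 * Real.logb 2 s := by
  refine DTree.eval_induction (P := fun f s =>
    cubeMean (fun x => F x * indic f x) - cubeMean F * cubeMean (indic f)
      ≤ A / 2 * Real.logb 2 s) ?_ ?_ s T hT
  · intro b s hs
    have e : indic (fun _ : Fin n → Bool => b) = fun _ => bitVal b := rfl
    have e' : cubeMean (fun x => F x * bitVal b) = cubeMean F * bitVal b := by
      rw [mul_comm, ← cubeMean_mul_left]
      simp only [mul_comm]
    rw [e, cubeMean_const, e', sub_self]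
    have := logb_natCast_nonneg s
    positivity
  · intro f i s₀ s₁ h₀ h₁ ih₀ ih₁
    set G₀ := indic (fixVar f i false) with hG₀
    set G₁ := indic (fixVar f i true) with hG₁
    set F₀ := fixVar F i false with hF₀
    set F₁ := fixVar F i true with hF₁
    have e : cubeMean (fun x => F x * indic f x)
        = (cubeMean (fun x => F₀ x * G₀ x) + cubeMean (fun x => F₁ x * G₁ x)) / 2 := by
      rw [cubeMean_split _ i]; rfl
    have e₀ : cubeMean (fun x => F x * G₀ x)
        = (cubeMean (fun x => F₀ x * G₀ x) + cubeMean (fun x => F₁ x * G₀ x)) / 2 := by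
      rw [cubeMean_split _ i]; simp [hG₀, hF₀, hF₁, fixVar_def, indic]
    have e₁ : cubeMean (fun x => F x * G₁ x)
        = (cubeMean (fun x => F₀ x * G₁ x) + cubeMean (fun x => F₁ x * G₁ x)) / 2 := by
      rw [cubeMean_split _ i]; simp [hG₁, hF₀, hF₁, fixVar_def, indic]
    have e' : cubeMean (indic f) = (cubeMean G₀ + cubeMean G₁) / 2 := cubeMean_split _ i
    have err : cubeMean (fun x => F₀ x * G₀ x) + cubeMean (fun x => F₁ x * G₁ x)
        - cubeMean (fun x => F₀ x * G₁ x) - cubeMean (fun x => F₁ x * G₀ x) ≤ 2 * A := by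
      rw [← cubeMean_add, ← cubeMean_sub, ← cubeMean_sub]
      refine le_trans (cubeMean_mono fun x => ?_) (hF i)
      have a₀ := bitVal_nonneg (fixVar f i false x)
      have a₁ := bitVal_nonneg (fixVar f i true x)
      have b₀ := bitVal_le_one (fixVar f i false x)
      have b₁ := bitVal_le_one (fixVar f i true x)
      have : |(F₁ x - F₀ x) * (G₁ x - G₀ x)| ≤ |F₁ x - F₀ x| * 1 := by
        rw [abs_mul]
        gcongr
        rw [abs_le]
        simp only [hG₀, hG₁, indic]
        constructor <;> linarith
      have := le_of_abs_le this
      linarith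
    have k := mul_le_mul_of_nonneg_left (half_logb_add_le h₀ h₁) (by linarith : 0 ≤ A / 2)
    rw [e, e']
    linarith

/-- Some variable of a monotone function with a small decision tree is influential. -/
lemma minority_le (s : ℕ) (T : DTree n) (hT : T.size ≤ s) (hmono : Monotone T.eval) (A : ℝ)
    (hA : 0 ≤ A) (h : ∀ i, coef (indic T.eval) i ≤ A) :
    minority T.eval ≤ Real.logb 2 s * A := by
  have c := covariance_le (indic T.eval) A hA (fun i => by
    have := h i
    rw [coef_eq, ← cubeMean_sub] at this
    have e : (fun x => |fixVar (indic T.eval) i true x - fixVar (indic T.eval) i false x|)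
        = fun x => fixVar (indic T.eval) i true x - fixVar (indic T.eval) i false x := by
      funext x
      exact abs_of_nonneg (by linarith [indic_fixVar_le hmono i x])
    rw [e]
    linarith) s T hT
  have e : (fun x => indic T.eval x * indic T.eval x) = indic T.eval := by
    funext x
    cases h : T.eval x <;> simp [indic, bitVal, h]
  rw [e] at c
  have p := cubeMean_indic_nonneg T.eval
  have q := cubeMean_indic_le_one T.eval
  -- The covariance of the indicator with itself is `p (1 - p)`, and `min p (1 - p) ≤ 2 p (1 - p)`
  -- cancels the factor `1 / 2`.
  unfold minority
  rcases le_total (cubeMean (indic T.eval)) (1 - cubeMean (indic T.eval)) with h | h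
  · rw [min_eq_left h]; nlinarith
  · rw [min_eq_right h]; nlinarith

end BooleanAnalysis

/-! ### Paths, and trees that query nearly most influential variables -/

section Paths

variable {n : ℕ} {α : Type*}

/-- A path in a decision tree: the queried variables with the answers, most recent first. -/
abbrev QueryPath (n : ℕ) : Type := List (Fin n × Bool)

/-- The points that follow a path. -/
def QueryPath.Follows (p : QueryPath n) (x : Fin n → Bool) : Prop := ∀ e ∈ p, x e.1 = e.2

instance (p : QueryPath n) (x : Fin n → Bool) : Decidable (p.Follows x) :=
  inferInstanceAs (Decidable (∀ e ∈ p, x e.1 = e.2))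

/-- The probability that a random point follows a path. -/
noncomputable def QueryPath.prob (p : QueryPath n) : ℝ :=
  cubeMean fun x => if p.Follows x then 1 else 0

/-- The point obtained by forcing the answers of a path. -/
def QueryPath.force : QueryPath n → (Fin n → Bool) → (Fin n → Bool)
  | [], x => x
  | (i, b) :: p, x => QueryPath.force p (Function.update x i b)

/-- The restriction of a function to the points that follow a path. -/
def QueryPath.restrict (p : QueryPath n) (g : (Fin n → Bool) → α) : (Fin n → Bool) → α :=
  fun x => g (p.force x)

/-! ### Restriction to a path, and the two quantities that a query changes. -/

namespace QueryPath

lemma follows_cons (i : Fin n) (b : Bool) (p : QueryPath n) (x : Fin n → Bool) :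
    Follows ((i, b) :: p) x ↔ x i = b ∧ p.Follows x := by
  simp [Follows]

lemma follows_nil (x : Fin n → Bool) : Follows [] x := by simp [Follows]

lemma restrict_def (p : QueryPath n) (g : (Fin n → Bool) → α) :
    p.restrict g = fun x => g (p.force x) := rfl

lemma restrict_cons (i : Fin n) (b : Bool) (p : QueryPath n) (g : (Fin n → Bool) → α) :
    restrict ((i, b) :: p) g = fixVar (p.restrict g) i b := rfl

/-- Paths may repeat variables, and in `force` the oldest answer wins. So a variable is either
untouched or frozen at a constant; the facts about extending a path split along this dichotomy. -/
lemma force_cases (p : QueryPath n) (i : Fin n) :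
    (∀ x, p.force x i = x i) ∨
      ((∃ c, ∀ x, p.force x i = c) ∧ ∀ x b, p.force (Function.update x i b) = p.force x) := by
  induction p with
  | nil => exact Or.inl fun _ => rfl
  | cons e p ih =>
    obtain ⟨j, b⟩ := e
    simp only [force]
    by_cases hj : i = j
    · subst hj
      right
      refine ⟨?_, fun x c => by simp⟩
      rcases ih with h | ⟨⟨c, hc⟩, -⟩
      · exact ⟨b, fun x => by simp [h]⟩
      · exact ⟨c, fun x => hc _⟩
    · rcases ih with h | ⟨⟨c, hc⟩, h⟩
      · exact Or.inl fun x => by simp [h, hj]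
      · refine Or.inr ⟨⟨c, fun x => hc _⟩, fun x a => ?_⟩
        rw [Function.update_comm hj, h]

lemma cubeMean_ite_eq (h : (Fin n → Bool) → ℝ) (i : Fin n) (b : Bool) :
    cubeMean (fun x => if x i = b then h x else 0) = cubeMean (fixVar h i b) / 2 := by
  rw [cubeMean_split _ i]
  have z := cubeMean_const (n := n) 0
  cases b <;> simp [fixVar_def, z]

lemma cubeMean_follows_cons (i : Fin n) (b : Bool) (p : QueryPath n) (g : (Fin n → Bool) → ℝ) :
    cubeMean (fun x => if Follows ((i, b) :: p) x then g x else 0)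
      = cubeMean (fun x => if p.Follows x then (if x i = b then g x else 0) else 0) := by
  congr 1
  funext x
  by_cases h : x i = b <;> simp [follows_cons, h]

/-- The law of a random point that follows `p` is that of `p.force x`. -/
lemma cubeMean_follows (p : QueryPath n) (g : (Fin n → Bool) → ℝ) :
    cubeMean (fun x => if p.Follows x then g x else 0) = p.prob * cubeMean (p.restrict g) := by
  induction p generalizing g with
  | nil =>
    have e : prob ([] : QueryPath n) = 1 := by simp [prob, follows_nil, cubeMean_const]
    simp only [follows_nil, e, if_true, one_mul]
    rfl
  | cons e p ih =>
    obtain ⟨i, b⟩ := e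
    unfold prob
    rw [cubeMean_follows_cons, cubeMean_follows_cons, ih, ih, restrict_cons]
    rcases force_cases p i with h | ⟨⟨c, hc⟩, h⟩
    · have e₁ : ∀ g : (Fin n → Bool) → ℝ, restrict p (fun x => if x i = b then g x else 0)
          = fun x => if x i = b then restrict p g x else 0 := by
        intro g; funext x; simp [restrict_def, h]
      rw [e₁, e₁, cubeMean_ite_eq, cubeMean_ite_eq]
      simp only [restrict_def, fixVar_def, cubeMean_const]
      ring
    · have e₂ : fixVar (restrict p g) i b = restrict p g := by
        funext x; simp [fixVar_def, restrict_def, h]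
      rw [e₂]
      -- A new answer contradicting the frozen one makes the path impossible: both sides are zero,
      -- whatever the restriction is.
      by_cases hcb : c = b
      · simp [restrict_def, hc, hcb, cubeMean_const]
      · simp [restrict_def, hc, hcb, cubeMean_const]

lemma prob_nonneg (p : QueryPath n) : 0 ≤ p.prob :=
  cubeMean_nonneg fun _ => by split_ifs <;> norm_num

lemma prob_nil : prob ([] : QueryPath n) = 1 := by simp [prob, follows_nil, cubeMean_const]

lemma cubeMean_follows_split (p : QueryPath n) (i : Fin n) (g : (Fin n → Bool) → ℝ) :
    cubeMean (fun x => if Follows ((i, false) :: p) x then g x else 0)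
      + cubeMean (fun x => if Follows ((i, true) :: p) x then g x else 0)
      = cubeMean (fun x => if p.Follows x then g x else 0) := by
  rw [← cubeMean_add]
  congr 1
  funext x
  cases h : x i <;> simp [follows_cons, h]

lemma prob_split (p : QueryPath n) (i : Fin n) :
    prob ((i, false) :: p) + prob ((i, true) :: p) = p.prob :=
  cubeMean_follows_split p i fun _ => 1

lemma prob_cons_of_free {p : QueryPath n} {i : Fin n} (h : ∀ x, p.force x i = x i) (b : Bool) :
    prob ((i, b) :: p) = p.prob / 2 := by
  have := cubeMean_follows p (fun x => if x i = b then 1 else 0)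
  unfold prob at this ⊢
  rw [cubeMean_follows_cons, this]
  simp only [restrict_def, h]
  rw [cubeMean_ite_eq]
  simp only [fixVar_def, cubeMean_const]
  ring

/-- A path has probability `0`, or at least the one of a path without repetitions. -/
lemma prob_eq_zero_or (p : QueryPath n) : p.prob = 0 ∨ 1 / 2 ^ p.length ≤ p.prob := by
  induction p with
  | nil => simp [prob_nil]
  | cons e p ih =>
    obtain ⟨i, b⟩ := e
    rcases force_cases p i with h | ⟨⟨c, hc⟩, h⟩
    · rw [prob_cons_of_free h]
      rcases ih with ih | ih
      · simp [ih]
      · right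
        rw [List.length_cons, pow_succ, ← div_div]
        linarith
    · have e₁ : prob ((i, b) :: p) = if c = b then prob p else 0 := by
        have := cubeMean_follows p (fun x => if x i = b then 1 else 0)
        rw [prob, cubeMean_follows_cons, this]
        simp only [restrict_def, hc, cubeMean_const]
        split_ifs <;> simp
      rw [e₁]
      split_ifs
      · rcases ih with ih | ih
        · exact Or.inl ih
        · right
          refine le_trans ?_ ih
          rw [List.length_cons]
          gcongr <;> norm_num
      · exact Or.inl rfl

/-- The linear weight of the restriction to a path, weighted by its probability. -/
noncomputable def weight (p : QueryPath n) (f : (Fin n → Bool) → Bool) : ℝ :=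
  p.prob * linWeight (indic (p.restrict f))

/-- The error of the best constant on the points that follow a path. -/
noncomputable def leafError (p : QueryPath n) (f : (Fin n → Bool) → Bool) : ℝ :=
  p.prob * minority (p.restrict f)

/-- The potential drop of one query. A variable already on the path has correlation zero, and the
potential is then unchanged. -/
lemma weight_split (p : QueryPath n) (f : (Fin n → Bool) → Bool) (i : Fin n) :
    weight ((i, false) :: p) f + weight ((i, true) :: p) f
      = p.weight f - p.prob * coef (indic (p.restrict f)) i := by
  unfold weight
  rw [restrict_cons, restrict_cons]
  rcases force_cases p i with h | ⟨-, h⟩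
  · rw [prob_cons_of_free h, prob_cons_of_free h, linWeight_split (indic (p.restrict f)) i,
      indic_fixVar, indic_fixVar]
    ring
  · have e : ∀ b, fixVar (p.restrict f) i b = p.restrict f := by
      intro b; funext x; simp [fixVar_def, restrict_def, h]
    have z : coef (indic (p.restrict f)) i = 0 := by
      rw [← e true, indic_fixVar, coef_fixVar_self]
    rw [e, e, z, ← add_mul, prob_split]
    ring

/-- Written as a minimum of two masses, each additive under splitting, the error visibly cannot grow
when a leaf is split. -/
lemma leafError_eq (p : QueryPath n) (f : (Fin n → Bool) → Bool) :
    p.leafError f = min (cubeMean fun x => if p.Follows x then indic f x else 0)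
      (cubeMean fun x => if p.Follows x then 1 - indic f x else 0) := by
  rw [cubeMean_follows, cubeMean_follows, leafError, minority, mul_min_of_nonneg _ _ p.prob_nonneg]
  have : cubeMean (p.restrict fun x => 1 - indic f x) = 1 - cubeMean (indic (p.restrict f)) := by
    rw [← cubeMean_const (n := n) 1, ← cubeMean_sub, cubeMean_const]
    rfl
  rw [this]
  rfl

lemma leafError_nonneg (p : QueryPath n) (f : (Fin n → Bool) → Bool) : 0 ≤ p.leafError f :=
  mul_nonneg p.prob_nonneg
    (le_min (cubeMean_indic_nonneg _) (by linarith [cubeMean_indic_le_one (p.restrict f)]))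

lemma leafError_split_le (p : QueryPath n) (f : (Fin n → Bool) → Bool) (i : Fin n) :
    leafError ((i, false) :: p) f + leafError ((i, true) :: p) f ≤ p.leafError f := by
  simp only [leafError_eq]
  rw [← cubeMean_follows_split p i, ← cubeMean_follows_split p i]
  apply le_min
  · exact add_le_add (min_le_left _ _) (min_le_left _ _)
  · exact add_le_add (min_le_right _ _) (min_le_right _ _)

lemma monotone_restrict {f : (Fin n → Bool) → Bool} (hf : Monotone f) (p : QueryPath n) :
    Monotone (p.restrict f) := by
  induction p with
  | nil => exact hf
  | cons e p ih => exact monotone_fixVar ih _ _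

lemma exists_tree_restrict {f : (Fin n → Bool) → Bool} {s : ℕ}
    (hf : ∃ T : DTree n, T.size ≤ s ∧ T.eval = f) (p : QueryPath n) :
    ∃ T : DTree n, T.size ≤ s ∧ T.eval = p.restrict f := by
  induction p with
  | nil => exact hf
  | cons e p ih =>
    obtain ⟨T, hT, h⟩ := ih
    exact ⟨T.fixVar e.1 e.2, (T.size_fixVar _ _).trans hT, by rw [T.eval_fixVar, h]; rfl⟩

end QueryPath

open QueryPath

/-- The probability that a random point follows `p` and is misclassified by `T`. -/
noncomputable def pathError (f : (Fin n → Bool) → Bool) (T : DTree n) (p : QueryPath n) : ℝ :=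
  cubeMean fun x => if p.Follows x then (if T.eval x = f x then 0 else 1) else 0

lemma pathError_node (f : (Fin n → Bool) → Bool) (i : Fin n) (T₀ T₁ : DTree n)
    (p : QueryPath n) :
    pathError f (.node i T₀ T₁) p
      = pathError f T₀ ((i, false) :: p) + pathError f T₁ ((i, true) :: p) := by
  unfold pathError
  rw [← cubeMean_add]
  congr 1
  funext x
  cases h : x i <;> simp [follows_cons, DTree.eval, h]

lemma pathError_nil (f : (Fin n → Bool) → Bool) (T : DTree n) :
    pathError f T [] = boolError T.eval f := by
  simp only [pathError, follows_nil, if_true, cubeMean, boolError]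
  congr 1
  rw [Finset.card_filter]
  push_cast
  refine Finset.sum_congr rfl fun x _ => ?_
  by_cases h : T.eval x = f x <;> simp [h]

/-- Complete trees of height `h` hanging below the path `p` which query, up to `η`, most
influential variables, and whose leaves carry, up to `η`, the most likely labels. -/
def NearGreedy (f : (Fin n → Bool) → Bool) (η : ℝ) : ℕ → QueryPath n → DTree n → Prop
  | 0, p, .leaf b => pathError f (.leaf b) p ≤ p.leafError f + η * p.prob
  | h + 1, p, .node i T₀ T₁ =>
    (∀ j, p.prob * coef (indic (p.restrict f)) j
      ≤ p.prob * coef (indic (p.restrict f)) i + η * p.prob) ∧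
    NearGreedy f η h ((i, false) :: p) T₀ ∧ NearGreedy f η h ((i, true) :: p) T₁
  | _, _, _ => False

/-- All near-greedy trees of height `h` have error at most `α` times the error of the best
constant, up to `β`. -/
def ErrorBound (f : (Fin n → Bool) → Bool) (η : ℝ) (h : ℕ) (α β : ℝ) : Prop :=
  ∀ p T, NearGreedy f η h p T → pathError f T p ≤ α * p.leafError f + β * p.prob

/-! ### Amortised error analysis of near-greedy trees. -/

section Greedy

variable {f : (Fin n → Bool) → Bool} {η : ℝ} {h s : ℕ} {α β ℓ : ℝ}

lemma nearGreedy_succ {p : QueryPath n} {T : DTree n} (hT : NearGreedy f η (h + 1) p T) :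
    ∃ i T₀ T₁, T = .node i T₀ T₁ ∧ (∀ j, p.prob * coef (indic (p.restrict f)) j
      ≤ p.prob * coef (indic (p.restrict f)) i + η * p.prob) ∧
    NearGreedy f η h ((i, false) :: p) T₀ ∧ NearGreedy f η h ((i, true) :: p) T₁ := by
  cases T with
  | leaf b => exact hT.elim
  | node i T₀ T₁ => exact ⟨i, T₀, T₁, rfl, hT⟩

lemma errorBound_zero : ErrorBound f η 0 1 η := by
  intro p T hT
  cases T with
  | leaf b => rw [one_mul]; exact hT
  | node i T₀ T₁ => exact hT.elim

lemma ErrorBound.succ (hα : 0 ≤ α) (hB : ErrorBound f η h α β) : ErrorBound f η (h + 1) α β := by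
  intro p T hT
  obtain ⟨i, T₀, T₁, rfl, -, h₀, h₁⟩ := nearGreedy_succ hT
  rw [pathError_node, ← prob_split p i]
  have := mul_le_mul_of_nonneg_left (leafError_split_le p f i) hα
  linarith [hB _ _ h₀, hB _ _ h₁]

lemma ErrorBound.add (hα : 0 ≤ α) (hB : ErrorBound f η h α β) (r : ℕ) :
    ErrorBound f η (h + r) α β := by
  induction r with
  | zero => exact hB
  | succ r ih => exact ih.succ hα

/-- The potential lost by querying `i`, times `ℓ`, pays for the error of stopping here: restrictions
of `f` are still monotone with trees of size at most `s`, so `minority_le` applies to them. -/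
lemma leafError_le (hf : Monotone f) (hs : ∃ T : DTree n, T.size ≤ s ∧ T.eval = f)
    (hη : 0 ≤ η) (hℓ : Real.logb 2 s ≤ ℓ) {p : QueryPath n} {i : Fin n}
    (hi : ∀ j, p.prob * coef (indic (p.restrict f)) j
      ≤ p.prob * coef (indic (p.restrict f)) i + η * p.prob) :
    p.leafError f ≤ ℓ * (p.prob * coef (indic (p.restrict f)) i + η * p.prob) := by
  obtain ⟨T, hT, e⟩ := exists_tree_restrict hs p
  have hmono := monotone_restrict hf p
  rcases p.prob_nonneg.eq_or_lt with h0 | h0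
  · simp [leafError, ← h0]
  · have nn : 0 ≤ coef (indic (p.restrict f)) i + η := by
      have := coef_indic_nonneg hmono i
      linarith
    have := minority_le s T hT (by rwa [e]) (coef (indic (p.restrict f)) i + η) nn (fun j => by
      rw [e]
      have := hi j
      rw [mul_comm η, ← mul_add] at this
      exact le_of_mul_le_mul_left this h0)
    rw [e] at this
    have := mul_le_mul_of_nonneg_left (this.trans (mul_le_mul_of_nonneg_right hℓ nn)) h0.le
    unfold leafError
    linarith

/-- Write `r + 1` copies of the error as one plus `r`. The single copy is charged to the root query
through `leafError_le`, the others recursively to the children; by `weight_split` the charges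
telescope to the potential at `p`. -/
lemma ErrorBound.mul_pathError_le (hf : Monotone f)
    (hs : ∃ T : DTree n, T.size ≤ s ∧ T.eval = f) (hη : 0 ≤ η) (hℓ : Real.logb 2 s ≤ ℓ)
    (hα : 0 ≤ α) (hB : ErrorBound f η h α β) (r : ℕ) :
    ∀ p T, NearGreedy f η (h + r) p T →
      r * pathError f T p ≤ α * ℓ * p.weight f + r * (β + α * ℓ * η) * p.prob := by
  have hℓ0 : 0 ≤ ℓ := (logb_natCast_nonneg s).trans hℓ
  induction r with
  | zero =>
    intro p T _
    have : 0 ≤ p.weight f := mul_nonneg p.prob_nonneg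
      (Finset.sum_nonneg fun i _ => coef_indic_nonneg (monotone_restrict hf p) i)
    simp only [Nat.cast_zero, zero_mul, add_zero]
    positivity
  | succ r ih =>
    intro p T hT
    have e := hB.add hα (r + 1) p T hT
    obtain ⟨i, T₀, T₁, rfl, hi, h₀, h₁⟩ := nearGreedy_succ (h := h + r) hT
    have b₀ := ih _ _ h₀
    have b₁ := ih _ _ h₁
    have w := weight_split p f i
    have l := mul_le_mul_of_nonneg_left (leafError_le hf hs hη hℓ hi) hα
    have d := pathError_node f i T₀ T₁ p
    have w' : α * ℓ * weight ((i, false) :: p) f + α * ℓ * weight ((i, true) :: p) f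
        = α * ℓ * p.weight f - α * ℓ * (p.prob * coef (indic (p.restrict f)) i) := by
      rw [← mul_add, w]; ring
    have q : r * (β + α * ℓ * η) * prob ((i, false) :: p)
        + r * (β + α * ℓ * η) * prob ((i, true) :: p) = r * (β + α * ℓ * η) * p.prob := by
      rw [← mul_add, prob_split]
    have d' : r * pathError f (.node i T₀ T₁) p
        = r * pathError f T₀ ((i, false) :: p) + r * pathError f T₁ ((i, true) :: p) := by
      rw [d]; ring
    push_cast
    linarith

/-- With `2 * ℓ * k` more levels and potential at most `k * leafError + s / 2 ^ k`, dividing by the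
number of levels leaves half of the error. -/
lemma ErrorBound.halve (hf : Monotone f)
    (hs : ∃ T : DTree n, T.size ≤ s ∧ T.eval = f) (hη : 0 ≤ η) {ℓ : ℕ} (hℓ : Real.logb 2 s ≤ ℓ)
    (hα : 0 ≤ α) {k : ℕ} (hk : 0 < k) (hℓ' : 0 < ℓ) (hB : ErrorBound f η h α β) :
    ErrorBound f η (h + 2 * ℓ * k) (α / 2) (β + α * (s / 2 ^ k / 2 + ℓ * η)) := by
  intro p T hT
  have m := hB.mul_pathError_le hf hs hη hℓ hα _ p T hT
  obtain ⟨S, hS, e⟩ := exists_tree_restrict hs p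
  have w := mul_le_mul_of_nonneg_left (linWeight_indic_le s S hS k) p.prob_nonneg
  rw [e] at w
  have w' : p.weight f ≤ k * p.leafError f + s / 2 ^ k * p.prob := by
    unfold weight leafError
    linarith
  have hk' : (1 : ℝ) ≤ k := by exact_mod_cast hk
  have hl' : (1 : ℝ) ≤ ℓ := by exact_mod_cast hℓ'
  have c : (0 : ℝ) < (2 * ℓ * k : ℕ) := by push_cast; positivity
  have x := mul_le_mul_of_nonneg_left w' (by positivity : 0 ≤ α * ℓ)
  refine le_of_mul_le_mul_left ?_ c
  -- The division also gives the truncation term a factor `1 / k`, which is discarded.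
  have y : 0 ≤ α * ℓ * (s / 2 ^ k * p.prob) * (k - 1) := by
    have := p.prob_nonneg
    have : 0 ≤ (k : ℝ) - 1 := by linarith
    positivity
  push_cast at m ⊢
  nlinarith

/-- The error of near-greedy trees, by the bound on the linear weight of monotone functions. -/
lemma NearGreedy.boolError_le_sqrt (hf : Monotone f)
    (hs : ∃ T : DTree n, T.size ≤ s ∧ T.eval = f) (hη : 0 ≤ η) (hℓ : Real.logb 2 s ≤ ℓ)
    (hh : 0 < h) {T : DTree n} (hT : NearGreedy f η h [] T) :
    boolError T.eval f ≤ ℓ * √ℓ / (2 * h) + (1 + ℓ) * η := by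
  -- All `h` levels are charged against the height-zero bound, with `α = 1` and `β = η`.
  have m := errorBound_zero.mul_pathError_le hf hs hη hℓ zero_le_one h [] T (by simpa using hT)
  obtain ⟨S, hS, e⟩ := hs
  have w := linWeight_indic_le_sqrt s S hS
  rw [pathError_nil, prob_nil] at m
  have hw : weight ([] : QueryPath n) f = linWeight (indic f) := by
    rw [weight, prob_nil, one_mul]
    rfl
  rw [hw] at m
  rw [e] at w
  have hℓ0 : 0 ≤ ℓ := (logb_natCast_nonneg s).trans hℓ
  have w' : ℓ * linWeight (indic f) ≤ ℓ * (√ℓ / 2) := by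
    apply mul_le_mul_of_nonneg_left _ hℓ0
    have := Real.sqrt_le_sqrt hℓ
    linarith
  have hh' : (0 : ℝ) < h := by exact_mod_cast hh
  refine le_of_mul_le_mul_left ?_ hh'
  have : (h : ℝ) * (ℓ * √ℓ / (2 * h) + (1 + ℓ) * η) = ℓ * (√ℓ / 2) + h * ((1 + ℓ) * η) := by
    field_simp
  rw [this]
  linarith

/-- The additive losses of successive halvings carry factors `1, 1/2, 1/4, …`, so their total stays
below twice one loss. -/
lemma errorBound_iterate (hf : Monotone f)
    (hs : ∃ T : DTree n, T.size ≤ s ∧ T.eval = f) (hη : 0 ≤ η) {ℓ : ℕ} (hℓ : Real.logb 2 s ≤ ℓ)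
    {k : ℕ} (hk : 0 < k) (hℓ' : 0 < ℓ) (a : ℕ) :
    ErrorBound f η (2 * ℓ * k * a) (1 / 2 ^ a)
      (η + (2 - 2 / 2 ^ a) * (s / 2 ^ k / 2 + ℓ * η)) := by
  induction a with
  | zero => simpa using errorBound_zero
  | succ a ih =>
    have := ih.halve hf hs hη hℓ (by positivity) hk hℓ'
    convert this using 1
    · ring
    · rw [pow_succ]; field_simp
    · rw [pow_succ]; field_simp; ring

/-- The error of near-greedy trees, by the edge-isoperimetric bound for small decision trees. -/
lemma NearGreedy.boolError_le_log (hf : Monotone f)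
    (hs : ∃ T : DTree n, T.size ≤ s ∧ T.eval = f) (hη : 0 ≤ η) {ℓ : ℕ} (hℓ : Real.logb 2 s ≤ ℓ)
    {k : ℕ} (hk : 0 < k) (hℓ' : 0 < ℓ) {a : ℕ} {T : DTree n}
    (hT : NearGreedy f η (2 * ℓ * k * a) [] T) :
    boolError T.eval f ≤ 1 / 2 ^ a / 2 + s / 2 ^ k + (1 + 2 * ℓ) * η := by
  have := errorBound_iterate hf hs hη hℓ hk hℓ' a [] T hT
  rw [pathError_nil, prob_nil] at this
  have l : leafError ([] : QueryPath n) f ≤ 1 / 2 := by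
    rw [leafError, prob_nil, one_mul, minority]
    rcases le_total (cubeMean (indic (restrict [] f))) (1 / 2) with h | h
    · exact (min_le_left _ _).trans h
    · exact (min_le_right _ _).trans (by linarith)
  have l' := mul_le_mul_of_nonneg_left l (by positivity : (0 : ℝ) ≤ 1 / 2 ^ a)
  have x : (0 : ℝ) ≤ 2 / 2 ^ a * (s / 2 ^ k / 2 + ℓ * η) := by positivity
  linarith

end Greedy

end Paths

/-! ### Accuracy of empirical frequencies -/

section Sampling

open MeasureTheory ProbabilityTheory

variable {n : ℕ}

instance : IsProbabilityMeasure (uniformSeq n) := by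
  unfold uniformSeq
  infer_instance

lemma integral_uniform (g : (Fin n → Bool) → ℝ) :
    ∫ x, g x ∂(PMF.uniformOfFintype (Fin n → Bool)).toMeasure = cubeMean g := by
  rw [PMF.integral_eq_sum]
  simp [cubeMean, Finset.mul_sum, div_eq_inv_mul]

lemma integral_uniformSeq (g : (Fin n → Bool) → ℝ) (k : ℕ) :
    ∫ ω, g (ω k) ∂(uniformSeq n) = cubeMean g := by
  rw [← integral_uniform]
  have h := measurePreserving_eval_infinitePi
    (fun _ : ℕ => (PMF.uniformOfFintype (Fin n → Bool)).toMeasure) k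
  have := h.map_eq
  rw [← this, integral_map h.measurable.aemeasurable
    (Measurable.of_discrete).aestronglyMeasurable]
  rfl

/-- Hoeffding's inequality for a function of the sample points in a finite set of positions. -/
lemma uniformSeq_sum_ge_le (g : (Fin n → Bool) → ℝ) (c : ℝ) (hg : ∀ x, g x ∈ Set.Icc c (c + 1))
    (s : Finset ℕ) (ε : ℝ) (hε : 0 ≤ ε) :
    (uniformSeq n).real {ω | ε ≤ ∑ k ∈ s, (g (ω k) - cubeMean g)}
      ≤ Real.exp (-2 * ε ^ 2 / s.card) := by
  have ind : iIndepFun (fun (k : ℕ) (ω : ℕ → Fin n → Bool) => g (ω k) - cubeMean g)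
      (uniformSeq n) :=
    iIndepFun_infinitePi (X := fun _ x => g x - cubeMean g) fun _ => Measurable.of_discrete
  have sub : ∀ k ∈ s, HasSubgaussianMGF (fun ω : ℕ → Fin n → Bool => g (ω k) - cubeMean g)
      ((‖(c + 1) - c‖₊ / 2) ^ 2) (uniformSeq n) := by
    intro k _
    have := hasSubgaussianMGF_of_mem_Icc (μ := uniformSeq n) (X := fun ω => g (ω k))
      (a := c) (b := c + 1)
      ((Measurable.of_discrete (f := g)).comp (measurable_pi_apply k)).aemeasurable
      (Filter.Eventually.of_forall fun ω => hg _)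
    rwa [integral_uniformSeq] at this
  have h := HasSubgaussianMGF.measure_sum_ge_le_of_iIndepFun ind sub hε
  refine h.trans (le_of_eq ?_)
  congr 1
  simp
  field_simp

/-- The number of examples in a block of `m` examples which satisfy `S`. -/
def blockCount (S : (Fin n → Bool) → Bool) (m k : ℕ) (ω : ℕ → Fin n → Bool) : ℕ :=
  ((Finset.range m).filter fun j => S (ω (k * m + j)) = true).card

lemma blockCount_eq_sum (S : (Fin n → Bool) → Bool) (m k : ℕ) (ω : ℕ → Fin n → Bool) :
    (blockCount S m k ω : ℝ) = ∑ i ∈ Finset.Ico (k * m) (k * m + m), indic S (ω i) := by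
  rw [Finset.sum_Ico_eq_sum_range]
  simp [blockCount, indic, bitVal]

/-- The one-sided bound for the indicator and for its negative, whence the factor two. -/
lemma blockCount_deviation (S : (Fin n → Bool) → Bool) (m k : ℕ) (hm : 0 < m) (τ : ℝ)
    (hτ : 0 ≤ τ) :
    (uniformSeq n).real {ω | m * τ ≤ |blockCount S m k ω - m * cubeMean (indic S)|}
      ≤ 2 * Real.exp (-2 * m * τ ^ 2) := by
  have hm' : (0 : ℝ) < m := by exact_mod_cast hm
  set I := Finset.Ico (k * m) (k * m + m) with hI
  have hc : I.card = m := by simp [hI]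
  have a := uniformSeq_sum_ge_le (indic S) 0
    (fun x => ⟨bitVal_nonneg _, by simpa [indic] using bitVal_le_one (S x)⟩) I (m * τ) (by positivity)
  have b := uniformSeq_sum_ge_le (fun x => (-1) * indic S x) (-1)
    (fun x => ⟨by simpa [indic] using bitVal_le_one (S x),
      by simpa [indic] using bitVal_nonneg (S x)⟩) I (m * τ) (by positivity)
  rw [cubeMean_mul_left] at b
  rw [hc] at a b
  have e : -2 * (m * τ) ^ 2 / m = -2 * m * τ ^ 2 := by field_simp
  rw [e] at a b
  have s : {ω : ℕ → Fin n → Bool | m * τ ≤ |blockCount S m k ω - m * cubeMean (indic S)|}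
      ⊆ {ω | m * τ ≤ ∑ k ∈ I, (indic S (ω k) - cubeMean (indic S))}
        ∪ {ω | m * τ ≤ ∑ k ∈ I, ((-1) * indic S (ω k) - (-1) * cubeMean (indic S))} := by
    intro ω hω
    simp only [Set.mem_ofPred_eq, Set.mem_union] at hω ⊢
    simp only [Finset.sum_sub_distrib, Finset.sum_const, hc, ← Finset.mul_sum, nsmul_eq_mul]
    rw [blockCount_eq_sum] at hω
    rcases le_abs.1 hω with h | h
    · left; linarith
    · right; linarith
  calc _ ≤ _ := measureReal_mono s
    _ ≤ _ := measureReal_union_le _ _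
    _ ≤ _ := by linarith

/-- The points of a subcube on which `f` has a given value. -/
def cubeEvent (f : (Fin n → Bool) → Bool) (A : Finset (Fin n × Bool)) (b : Bool)
    (x : Fin n → Bool) : Bool := decide (f x = b ∧ ∀ e ∈ A, x e.1 = e.2)

/-- In the first `N` blocks of `m` examples, the frequencies of all subcubes with all labels are
`τ`-accurate. -/
def AccurateSample (f : (Fin n → Bool) → Bool) (N m : ℕ) (τ : ℝ) (ω : ℕ → Fin n → Bool) : Prop :=
  ∀ k < N, ∀ A b, |blockCount (cubeEvent f A b) m k ω - m * cubeMean (indic (cubeEvent f A b))|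
    < m * τ

lemma measurable_blockCount (S : (Fin n → Bool) → Bool) (m k : ℕ) :
    Measurable fun ω => (blockCount S m k ω : ℝ) := by
  simp only [blockCount_eq_sum]
  exact Finset.measurable_sum _ fun i _ =>
    (Measurable.of_discrete (f := indic S)).comp (measurable_pi_apply i)

/-- The union runs over blocks, all `4 ^ n` sets of literals (contradictory ones included) and both
labels. Since no event depends on the learner's choices, paths chosen from earlier examples need no
conditioning. -/
lemma accurateSample_probability (f : (Fin n → Bool) → Bool) (N m : ℕ) (hm : 0 < m) (τ : ℝ)
    (hτ : 0 ≤ τ) :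
    1 - N * 4 ^ n * 4 * Real.exp (-2 * m * τ ^ 2)
      ≤ (uniformSeq n).real {ω | AccurateSample f N m τ ω} := by
  set bad : ℕ × Finset (Fin n × Bool) × Bool → Set (ℕ → Fin n → Bool) := fun i =>
    {ω | m * τ ≤ |blockCount (cubeEvent f i.2.1 i.2.2) m i.1 ω
      - m * cubeMean (indic (cubeEvent f i.2.1 i.2.2))|} with hbad
  set J : Finset (ℕ × Finset (Fin n × Bool) × Bool) := Finset.range N ×ˢ Finset.univ with hJ
  have hcompl : {ω | AccurateSample f N m τ ω} = (⋃ i ∈ J, bad i)ᶜ := by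
    ext ω
    simp [AccurateSample, hJ, hbad]
    grind
  have meas : MeasurableSet (⋃ i ∈ J, bad i) := by
    refine Finset.measurableSet_biUnion _ fun i _ => ?_
    refine measurableSet_le measurable_const ?_
    have := measurable_blockCount (cubeEvent f i.2.1 i.2.2) m i.1
    have := this.sub_const (m * cubeMean (indic (cubeEvent f i.2.1 i.2.2)))
    simpa only [Real.norm_eq_abs] using this.norm
  rw [hcompl, probReal_compl_eq_one_sub meas]
  have u : (uniformSeq n).real (⋃ i ∈ J, bad i)
      ≤ ∑ i ∈ J, (uniformSeq n).real (bad i) := measureReal_biUnion_finset_le _ _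
  have v : ∑ i ∈ J, (uniformSeq n).real (bad i)
      ≤ ∑ i ∈ J, 2 * Real.exp (-2 * m * τ ^ 2) :=
    Finset.sum_le_sum fun i _ => blockCount_deviation _ _ _ hm τ hτ
  have w : ∑ i ∈ J, 2 * Real.exp (-2 * m * τ ^ 2)
      = N * 4 ^ n * 4 * Real.exp (-2 * m * τ ^ 2) := by
    have : J.card = N * (4 ^ n * 2) := by
      simp [hJ, mul_comm n 2, pow_mul]
    rw [Finset.sum_const, this, nsmul_eq_mul]
    push_cast
    ring
  linarith

end Sampling

/-! ### Reasoning about programs -/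

section Programs

variable {n : ℕ} {ex : ℕ → (Fin n → Bool) × Bool}

/-- Started in `σ`, the program `P` halts within `B` units of time in a configuration with `Q`. -/
def RProg.Reaches (ex : ℕ → (Fin n → Bool) × Bool) (P : RProg) (σ : RState) (B : ℕ)
    (Q : RState → Prop) : Prop :=
  ∃ t τ, P.Run ex σ t τ ∧ t ≤ B ∧ Q τ

namespace RProg

variable {P P' : RProg} {σ : RState} {B B' : ℕ} {Q Q' : RState → Prop}

lemma Reaches.mono (h : P.Reaches ex σ B Q) (hB : B ≤ B') (hQ : ∀ τ, Q τ → Q' τ) :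
    P.Reaches ex σ B' Q' := by
  obtain ⟨t, τ, h₁, h₂, h₃⟩ := h
  exact ⟨t, τ, h₁, h₂.trans hB, hQ _ h₃⟩

lemma Reaches.seq (h : P.Reaches ex σ B Q) (h' : ∀ τ, Q τ → P'.Reaches ex τ B' Q') :
    (RProg.seq P P').Reaches ex σ (B + B') Q' := by
  obtain ⟨t, τ, h₁, h₂, h₃⟩ := h
  obtain ⟨u, υ, k₁, k₂, k₃⟩ := h' τ h₃
  exact ⟨t + u, υ, .seq h₁ k₁, by omega, k₃⟩

lemma reaches_skip (h : Q σ) : RProg.skip.Reaches ex σ 1 Q :=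
  ⟨_, _, .skip σ, le_rfl, h⟩

lemma reaches_assign {r : ℕ} {e : RExpr} (h : Q (σ.setReg r (e.eval σ))) :
    (RProg.assign r e).Reaches ex σ (e.cost + 1) Q :=
  ⟨_, _, .assign r e σ, le_rfl, h⟩

lemma reaches_store {a : ℕ} {i e : RExpr} (h : Q (σ.setArr a (i.eval σ) (e.eval σ))) :
    (RProg.store a i e).Reaches ex σ (i.cost + e.cost + 1) Q :=
  ⟨_, _, .store a i e σ, le_rfl, h⟩

lemma reaches_draw {a : ℕ} (h : Q (σ.draw ex a)) :
    (RProg.draw a).Reaches ex σ (n + 2) Q :=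
  ⟨_, _, .draw a σ, le_rfl, h⟩

lemma reaches_emit {e : RExpr} (h : Q (σ.emit (e.eval σ))) :
    (RProg.emit e).Reaches ex σ (e.cost + 1) Q :=
  ⟨_, _, .emit e σ, le_rfl, h⟩

lemma reaches_assign_seq {r : ℕ} {e : RExpr} (h : P.Reaches ex (σ.setReg r (e.eval σ)) B Q) :
    (RProg.seq (.assign r e) P).Reaches ex σ (e.cost + 1 + B) Q :=
  Reaches.seq (Q := fun τ => τ = σ.setReg r (e.eval σ)) (reaches_assign rfl) (by rintro _ rfl; exact h)

lemma reaches_store_seq {a : ℕ} {i e : RExpr}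
    (h : P.Reaches ex (σ.setArr a (i.eval σ) (e.eval σ)) B Q) :
    (RProg.seq (.store a i e) P).Reaches ex σ (i.cost + e.cost + 1 + B) Q :=
  Reaches.seq (Q := fun τ => τ = σ.setArr a (i.eval σ) (e.eval σ)) (reaches_store rfl)
    (by rintro _ rfl; exact h)

lemma reaches_draw_seq {a : ℕ} (h : P.Reaches ex (σ.draw ex a) B Q) :
    (RProg.seq (.draw a) P).Reaches ex σ (n + 2 + B) Q :=
  Reaches.seq (Q := fun τ => τ = σ.draw ex a) (reaches_draw rfl) (by rintro _ rfl; exact h)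

lemma reaches_emit_seq {e : RExpr} (h : P.Reaches ex (σ.emit (e.eval σ)) B Q) :
    (RProg.seq (.emit e) P).Reaches ex σ (e.cost + 1 + B) Q :=
  Reaches.seq (Q := fun τ => τ = σ.emit (e.eval σ)) (reaches_emit rfl) (by rintro _ rfl; exact h)

lemma reaches_ite {e : RExpr} (h : e.eval σ ≠ 0 → P.Reaches ex σ B Q)
    (h' : e.eval σ = 0 → P'.Reaches ex σ B Q) :
    (RProg.ite e P P').Reaches ex σ (e.cost + 1 + B) Q := by
  by_cases he : e.eval σ = 0
  · obtain ⟨t, τ, h₁, h₂, h₃⟩ := h' he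
    exact ⟨_, τ, .ite_false he h₁, by omega, h₃⟩
  · obtain ⟨t, τ, h₁, h₂, h₃⟩ := h he
    exact ⟨_, τ, .ite_true he h₁, by omega, h₃⟩

lemma reaches_while_done {e : RExpr} (he : e.eval σ = 0) (h : Q σ) :
    (RProg.while e P).Reaches ex σ (e.cost + 1) Q :=
  ⟨_, _, .while_false he, le_rfl, h⟩

lemma reaches_while_step {e : RExpr} (he : e.eval σ ≠ 0) (h : P.Reaches ex σ B Q')
    (h' : ∀ τ, Q' τ → (RProg.while e P).Reaches ex τ B' Q) :
    (RProg.while e P).Reaches ex σ (e.cost + 1 + B + B') Q := by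
  obtain ⟨t, τ, h₁, h₂, h₃⟩ := h
  obtain ⟨u, υ, k₁, k₂, k₃⟩ := h' τ h₃
  exact ⟨_, υ, .while_true he h₁ k₁, by omega, k₃⟩

/-- A loop with an invariant that depends on the number of rounds. -/
lemma reaches_while {e : RExpr} (N : ℕ) (I : ℕ → RState → Prop) (h0 : I 0 σ)
    (step : ∀ j < N, ∀ τ, I j τ → e.eval τ ≠ 0 ∧ P.Reaches ex τ B (I (j + 1)))
    (exit : ∀ τ, I N τ → e.eval τ = 0) :
    (RProg.while e P).Reaches ex σ (N * (e.cost + 1 + B) + (e.cost + 1)) (I N) := by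
  have main : ∀ d j, j + d = N → ∀ τ, I j τ →
      (RProg.while e P).Reaches ex τ (d * (e.cost + 1 + B) + (e.cost + 1)) (I N) := by
    intro d
    induction d with
    | zero =>
      intro j hj τ hτ
      obtain rfl : j = N := by omega
      simpa using reaches_while_done (exit τ hτ) hτ
    | succ d ih =>
      intro j hj τ hτ
      obtain ⟨he, hb⟩ := step j (by omega) τ hτ
      exact (reaches_while_step he hb fun υ hυ => ih (j + 1) (by omega) υ hυ).mono
        (le_of_eq (by ring)) fun _ h => h
  exact main N 0 (by omega) σ h0

end RProg

/-! ### State updates, and frames recording what a program leaves untouched. -/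

namespace RState

@[simp] lemma setReg_reg (σ : RState) (r v s : ℕ) :
    (σ.setReg r v).reg s = if s = r then v else σ.reg s := by
  simp [setReg, Function.update_apply]

@[simp] lemma setReg_arr (σ : RState) (r v : ℕ) : (σ.setReg r v).arr = σ.arr := rfl
@[simp] lemma setReg_drawn (σ : RState) (r v : ℕ) : (σ.setReg r v).drawn = σ.drawn := rfl
@[simp] lemma setReg_out (σ : RState) (r v : ℕ) : (σ.setReg r v).out = σ.out := rfl

@[simp] lemma setArr_arr (σ : RState) (a i v b : ℕ) :
    (σ.setArr a i v).arr b = if b = a then Function.update (σ.arr a) i v else σ.arr b := by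
  simp [setArr, Function.update_apply]

@[simp] lemma setArr_reg (σ : RState) (a i v : ℕ) : (σ.setArr a i v).reg = σ.reg := rfl
@[simp] lemma setArr_drawn (σ : RState) (a i v : ℕ) : (σ.setArr a i v).drawn = σ.drawn := rfl
@[simp] lemma setArr_out (σ : RState) (a i v : ℕ) : (σ.setArr a i v).out = σ.out := rfl
@[simp] lemma emit_arr (σ : RState) (v : ℕ) : (σ.emit v).arr = σ.arr := rfl
@[simp] lemma emit_reg (σ : RState) (v : ℕ) : (σ.emit v).reg = σ.reg := rfl
@[simp] lemma emit_drawn (σ : RState) (v : ℕ) : (σ.emit v).drawn = σ.drawn := rfl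
@[simp] lemma emit_out (σ : RState) (v : ℕ) : (σ.emit v).out = σ.out ++ [v] := rfl
@[simp] lemma draw_reg (σ : RState) (a : ℕ) : (σ.draw ex a).reg = σ.reg := rfl
@[simp] lemma draw_drawn (σ : RState) (a : ℕ) : (σ.draw ex a).drawn = σ.drawn + 1 := rfl
@[simp] lemma draw_out (σ : RState) (a : ℕ) : (σ.draw ex a).out = σ.out := rfl

lemma draw_arr_of_ne (σ : RState) {a b : ℕ} (h : b ≠ a) : (σ.draw ex a).arr b = σ.arr b := by
  simp [draw, h]

/-- `τ` differs from `σ` at most in the registers of `R`, in the arrays of `A` and in the number of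
examples drawn. -/
structure Frame (R A : List ℕ) (σ τ : RState) : Prop where
  reg : ∀ r, r ∉ R → τ.reg r = σ.reg r
  arr : ∀ a, a ∉ A → τ.arr a = σ.arr a
  out : τ.out = σ.out

variable {R A R' A' : List ℕ} {σ τ υ : RState}

lemma Frame.refl : Frame R A σ σ := ⟨fun _ _ => rfl, fun _ _ => rfl, rfl⟩

lemma Frame.trans (h : Frame R A σ τ) (h' : Frame R A τ υ) : Frame R A σ υ :=
  ⟨fun r hr => (h'.reg r hr).trans (h.reg r hr), fun a ha => (h'.arr a ha).trans (h.arr a ha),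
    h'.out.trans h.out⟩

lemma Frame.mono (h : Frame R A σ τ) (hR : R ⊆ R') (hA : A ⊆ A') : Frame R' A' σ τ :=
  ⟨fun r hr => h.reg r fun h => hr (hR h), fun a ha => h.arr a fun h => ha (hA h), h.out⟩

lemma Frame.setReg (h : Frame R A σ τ) {r : ℕ} (hr : r ∈ R) (v : ℕ) :
    Frame R A σ (τ.setReg r v) :=
  ⟨fun s hs => by
    have : s ≠ r := fun e => hs (e ▸ hr)
    simp [this, h.reg s hs], h.arr, h.out⟩

lemma Frame.setArr (h : Frame R A σ τ) {a : ℕ} (ha : a ∈ A) (i v : ℕ) :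
    Frame R A σ (τ.setArr a i v) :=
  ⟨h.reg, fun b hb => by
    have : b ≠ a := fun e => hb (e ▸ ha)
    simp [this, h.arr b hb], h.out⟩

lemma Frame.draw (h : Frame R A σ τ) {a : ℕ} (ha : a ∈ A) :
    Frame R A σ (τ.draw ex a) :=
  ⟨h.reg, fun b hb => by
    have : b ≠ a := fun e => hb (e ▸ ha)
    rw [draw_arr_of_ne _ this, h.arr b hb], h.out⟩

end RState

/-! ### Counting the examples that follow a path -/

open RProg RState

/-- Sequential composition of programs. -/
infixr:60 " ;; " => RProg.seq

/-- An expression that is nonzero when the values of its arguments differ. -/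
def RExpr.neq (e₁ e₂ : RExpr) : RExpr := .add (.sub e₁ e₂) (.sub e₂ e₁)

lemma RExpr.eval_neq_eq_zero (σ : RState) (e₁ e₂ : RExpr) :
    (RExpr.neq e₁ e₂).eval σ = 0 ↔ e₁.eval σ = e₂.eval σ := by
  simp only [RExpr.neq, RExpr.eval]
  omega

/-- The `j`-th symbol of an example; the label is the last one. -/
def exampleSymbol (e : (Fin n → Bool) × Bool) (j : ℕ) : ℕ :=
  if h : j < n then (e.1 ⟨j, h⟩).toNat else e.2.toNat

lemma draw_arr_self (σ : RState) (a : ℕ) {j : ℕ} (hj : j ≤ n) :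
    (σ.draw ex a).arr a j = exampleSymbol (ex σ.drawn) j := by
  rcases hj.lt_or_eq with h | h
  · simp [RState.draw, exampleSymbol, h]
  · simp [RState.draw, exampleSymbol, h]

/-- Draw an example and let `r₁₇` say whether it agrees with the first `r₉` entries of the stack:
array `1` holds positions in the example, and array `2` the symbols required there. -/
def testProg : RProg :=
  .draw 0 ;; .assign 17 (.const 1) ;; .assign 18 (.reg 9) ;;
  .while (.reg 18) (.assign 18 (.sub (.reg 18) (.const 1)) ;;
    .ite (.neq (.get 0 (.get 1 (.reg 18))) (.get 2 (.reg 18))) (.assign 17 (.const 0)) .skip)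

open Classical in
lemma testProg_spec (σ : RState) (hpos : ∀ j < σ.reg 9, σ.arr 1 j ≤ n) :
    testProg.Reaches ex σ (n + 30 + 30 * σ.reg 9) fun τ =>
      Frame [17, 18] [0] σ τ ∧ τ.drawn = σ.drawn + 1 ∧
      τ.reg 17 = if ∀ j < σ.reg 9, exampleSymbol (ex σ.drawn) (σ.arr 1 j) = σ.arr 2 j
        then 1 else 0 := by
  set L := σ.reg 9 with hL
  set X := (σ.draw ex 0).arr 0 with hX
  refine Reaches.mono (reaches_draw_seq (reaches_assign_seq (reaches_assign_seq
    (reaches_while (B := 20) L (fun i τ => Frame [17, 18] [0] σ τ ∧ τ.drawn = σ.drawn + 1 ∧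
      τ.arr 0 = X ∧ τ.reg 18 = L - i ∧
      τ.reg 17 = if ∀ j < L, L - i ≤ j → exampleSymbol (ex σ.drawn) (σ.arr 1 j) = σ.arr 2 j
        then 1 else 0) ?_ ?_ ?_)))) ?_ ?_
  · refine ⟨?_, rfl, rfl, ?_, ?_⟩
    · exact ((Frame.refl.draw (by simp)).setReg (by simp) _).setReg (by simp) _
    · simp [RExpr.eval, hL]
    · rw [if_pos (by intro j h₁ h₂; omega)]
      simp [RExpr.eval]
  · rintro i hi τ ⟨fr, hd, hx, h18, h17⟩
    refine ⟨by simp only [RExpr.eval]; omega, ?_⟩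
    refine (reaches_assign_seq (B := 16) (Reaches.mono (reaches_ite (B := 2)
      (fun he => reaches_assign ?_) (fun he => (reaches_skip ?_).mono (by norm_num)
        fun _ h => h)) ?_ fun _ h => h)).mono ?_ fun _ h => h
    · refine ⟨(fr.setReg (by simp) _).setReg (by simp) _, hd, hx, ?_, ?_⟩
      · simp [RExpr.eval, h18]; omega
      · rw [ne_eq, RExpr.eval_neq_eq_zero] at he
        simp only [RExpr.eval, setReg_reg, setReg_arr, h18, if_true, fr.arr 1 (by simp),
          fr.arr 2 (by simp), hx] at he
        rw [if_neg]
        · simp [RExpr.eval]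
        · intro h
          apply he
          have := h (L - i - 1) (by omega) (by omega)
          rwa [hX, draw_arr_self _ _ (hpos _ (by omega))]
    · refine ⟨fr.setReg (by simp) _, hd, hx, ?_, ?_⟩
      · simp [RExpr.eval, h18]; omega
      · rw [RExpr.eval_neq_eq_zero] at he
        simp only [RExpr.eval, setReg_reg, setReg_arr, h18, if_true, fr.arr 1 (by simp),
          fr.arr 2 (by simp), hx] at he
        rw [hX, draw_arr_self _ _ (hpos _ (by omega))] at he
        simp only [setReg_reg, h17]
        rw [if_neg (by norm_num)]
        congr 1
        apply propext
        constructor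
        · intro h j hj hj'
          by_cases e : j = L - i - 1
          · rw [e]; exact he
          · exact h j hj (by omega)
        · intro h j hj hj'
          exact h j hj (by omega)
    · simp [RExpr.cost, RExpr.neq]
    · simp [RExpr.cost]
  · rintro τ ⟨-, -, -, h, -⟩
    simp [RExpr.eval, h]
  · simp only [RExpr.cost]
    omega
  · rintro τ ⟨fr, hd, -, -, h⟩
    refine ⟨fr, hd, ?_⟩
    rw [h]
    simp

/-- Count in `r₁₅` how many of `r₈` fresh examples agree with the stack. -/
def countProg : RProg :=
  .assign 15 (.const 0) ;; .assign 16 (.reg 8) ;;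
  .while (.reg 16) (.assign 16 (.sub (.reg 16) (.const 1)) ;; testProg ;;
    .assign 15 (.add (.reg 15) (.reg 17)))

open Classical in
lemma countProg_spec (σ : RState) (hpos : ∀ j < σ.reg 9, σ.arr 1 j ≤ n) :
    countProg.Reaches ex σ (10 + σ.reg 8 * (n + 50 + 30 * σ.reg 9)) fun τ =>
      Frame [15, 16, 17, 18] [0] σ τ ∧ τ.drawn = σ.drawn + σ.reg 8 ∧
      τ.reg 15 = ((Finset.range (σ.reg 8)).filter fun i => ∀ j < σ.reg 9,
        exampleSymbol (ex (σ.drawn + i)) (σ.arr 1 j) = σ.arr 2 j).card := by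
  set m := σ.reg 8 with hm
  refine Reaches.mono (reaches_assign_seq (reaches_assign_seq
    (reaches_while (B := n + 40 + 30 * σ.reg 9) m
      (fun i τ => Frame [15, 16, 17, 18] [0] σ τ ∧ τ.drawn = σ.drawn + i ∧
      τ.reg 16 = m - i ∧ τ.reg 15 = ((Finset.range i).filter fun i => ∀ j < σ.reg 9,
        exampleSymbol (ex (σ.drawn + i)) (σ.arr 1 j) = σ.arr 2 j).card) ?_ ?_ ?_))) ?_ ?_
  · refine ⟨(Frame.refl.setReg (by simp) _).setReg (by simp) _, by simp, ?_, ?_⟩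
    · simp [RExpr.eval, hm]
    · simp [RExpr.eval]
  · rintro i hi τ ⟨fr, hd, h16, h15⟩
    refine ⟨by simp only [RExpr.eval]; omega, ?_⟩
    set τ' := τ.setReg 16 (RExpr.eval τ (.sub (.reg 16) (.const 1))) with hτ'
    have fr' : Frame [15, 16, 17, 18] [0] σ τ' := fr.setReg (by simp) _
    have h9 : τ'.reg 9 = σ.reg 9 := fr'.reg 9 (by simp)
    have ha1 : τ'.arr 1 = σ.arr 1 := fr'.arr 1 (by simp)
    have ha2 : τ'.arr 2 = σ.arr 2 := fr'.arr 2 (by simp)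
    have hd' : τ'.drawn = σ.drawn + i := hd
    have sp := testProg_spec (ex := ex) τ' (by rw [h9, ha1]; exact hpos)
    rw [h9, ha1, ha2, hd'] at sp
    refine (reaches_assign_seq (Reaches.seq sp fun υ hυ => reaches_assign ?_)).mono ?_ fun _ h => h
    · obtain ⟨fu, du, ru⟩ := hυ
      refine ⟨(fr'.trans (fu.mono (by simp) (by simp))).setReg (by simp) _, by simp; omega, ?_, ?_⟩
      · have : υ.reg 16 = m - (i + 1) := by
          rw [fu.reg 16 (by simp), hτ']
          simp [RExpr.eval, h16]; omega
        simpa using this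
      · have e15 : υ.reg 15 = τ.reg 15 := by
          rw [fu.reg 15 (by simp), hτ']; simp
        rw [Finset.range_add_one, Finset.filter_insert]
        simp only [setReg_reg, if_true, RExpr.eval, e15, h15, ru]
        split_ifs with h
        · rw [Finset.card_insert_of_notMem (by simp)]
        · rfl
    · simp only [RExpr.cost]
      omega
  · rintro τ ⟨-, -, h, -⟩
    simp [RExpr.eval, h]
  · simp only [RExpr.cost]
    have : m * (1 + 1 + (n + 40 + 30 * σ.reg 9)) ≤ m * (n + 50 + 30 * σ.reg 9) :=
      Nat.mul_le_mul_left _ (by omega)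
    omega
  · rintro τ ⟨fr, hd, -, h⟩
    exact ⟨fr, hd, h⟩

/-- The arrays `a` and `b` hold the stack for the path `p` and the label `c`. -/
def IsStack (a b : ℕ → ℕ) (c : Bool) : QueryPath n → Prop
  | [] => a 0 = n ∧ b 0 = c.toNat
  | (i, v) :: p => a (p.length + 1) = i ∧ b (p.length + 1) = v.toNat ∧ IsStack a b c p

lemma IsStack.congr {a b a' b' : ℕ → ℕ} {c : Bool} {p : QueryPath n}
    (h : IsStack a b c p) (ha : ∀ j ≤ p.length, a' j = a j) (hb : ∀ j ≤ p.length, b' j = b j) :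
    IsStack a' b' c p := by
  induction p with
  | nil => exact ⟨(ha 0 le_rfl).trans h.1, (hb 0 le_rfl).trans h.2⟩
  | cons e p ih =>
    simp only [List.length_cons] at ha hb
    refine ⟨?_, ?_, ih h.2.2 (fun j hj => ha j (by omega)) fun j hj => hb j (by omega)⟩
    · rw [ha _ le_rfl]; exact h.1
    · rw [hb _ le_rfl]; exact h.2.1

lemma IsStack.congr_label {a b b' : ℕ → ℕ} {c c' : Bool} {p : QueryPath n}
    (h : IsStack a b c p) (h0 : b' 0 = c'.toNat) (hb : ∀ j, j ≠ 0 → b' j = b j) :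
    IsStack a b' c' p := by
  induction p with
  | nil => exact ⟨h.1, h0⟩
  | cons e p ih => exact ⟨h.1, by rw [hb _ (by omega)]; exact h.2.1, ih h.2.2⟩

lemma IsStack.le {a b : ℕ → ℕ} {c : Bool} {p : QueryPath n}
    (h : IsStack a b c p) : ∀ j < p.length + 1, a j ≤ n := by
  induction p with
  | nil =>
    intro j hj
    obtain rfl : j = 0 := by simp at hj; omega
    exact h.1.le
  | cons e p ih =>
    intro j hj
    rcases Nat.lt_succ_iff_lt_or_eq.1 hj with hj | rfl
    · exact ih h.2.2 j hj
    · rw [List.length_cons, h.1]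
      exact e.1.2.le

/-- The bottom entry of the stack points at position `n`, where an example keeps its label. One
comparison loop therefore tests label and path together. -/
lemma IsStack.agree_iff {a b : ℕ → ℕ} {c : Bool} {p : QueryPath n}
    (h : IsStack a b c p) (e : (Fin n → Bool) × Bool) :
    (∀ j < p.length + 1, exampleSymbol e (a j) = b j) ↔ e.2 = c ∧ p.Follows e.1 := by
  have tn : ∀ u v : Bool, u.toNat = v.toNat ↔ u = v := by decide
  induction p with
  | nil =>
    have h1 := h.1
    have h2 := h.2
    simp [h1, h2, exampleSymbol, QueryPath.follows_nil, tn]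
  | cons d p ih =>
    have h1 := h.1
    have h2 := h.2.1
    rw [QueryPath.follows_cons]
    constructor
    · intro H
      have k := (ih h.2.2).1 fun j hj => H j (by simp; omega)
      have l := H (p.length + 1) (by simp)
      rw [h1, h2] at l
      simp [exampleSymbol, tn] at l
      exact ⟨k.1, l, k.2⟩
    · rintro ⟨h3, h4, h5⟩ j hj
      rcases Nat.lt_succ_iff_lt_or_eq.1 hj with hj | rfl
      · exact (ih h.2.2).2 ⟨h3, h5⟩ j hj
      · rw [List.length_cons, h1, h2]
        simp [exampleSymbol, h4]

lemma IsStack.mem_iff {a b : ℕ → ℕ} {c : Bool} {p : QueryPath n}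
    (h : IsStack a b c p) (i : Fin n) :
    (∃ j < p.length + 1, a j = i) ↔ i ∈ p.map Prod.fst := by
  induction p with
  | nil =>
    have := i.2
    have h1 := h.1
    simp [h1]
    omega
  | cons d p ih =>
    have h1 := h.1
    rw [List.map_cons, List.mem_cons, ← ih h.2.2]
    constructor
    · rintro ⟨j, hj, e⟩
      rcases Nat.lt_succ_iff_lt_or_eq.1 hj with hj | rfl
      · exact Or.inr ⟨j, hj, e⟩
      · rw [List.length_cons, h1] at e
        exact Or.inl (Fin.ext e.symm)
    · rintro (rfl | ⟨j, hj, e⟩)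
      · exact ⟨p.length + 1, by simp, h1⟩
      · exact ⟨j, by simp; omega, e⟩

/-- The invariant `drawn = k * m` identifies the machine's count with `blockCount` of the `k`-th
block. -/
lemma countProg_spec_stack {f : (Fin n → Bool) → Bool} {ω : ℕ → Fin n → Bool} {σ : RState}
    {p : QueryPath n} {c : Bool} {m k : ℕ} (hm : σ.reg 8 = m) (hL : σ.reg 9 = p.length + 1)
    (hS : IsStack (σ.arr 1) (σ.arr 2) c p) (hd : σ.drawn = k * m) :
    countProg.Reaches (fun i => (ω i, f (ω i))) σ (10 + m * (n + 80 + 30 * p.length)) fun τ =>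
      Frame [15, 16, 17, 18] [0] σ τ ∧ τ.drawn = (k + 1) * m ∧
      τ.reg 15 = blockCount (cubeEvent f p.toFinset c) m k ω := by
  refine (countProg_spec σ (by rw [hL]; exact hS.le)).mono ?_ ?_
  · rw [hm, hL]
    exact le_of_eq (by ring)
  · rintro τ ⟨fr, h, h'⟩
    refine ⟨fr, by rw [h, hd, hm]; ring, ?_⟩
    rw [h', hm, blockCount]
    congr 1
    apply Finset.filter_congr
    intro i _
    rw [hL, hS.agree_iff, hd]
    simp [cubeEvent, QueryPath.Follows]

end Programs

/-! ### Choosing a variable -/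

section Choice

variable {n : ℕ} {ex : ℕ → (Fin n → Bool) × Bool}

open RProg RState

/-- Set `r₁₅` to zero if the position `r₁₂` occurs among the first `r₉` entries of the stack. -/
def discardProg : RProg :=
  .assign 18 (.reg 9) ;; .while (.reg 18) (.assign 18 (.sub (.reg 18) (.const 1)) ;;
    .ite (.neq (.get 1 (.reg 18)) (.reg 12)) .skip (.assign 15 (.const 0)))

open Classical in
lemma discardProg_spec (σ : RState) :
    discardProg.Reaches ex σ (4 + 30 * σ.reg 9) fun τ =>
      Frame [15, 18] [] σ τ ∧ τ.drawn = σ.drawn ∧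
      τ.reg 15 = if ∃ j < σ.reg 9, σ.arr 1 j = σ.reg 12 then 0 else σ.reg 15 := by
  set L := σ.reg 9 with hL
  refine Reaches.mono (reaches_assign_seq
    (reaches_while (B := 20) L (fun i τ => Frame [15, 18] [] σ τ ∧ τ.drawn = σ.drawn ∧
      τ.reg 18 = L - i ∧
      τ.reg 15 = if ∃ j < L, L - i ≤ j ∧ σ.arr 1 j = σ.reg 12 then 0 else σ.reg 15)
      ?_ ?_ ?_)) ?_ ?_
  · refine ⟨Frame.refl.setReg (by simp) _, rfl, by simp [RExpr.eval, hL], ?_⟩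
    rw [if_neg (by rintro ⟨j, h₁, h₂, -⟩; omega)]
    simp
  · rintro i hi τ ⟨fr, hd, h18, h15⟩
    refine ⟨by simp only [RExpr.eval]; omega, ?_⟩
    refine (reaches_assign_seq (reaches_ite (B := 2)
      (fun he => (reaches_skip ?_).mono (by norm_num) fun _ h => h)
      (fun he => reaches_assign ?_))).mono (by simp [RExpr.cost, RExpr.neq]) fun _ h => h
    · refine ⟨fr.setReg (by simp) _, hd, ?_, ?_⟩
      · simp [RExpr.eval, h18]; omega
      · rw [ne_eq, RExpr.eval_neq_eq_zero] at he
        simp only [RExpr.eval, setReg_reg, setReg_arr, h18, if_true, fr.arr 1 (by simp)] at he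
        rw [if_neg (by norm_num), fr.reg 12 (by simp)] at he
        simp only [setReg_reg, h15]
        rw [if_neg (by norm_num)]
        congr 1
        apply propext
        constructor
        · rintro ⟨j, hj, hj', e⟩
          exact ⟨j, hj, by omega, e⟩
        · rintro ⟨j, hj, hj', e⟩
          by_cases e' : j = L - i - 1
          · rw [e'] at e; exact absurd e he
          · exact ⟨j, hj, by omega, e⟩
    · refine ⟨(fr.setReg (by simp) _).setReg (by simp) _, hd, ?_, ?_⟩
      · simp [RExpr.eval, h18]; omega
      · rw [RExpr.eval_neq_eq_zero] at he
        simp only [RExpr.eval, setReg_reg, setReg_arr, h18, if_true, fr.arr 1 (by simp)] at he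
        rw [if_neg (by norm_num), fr.reg 12 (by simp)] at he
        rw [if_pos ⟨L - i - 1, by omega, by omega, he⟩]
        simp [RExpr.eval]
  · rintro τ ⟨-, -, h, -⟩
    simp [RExpr.eval, h]
  · simp only [RExpr.cost]
    omega
  · rintro τ ⟨fr, hd, -, h⟩
    refine ⟨fr, hd, ?_⟩
    rw [h]
    simp

variable {f : (Fin n → Bool) → Bool} {ω : ℕ → Fin n → Bool} {p : QueryPath n} {m : ℕ}

/-- The score of a variable at the end of a path: the number of positive examples in the `k`-th block
that follow the path and have a `1` there. Variables on the path have score zero. -/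
def variableScore (f : (Fin n → Bool) → Bool) (ω : ℕ → Fin n → Bool) (p : QueryPath n)
    (m k : ℕ) (i : Fin n) : ℕ :=
  if i ∈ p.map Prod.fst then 0
  else blockCount (cubeEvent f (List.toFinset ((i, true) :: p)) true) m k ω

/-- Compute in `r₁₅` the score of the variable `r₁₂`. -/
def scoreProg : RProg :=
  .store 1 (.reg 9) (.reg 12) ;; .store 2 (.reg 9) (.const 1) ;;
  .assign 9 (.add (.reg 9) (.const 1)) ;; countProg ;;
  .assign 9 (.sub (.reg 9) (.const 1)) ;; discardProg

lemma scoreProg_spec {σ : RState} {k : ℕ} (hm : σ.reg 8 = m)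
    (hL : σ.reg 9 = p.length + 1) (hS : IsStack (σ.arr 1) (σ.arr 2) true p)
    (hd : σ.drawn = k * m) (i : Fin n) (hi : σ.reg 12 = i) :
    scoreProg.Reaches (fun i => (ω i, f (ω i))) σ
      (100 + 30 * p.length + m * (n + 110 + 30 * p.length)) fun τ =>
      Frame [9, 15, 16, 17, 18] [0, 1, 2] σ τ ∧ τ.reg 9 = p.length + 1 ∧
      IsStack (τ.arr 1) (τ.arr 2) true p ∧ τ.drawn = (k + 1) * m ∧
      τ.reg 15 = variableScore f ω p m k i := by
  set τ := ((σ.setArr 1 (σ.reg 9) (σ.reg 12)).setArr 2 (σ.reg 9) 1).setReg 9 (σ.reg 9 + 1) with hτ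
  have fr : Frame [9, 15, 16, 17, 18] [0, 1, 2] σ τ :=
    ((Frame.refl.setArr (by simp) _ _).setArr (by simp) _ _).setReg (by simp) _
  have hS' : IsStack (τ.arr 1) (τ.arr 2) true p := by
    refine hS.congr (fun j hj => ?_) (fun j hj => ?_)
    · simp [hτ, hL, show j ≠ p.length + 1 by omega]
    · simp [hτ, hL, show j ≠ p.length + 1 by omega]
  -- The candidate is pushed with answer `1` only for the count. The push may repeat a variable of
  -- `p`; such a score is zeroed afterwards.
  have hS₂ : IsStack (τ.arr 1) (τ.arr 2) true ((i, true) :: p : QueryPath n) :=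
    ⟨by simp [hτ, hL, hi], by simp [hτ, hL], hS'⟩
  have sp := countProg_spec_stack (σ := τ) (f := f) (ω := ω) (p := (i, true) :: p) (c := true)
    (m := m) (k := k) (by simp [hτ, hm]) (by simp [hτ, hL]) hS₂ (by simp [hτ, hd])
  have main := Reaches.seq sp (P' := .assign 9 (.sub (.reg 9) (.const 1)) ;; discardProg)
    (Q' := fun υ => Frame [9, 15, 16, 17, 18] [0, 1, 2] σ υ ∧ υ.reg 9 = p.length + 1 ∧
      IsStack (υ.arr 1) (υ.arr 2) true p ∧ υ.drawn = (k + 1) * m ∧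
      υ.reg 15 = variableScore f ω p m k i) (B' := 50 + 30 * p.length) (by
    rintro υ ⟨fu, du, ru⟩
    have u9 : υ.reg 9 = p.length + 2 := by rw [fu.reg 9 (by simp)]; simp [hτ, hL]
    set υ' := υ.setReg 9 (RExpr.eval υ (.sub (.reg 9) (.const 1))) with hυ'
    have v9 : υ'.reg 9 = p.length + 1 := by simp [hυ', RExpr.eval, u9]
    have fv : Frame [9, 15, 16, 17, 18] [0, 1, 2] σ υ' :=
      (fr.trans (fu.mono (by simp) (by simp))).setReg (by simp) _
    have hSv : IsStack (υ'.arr 1) (υ'.arr 2) true p := by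
      simpa [hυ', fu.arr 1 (by simp), fu.arr 2 (by simp)] using hS'
    refine (reaches_assign_seq (discardProg_spec υ')).mono ?_ ?_
    · rw [v9]; simp only [RExpr.cost]; omega
    · rintro ψ ⟨fp, dp, rp⟩
      refine ⟨fv.trans (fp.mono (by simp) (by simp)), ?_, ?_, ?_, ?_⟩
      · rw [fp.reg 9 (by simp), v9]
      · simpa [fp.arr 1 (by simp), fp.arr 2 (by simp)] using hSv
      · rw [dp]; exact du
      · rw [rp, v9, fv.reg 12 (by simp), hi, variableScore]
        simp only [hSv.mem_iff i]
        congr 1)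
  refine (reaches_store_seq (reaches_store_seq (reaches_assign_seq main))).mono ?_ fun _ h => h
  simp only [RExpr.cost, List.length_cons]
  have : m * (n + 80 + 30 * (p.length + 1)) = m * (n + 110 + 30 * p.length) := by ring
  omega

/-- Find in `r₁₃` a variable of maximal score. -/
def chooseProg : RProg :=
  .assign 13 (.const 0) ;; .assign 14 (.const 0) ;; .assign 12 (.reg 0) ;;
  .while (.reg 12) (.assign 12 (.sub (.reg 12) (.const 1)) ;; scoreProg ;;
    .ite (.sub (.reg 15) (.reg 14)) (.assign 13 (.reg 12) ;; .assign 14 (.reg 15)) .skip)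

/-- The scores computed from `n` successive blocks are, up to the exclusion of the variables on the
path, at most `v`, and `v` is the score of the variable `i` unless it vanishes. -/
def IsBestScore (f : (Fin n → Bool) → Bool) (ω : ℕ → Fin n → Bool) (p : QueryPath n)
    (m k t i v : ℕ) : Prop :=
  (∀ j : Fin n, n ≤ j + t → variableScore f ω p m (k + (n - 1 - j)) j ≤ v) ∧
    (v = 0 ∨ ∃ j : Fin n, i = j ∧ v = variableScore f ω p m (k + (n - 1 - j)) j)

/-- The scan runs from variable `n - 1` down to `0`, so variable `j` is scored on block `k + (n - 1
- j)`. If every score vanishes, the default variable `0` remains; it exists as `n` is positive. -/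
lemma chooseProg_spec {σ : RState} {k : ℕ} (hn : 0 < n) (h0 : σ.reg 0 = n) (hm : σ.reg 8 = m)
    (hL : σ.reg 9 = p.length + 1) (hS : IsStack (σ.arr 1) (σ.arr 2) true p)
    (hd : σ.drawn = k * m) :
    chooseProg.Reaches (fun i => (ω i, f (ω i))) σ
      (20 + n * (150 + 30 * p.length + m * (n + 110 + 30 * p.length))) fun τ =>
      Frame [9, 12, 13, 14, 15, 16, 17, 18] [0, 1, 2] σ τ ∧ τ.reg 9 = p.length + 1 ∧
      IsStack (τ.arr 1) (τ.arr 2) true p ∧ τ.drawn = (k + n) * m ∧ τ.reg 13 < n ∧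
      IsBestScore f ω p m k n (τ.reg 13) (τ.reg 14) := by
  refine Reaches.mono (reaches_assign_seq (reaches_assign_seq (reaches_assign_seq
    (reaches_while (B := 130 + 30 * p.length + m * (n + 110 + 30 * p.length)) n (fun t τ =>
      Frame [9, 12, 13, 14, 15, 16, 17, 18] [0, 1, 2] σ τ ∧ τ.reg 9 = p.length + 1 ∧
      IsStack (τ.arr 1) (τ.arr 2) true p ∧ τ.drawn = (k + t) * m ∧ τ.reg 13 < n ∧
      τ.reg 12 = n - t ∧ IsBestScore f ω p m k t (τ.reg 13) (τ.reg 14)) ?_ ?_ ?_)))) ?_ ?_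
  · refine ⟨((Frame.refl.setReg (by simp) _).setReg (by simp) _).setReg (by simp) _, ?_, hS, ?_,
      ?_, ?_, ?_, ?_⟩
    · simp [hL]
    · simpa using hd
    · simpa [RExpr.eval] using hn
    · simp [RExpr.eval, h0]
    · intro j hj
      have := j.2
      omega
    · simp [RExpr.eval]
  · rintro t ht τ ⟨fr, h9, hSt, hdt, h13, h12, hb⟩
    refine ⟨by simp only [RExpr.eval]; omega, ?_⟩
    set τ' := τ.setReg 12 (RExpr.eval τ (.sub (.reg 12) (.const 1))) with hτ'
    have fr' : Frame [9, 12, 13, 14, 15, 16, 17, 18] [0, 1, 2] σ τ' := fr.setReg (by simp) _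
    have hi : n - 1 - t < n := by omega
    have e12 : τ'.reg 12 = n - 1 - t := by
      simp [hτ', RExpr.eval, h12]; omega
    have sp := scoreProg_spec (f := f) (ω := ω) (σ := τ') (p := p) (m := m) (k := k + t)
      (by rw [fr'.reg 8 (by simp), hm]) (by simp [hτ', h9]) hSt hdt ⟨n - 1 - t, hi⟩ e12
    refine (reaches_assign_seq (Reaches.seq sp (B' := 10) ?_)).mono ?_ fun _ h => h
    · rintro υ ⟨fu, u9, uS, ud, u15⟩
      have fu' : Frame [9, 12, 13, 14, 15, 16, 17, 18] [0, 1, 2] σ υ :=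
        fr'.trans (fu.mono (by simp) (by simp))
      have u12 : υ.reg 12 = n - 1 - t := by rw [fu.reg 12 (by simp), e12]
      have u13 : υ.reg 13 = τ.reg 13 := by rw [fu.reg 13 (by simp)]; simp [hτ']
      have u14 : υ.reg 14 = τ.reg 14 := by rw [fu.reg 14 (by simp)]; simp [hτ']
      have kt : k + (n - 1 - (n - 1 - t)) = k + t := by omega
      have sc : υ.reg 15 = variableScore f ω p m (k + (n - 1 - (⟨n - 1 - t, hi⟩ : Fin n)))
          ⟨n - 1 - t, hi⟩ := by rw [u15]; simp only [kt]
      have cases : ∀ j : Fin n, n ≤ j + (t + 1) → n ≤ j + t ∨ j = ⟨n - 1 - t, hi⟩ := by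
        intro j hj
        by_cases e : n ≤ j + t
        · exact Or.inl e
        · exact Or.inr (Fin.ext (by simp; omega))
      refine (reaches_ite (B := 4) (fun he => ?_) (fun he => ?_)).mono
        (by simp [RExpr.cost]) fun _ h => h
      · refine (reaches_assign_seq (reaches_assign ?_)).mono (by simp [RExpr.cost]) fun _ h => h
        simp only [RExpr.eval] at he
        refine ⟨(fu'.setReg (by simp) _).setReg (by simp) _, by simpa using u9, by simpa using uS,
          by simpa [add_assoc] using ud, ?_, ?_, ?_, ?_⟩
        · simp [RExpr.eval, u12]; omega
        · simp [u12]; omega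
        · intro j hj
          simp only [setReg_reg, RExpr.eval, if_true]
          rw [if_neg (by norm_num)]
          rcases cases j hj with h | rfl
          · have := hb.1 j h
            omega
          · exact sc.ge
        · right
          exact ⟨⟨n - 1 - t, hi⟩, by simp [RExpr.eval, u12], by simpa [RExpr.eval] using sc⟩
      · refine (reaches_skip ?_).mono (by norm_num) fun _ h => h
        simp only [RExpr.eval] at he
        refine ⟨fu', u9, uS, by simpa [add_assoc] using ud, by omega, by omega, ?_, ?_⟩
        · intro j hj
          rw [u14]
          rcases cases j hj with h | rfl
          · exact hb.1 j h
          · rw [← sc]; omega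
        · rw [u13, u14]
          exact hb.2
    · simp only [RExpr.cost]
      omega
  · rintro τ ⟨-, -, -, -, -, h, -⟩
    simp [RExpr.eval, h]
  · simp only [RExpr.cost]
    have : n * (1 + 1 + (130 + 30 * p.length + m * (n + 110 + 30 * p.length)))
        ≤ n * (150 + 30 * p.length + m * (n + 110 + 30 * p.length)) :=
      Nat.mul_le_mul_left _ (by omega)
    omega
  · rintro τ ⟨fr, h9, hS', hd', h13, -, hb⟩
    exact ⟨fr, h9, hS', hd', h13, hb⟩

end Choice

/-! ### Growing the tree in preorder -/

section Growing

variable {n : ℕ} {f : (Fin n → Bool) → Bool} {ω : ℕ → Fin n → Bool} {p : QueryPath n} {m : ℕ}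

open RProg RState QueryPath

lemma QueryPath.force_apply_of_notMem {i : Fin n} (h : i ∉ p.map Prod.fst) (x : Fin n → Bool) :
    force p x i = x i := by
  induction p generalizing x with
  | nil => rfl
  | cons e p ih =>
    simp only [List.map_cons, List.mem_cons, not_or] at h
    rw [force, ih h.2, Function.update_of_ne h.1]

lemma QueryPath.force_update_of_mem {i : Fin n} (h : i ∈ p.map Prod.fst) (x : Fin n → Bool)
    (b : Bool) : force p (Function.update x i b) = force p x := by
  induction p generalizing x with
  | nil => simp at h
  | cons e p ih =>
    rw [List.map_cons, List.mem_cons] at h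
    simp only [force]
    by_cases hi : i = e.1
    · subst hi; simp
    · rw [Function.update_comm hi, ih (h.resolve_left hi)]

lemma coef_restrict_of_mem {i : Fin n} (h : i ∈ p.map Prod.fst) :
    coef (indic (restrict p f)) i = 0 := by
  have : indic (restrict p f) = fixVar (indic (restrict p f)) i true := by
    funext x
    simp only [indic, restrict_def, fixVar_def, force_update_of_mem h]
  rw [this, coef_fixVar_self]

lemma cubeMean_cubeEvent (p : QueryPath n) (c : Bool) :
    cubeMean (indic (cubeEvent f p.toFinset c))
      = cubeMean fun x => if p.Follows x then (if f x = c then 1 else 0) else 0 := by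
  congr 1
  funext x
  by_cases h : p.Follows x <;> by_cases h' : f x = c <;>
    simp_all [indic, bitVal, cubeEvent, Follows]

/-- The subtracted term does not depend on `i`. Ranking free variables by correlation is thus
ranking them by the mass of positive points with a `1` there, the one frequency that `variableScore`
estimates. -/
lemma prob_mul_coef_of_notMem {i : Fin n} (h : i ∉ p.map Prod.fst) :
    p.prob * coef (indic (p.restrict f)) i
      = 2 * cubeMean (indic (cubeEvent f (List.toFinset ((i, true) :: p)) true))
        - p.prob * cubeMean (indic (p.restrict f)) := by
  have e : cubeMean (indic (cubeEvent f (List.toFinset ((i, true) :: p)) true))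
      = p.prob / 2 * cubeMean (fixVar (indic (p.restrict f)) i true) := by
    rw [cubeMean_cubeEvent ((i, true) :: p) true, cubeMean_follows,
      prob_cons_of_free (force_apply_of_notMem h)]
    congr 2
  rw [e, coef_eq, cubeMean_split (indic (p.restrict f)) i]
  ring

/-- Converts absolute sampling accuracy into accuracy relative to the path: a path that is possible
at all has probability at least `2 ^ (-d)`. -/
lemma four_mul_le_prob {τ η : ℝ} {d : ℕ} (hη : 0 ≤ η) (hτ : 4 * τ * 2 ^ d ≤ η)
    (hp : p.length ≤ d) (h0 : p.prob ≠ 0) : 4 * τ ≤ η * p.prob := by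
  have h := (prob_eq_zero_or p).resolve_left h0
  calc 4 * τ ≤ η / 2 ^ d := by rw [le_div_iff₀ (by positivity)]; exact hτ
    _ ≤ η / 2 ^ p.length := by gcongr; norm_num
    _ = η * (1 / 2 ^ p.length) := by ring
    _ ≤ η * p.prob := by gcongr

/-- Two estimates, each off by at most `τ`, enter the correlation with a factor two, so the choice
loses at most `4 * τ`. -/
lemma isBestScore_coef_le {N k i v d : ℕ} {τ η : ℝ} (hf : Monotone f) (hm : 0 < m)
    (hη : 0 ≤ η) (hτ : 4 * τ * 2 ^ d ≤ η) (hτ0 : 0 ≤ τ) (hp : p.length ≤ d)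
    (hacc : AccurateSample f N m τ ω) (hN : k + n ≤ N) (hi : i < n)
    (hb : IsBestScore f ω p m k n i v) (j : Fin n) :
    p.prob * coef (indic (p.restrict f)) j
      ≤ p.prob * coef (indic (p.restrict f)) ⟨i, hi⟩ + η * p.prob := by
  by_cases h0 : p.prob = 0
  · simp [h0]
  have h4 := four_mul_le_prob hη hτ hp h0
  have ni : 0 ≤ p.prob * coef (indic (p.restrict f)) ⟨i, hi⟩ :=
    mul_nonneg p.prob_nonneg (coef_indic_nonneg (monotone_restrict hf p) _)
  have nm : 0 ≤ p.prob * cubeMean (indic (p.restrict f)) :=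
    mul_nonneg p.prob_nonneg (cubeMean_indic_nonneg _)
  have hm' : (0 : ℝ) < m := by exact_mod_cast hm
  by_cases hj : j ∈ p.map Prod.fst
  · rw [coef_restrict_of_mem hj, mul_zero]
    linarith
  have sj := hb.1 j (by omega)
  rw [variableScore, if_neg hj] at sj
  have aj := (abs_lt.1 (hacc (k + (n - 1 - j)) (by have := j.2; omega)
    (List.toFinset ((j, true) :: p)) true)).1
  have sj' : (blockCount (cubeEvent f (List.toFinset ((j, true) :: p)) true) m
    (k + (n - 1 - j)) ω : ℝ) ≤ v := by exact_mod_cast sj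
  rw [prob_mul_coef_of_notMem hj]
  set u := cubeMean (indic (cubeEvent f (List.toFinset ((j, true) :: p)) true))
  -- When the best score is zero, nothing is known about `i`. But then every free variable has
  -- correlation at most `2 * τ` after weighting, while that of `i` is nonnegative by monotonicity.
  by_cases hv : v = 0
  · rw [hv] at sj'
    have : m * u ≤ m * τ := by push_cast at sj'; linarith
    have := le_of_mul_le_mul_left this hm'
    linarith
  · obtain ⟨l, rfl, hl⟩ := hb.2.resolve_left hv
    by_cases hl' : l ∈ p.map Prod.fst
    · rw [variableScore, if_pos hl'] at hl
      exact absurd hl hv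
    rw [variableScore, if_neg hl'] at hl
    have al := (abs_lt.1 (hacc (k + (n - 1 - l)) (by have := l.2; omega)
      (List.toFinset ((l, true) :: p)) true)).2
    rw [← hl] at al
    rw [Fin.eta, prob_mul_coef_of_notMem hl']
    set w := cubeMean (indic (cubeEvent f (List.toFinset ((l, true) :: p)) true))
    have : m * u ≤ m * (w + 2 * τ) := by linarith
    have := le_of_mul_le_mul_left this hm'
    linarith

lemma nearGreedy_leaf {N k d : ℕ} {τ η : ℝ} (hm : 0 < m)
    (hη : 0 ≤ η) (hτ : 4 * τ * 2 ^ d ≤ η) (hτ0 : 0 ≤ τ) (hp : p.length ≤ d)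
    (hacc : AccurateSample f N m τ ω) (hN : k + 2 ≤ N) :
    NearGreedy f η 0 p (.leaf (decide (blockCount (cubeEvent f p.toFinset false) m (k + 1) ω
      < blockCount (cubeEvent f p.toFinset true) m k ω))) := by
  have hm' : (0 : ℝ) < m := by exact_mod_cast hm
  have e : ∀ b, pathError f (.leaf b) p = cubeMean (indic (cubeEvent f p.toFinset (!b))) := by
    intro b
    rw [cubeMean_cubeEvent, pathError]
    congr 1
    funext x
    simp only [DTree.eval]
    cases b <;> cases f x <;> simp
  have l : p.leafError f = min (cubeMean (indic (cubeEvent f p.toFinset true)))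
      (cubeMean (indic (cubeEvent f p.toFinset false))) := by
    rw [leafError_eq, cubeMean_cubeEvent, cubeMean_cubeEvent]
    congr 2
    all_goals
      funext x
      cases h : f x <;> simp [indic, bitVal, h]
  have a₁ := abs_lt.1 (hacc k (by omega) p.toFinset true)
  have a₀ := abs_lt.1 (hacc (k + 1) (by omega) p.toFinset false)
  set P₁ := cubeMean (indic (cubeEvent f p.toFinset true))
  set P₀ := cubeMean (indic (cubeEvent f p.toFinset false))
  set c₁ := blockCount (cubeEvent f p.toFinset true) m k ω
  set c₀ := blockCount (cubeEvent f p.toFinset false) m (k + 1) ω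
  have main : pathError f (.leaf (decide (c₀ < c₁))) p ≤ p.leafError f + 4 * τ := by
    rw [e, l]
    by_cases h : c₀ < c₁
    · have h' : (c₀ : ℝ) ≤ c₁ := by exact_mod_cast h.le
      simp only [h, decide_true, Bool.not_true]
      have : m * P₀ ≤ m * (P₁ + 2 * τ) := by linarith
      have := le_of_mul_le_mul_left this hm'
      rcases min_choice P₁ P₀ with q | q <;> rw [q] <;> linarith
    · have h' : (c₁ : ℝ) ≤ c₀ := by exact_mod_cast not_lt.1 h
      simp only [h, decide_false, Bool.not_false]
      have : m * P₁ ≤ m * (P₀ + 2 * τ) := by linarith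
      have := le_of_mul_le_mul_left this hm'
      rcases min_choice P₁ P₀ with q | q <;> rw [q] <;> linarith
  -- An impossible path allows no slack `η * prob`, but there both errors vanish.
  by_cases h0 : p.prob = 0
  · have z : ∀ g : (Fin n → Bool) → ℝ,
        cubeMean (fun x => if p.Follows x then g x else 0) = 0 := by
      intro g; rw [cubeMean_follows, h0, zero_mul]
    simp only [NearGreedy, pathError, z, h0, mul_zero, add_zero]
    exact p.leafError_nonneg f
  · have := four_mul_le_prob hη hτ hp h0
    exact main.trans (by linarith)

/-- Write a leaf with the most likely label at the end of the current path. -/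
def leafProg : RProg :=
  countProg ;; .assign 19 (.reg 15) ;; .store 2 (.const 0) (.const 0) ;; countProg ;;
  .store 2 (.const 0) (.const 1) ;;
  -- Truncated subtraction turns the difference of the counts into the bit that says whether it is
  -- positive; ties give `0`.
  .emit (.sub (.const 1) (.sub (.const 1) (.sub (.reg 19) (.reg 15)))) ;; .assign 10 (.const 1)

/-- Query a variable of maximal score at the end of the current path. -/
def nodeProg : RProg :=
  chooseProg ;; .emit (.add (.reg 13) (.const 2)) ;; .store 1 (.reg 9) (.reg 13) ;;
  .store 2 (.reg 9) (.const 0) ;; .assign 9 (.add (.reg 9) (.const 1))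

/-- One round of the depth-first construction of the tree. The register `r₁₀` is `2` when a new
subtree is to be built, `1` when a subtree has been completed, and `0` at the end. -/
def stepProg : RProg :=
  .ite (.sub (.reg 10) (.const 1))
    (.ite (.sub (.add (.reg 7) (.const 1)) (.reg 9)) nodeProg leafProg)
    (.ite (.sub (.reg 9) (.const 1))
      (.ite (.get 2 (.sub (.reg 9) (.const 1)))
        (.assign 9 (.sub (.reg 9) (.const 1)))
        (.store 2 (.sub (.reg 9) (.const 1)) (.const 1) ;; .assign 10 (.const 2)))
      (.assign 10 (.const 0)))

/-- The configurations between two rounds: `k` blocks of examples have been used, and the current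
path is `p`. -/
structure IsGrowing (d m k ph : ℕ) (p : QueryPath n) (σ : RState) : Prop where
  dim : σ.reg 0 = n
  depth : σ.reg 7 = d
  samples : σ.reg 8 = m
  phase : σ.reg 10 = ph
  length : σ.reg 9 = p.length + 1
  stack : IsStack (σ.arr 1) (σ.arr 2) true p
  drawn : σ.drawn = k * m

/-- A bound for the time of one round. -/
def stepTime (n d m : ℕ) : ℕ := (n + 2) * (200 + 30 * d + m * (n + 110 + 30 * d))

lemma leafProg_spec {d k : ℕ} {σ : RState} (h : IsGrowing d m k 2 p σ) :
    leafProg.Reaches (fun i => (ω i, f (ω i))) σ (50 + 2 * (m * (n + 80 + 30 * p.length)))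
      fun τ => IsGrowing d m (k + 2) 1 p τ ∧
        τ.out = σ.out ++ (DTree.leaf (n := n)
          (decide (blockCount (cubeEvent f p.toFinset false) m (k + 1) ω
            < blockCount (cubeEvent f p.toFinset true) m k ω))).encode := by
  refine Reaches.mono (Reaches.seq (countProg_spec_stack h.samples h.length h.stack h.drawn)
    (B' := 30 + m * (n + 80 + 30 * p.length)) ?_) ?_ fun _ h => h
  · rintro τ ⟨ft, dt, rt⟩
    set τ' := (τ.setReg 19 (τ.reg 15)).setArr 2 0 0 with hτ'
    have st : IsStack (τ'.arr 1) (τ'.arr 2) false p := by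
      refine IsStack.congr_label (b := σ.arr 2) (c := true) ?_ (by simp [hτ']) fun j hj => ?_
      · simpa [hτ', ft.arr 1 (by simp)] using h.stack
      · simp [hτ', hj, ft.arr 2 (by simp)]
    have sp := countProg_spec_stack (σ := τ') (f := f) (ω := ω) (p := p) (c := false)
      (m := m) (k := k + 1) (by simp [hτ', ft.reg 8 (by simp), h.samples])
      (by simp [hτ', ft.reg 9 (by simp), h.length]) st (by simpa [hτ'] using dt)
    refine (reaches_assign_seq (reaches_store_seq (Reaches.seq sp (B' := 14) ?_))).mono
      (by simp only [RExpr.cost]; omega) fun _ h => h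
    rintro υ ⟨fu, du, ru⟩
    refine (reaches_store_seq (reaches_emit_seq (reaches_assign ?_))).mono
      (by simp [RExpr.cost]) fun _ h => h
    have u19 : υ.reg 19 = blockCount (cubeEvent f p.toFinset true) m k ω := by
      rw [fu.reg 19 (by simp), ← rt]; simp [hτ']
    have reg : ∀ r, r ∉ [10, 15, 16, 17, 18, 19] → υ.reg r = σ.reg r := by
      intro r hr
      simp only [List.mem_cons, not_or] at hr
      rw [fu.reg r (by simp; omega)]
      simp only [hτ', setArr_reg, setReg_reg]
      rw [if_neg (by omega), ft.reg r (by simp; omega)]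
    have a1 : υ.arr 1 = σ.arr 1 := by
      rw [fu.arr 1 (by simp)]; simp [hτ', ft.arr 1 (by simp)]
    have a2 : Function.update (υ.arr 2) 0 1 = Function.update (σ.arr 2) 0 1 := by
      rw [fu.arr 2 (by simp)]; simp [hτ', ft.arr 2 (by simp)]
    refine ⟨⟨?_, ?_, ?_, ?_, ?_, ?_, ?_⟩, ?_⟩
    · simp [reg 0 (by simp), h.dim]
    · simp [reg 7 (by simp), h.depth]
    · simp [reg 8 (by simp), h.samples]
    · simp [RExpr.eval]
    · simp [reg 9 (by simp), h.length]
    · simp only [setReg_arr, emit_arr, setArr_arr, if_true, RExpr.eval, a2]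
      rw [if_neg (by norm_num), a1]
      refine IsStack.congr_label (b := σ.arr 2) (c := true) h.stack (by simp) fun j hj => ?_
      simp [hj]
    · simpa [add_assoc] using du
    · have o : υ.out = σ.out := by rw [fu.out]; exact ft.out
      simp only [setReg_out, emit_out, setArr_out, o, RExpr.eval, setArr_reg, u19, ru,
        DTree.encode]
      congr 2
      by_cases hlt : blockCount (cubeEvent f p.toFinset false) m (k + 1) ω
          < blockCount (cubeEvent f p.toFinset true) m k ω
      · simp [hlt]; omega
      · simp [hlt]; omega
  · omega

lemma nodeProg_spec {d k : ℕ} {σ : RState} (hn : 0 < n) (h : IsGrowing d m k 2 p σ) :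
    nodeProg.Reaches (fun i => (ω i, f (ω i))) σ
      (50 + n * (150 + 30 * p.length + m * (n + 110 + 30 * p.length)))
      fun τ => ∃ (i : Fin n) (v : ℕ), IsBestScore f ω p m k n i v ∧
        IsGrowing d m (k + n) 2 ((i, false) :: p) τ ∧ τ.out = σ.out ++ [(i : ℕ) + 2] := by
  refine Reaches.mono (Reaches.seq (chooseProg_spec hn h.dim h.samples h.length h.stack h.drawn)
    (B' := 30) ?_) (by omega) fun _ h => h
  rintro τ ⟨ft, t9, tS, td, t13, hb⟩
  refine (reaches_emit_seq (reaches_store_seq (reaches_store_seq (reaches_assign ?_)))).mono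
    (by simp [RExpr.cost]) fun _ h => h
  refine ⟨⟨τ.reg 13, t13⟩, τ.reg 14, hb, ⟨?_, ?_, ?_, ?_, ?_, ?_, ?_⟩, ?_⟩
  · simp [ft.reg 0 (by simp), h.dim]
  · simp [ft.reg 7 (by simp), h.depth]
  · simp [ft.reg 8 (by simp), h.samples]
  · simp [ft.reg 10 (by simp), h.phase]
  · simp [RExpr.eval, t9]
  · refine ⟨by simp [RExpr.eval, t9], by simp [RExpr.eval, t9], ?_⟩
    refine tS.congr (fun j hj => ?_) (fun j hj => ?_)
    · simp [RExpr.eval, t9, show j ≠ p.length + 1 by omega]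
    · simp [RExpr.eval, t9, show j ≠ p.length + 1 by omega]
  · simpa using td
  · simp [RExpr.eval, ft.out]

lemma stepProg_leaf {d k : ℕ} {σ : RState} (h : IsGrowing d m k 2 p σ) (hp : p.length = d) :
    stepProg.Reaches (fun i => (ω i, f (ω i))) σ (stepTime n d m)
      fun τ => IsGrowing d m (k + 2) 1 p τ ∧
        τ.out = σ.out ++ (DTree.leaf (n := n)
          (decide (blockCount (cubeEvent f p.toFinset false) m (k + 1) ω
            < blockCount (cubeEvent f p.toFinset true) m k ω))).encode := by
  refine Reaches.mono (reaches_ite (fun _ => reaches_ite (fun h2 => ?_) fun _ => leafProg_spec h)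
    fun h1 => ?_) ?_ fun _ h => h
  · simp [RExpr.eval, h.depth, h.length, hp] at h2
  · simp [RExpr.eval, h.phase] at h1
  · simp only [RExpr.cost, stepTime]
    have : m * (n + 80 + 30 * p.length) ≤ m * (n + 110 + 30 * d) :=
      Nat.mul_le_mul_left _ (by omega)
    nlinarith [Nat.zero_le (n * (200 + 30 * d + m * (n + 110 + 30 * d)))]

lemma stepProg_node {d k : ℕ} {σ : RState} (hn : 0 < n) (h : IsGrowing d m k 2 p σ)
    (hp : p.length < d) :
    stepProg.Reaches (fun i => (ω i, f (ω i))) σ (stepTime n d m)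
      fun τ => ∃ (i : Fin n) (v : ℕ), IsBestScore f ω p m k n i v ∧
        IsGrowing d m (k + n) 2 ((i, false) :: p) τ ∧ τ.out = σ.out ++ [(i : ℕ) + 2] := by
  refine Reaches.mono (reaches_ite (fun _ => reaches_ite (fun _ => nodeProg_spec hn h)
    fun h2 => ?_) fun h1 => ?_) ?_ fun _ h => h
  · simp [RExpr.eval, h.depth, h.length] at h2; omega
  · simp [RExpr.eval, h.phase] at h1
  · simp only [RExpr.cost, stepTime]
    have : n * (150 + 30 * p.length + m * (n + 110 + 30 * p.length))
        ≤ n * (200 + 30 * d + m * (n + 110 + 30 * d)) := by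
      gcongr
      omega
    nlinarith [Nat.zero_le (m * (n + 110 + 30 * d))]

lemma le_stepTime {d B : ℕ} (h : B ≤ 200) : B ≤ stepTime n d m := by
  unfold stepTime
  nlinarith [Nat.zero_le (m * (n + 110 + 30 * d)),
    Nat.zero_le (n * (200 + 30 * d + m * (n + 110 + 30 * d)))]

lemma stepProg_flip {d k : ℕ} {σ : RState} {i : Fin n}
    (h : IsGrowing d m k 1 ((i, false) :: p) σ) :
    stepProg.Reaches (fun i => (ω i, f (ω i))) σ (stepTime n d m)
      fun τ => IsGrowing d m k 2 ((i, true) :: p) τ ∧ τ.out = σ.out := by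
  have h9 := h.length
  have hv := h.stack.2.1
  simp only [List.length_cons] at h9
  refine Reaches.mono (reaches_ite (B := 25) (fun h1 => ?_) fun _ => reaches_ite (B := 21)
    (fun _ => reaches_ite (B := 16) (fun h3 => ?_) fun _ => ?_) fun h2 => ?_)
    (le_stepTime (by simp [RExpr.cost])) fun _ h => h
  · simp [RExpr.eval, h.phase] at h1
  · simp [RExpr.eval, h9, hv] at h3
  · refine (reaches_store_seq (reaches_assign ?_)).mono (by simp [RExpr.cost]) fun _ h => h
    refine ⟨⟨?_, ?_, ?_, ?_, ?_, ?_, ?_⟩, rfl⟩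
    · simp [h.dim]
    · simp [h.depth]
    · simp [h.samples]
    · simp [RExpr.eval]
    · simp [h9]
    · refine ⟨?_, ?_, h.stack.2.2.congr (fun j hj => ?_) fun j hj => ?_⟩
      · simpa using h.stack.1
      · simp [RExpr.eval, h9]
      · simp
      · simp [RExpr.eval, h9, show j ≠ p.length + 1 by omega]
    · exact h.drawn
  · simp [RExpr.eval, h9] at h2

lemma stepProg_pop {d k : ℕ} {σ : RState} {i : Fin n}
    (h : IsGrowing d m k 1 ((i, true) :: p) σ) :
    stepProg.Reaches (fun i => (ω i, f (ω i))) σ (stepTime n d m)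
      fun τ => IsGrowing d m k 1 p τ ∧ τ.out = σ.out := by
  have h9 := h.length
  have hv := h.stack.2.1
  simp only [List.length_cons] at h9
  refine Reaches.mono (reaches_ite (B := 25) (fun h1 => ?_) fun _ => reaches_ite (B := 21)
    (fun _ => reaches_ite (B := 16) (fun _ => ?_) fun h3 => ?_) fun h2 => ?_)
    (le_stepTime (by simp [RExpr.cost])) fun _ h => h
  · simp [RExpr.eval, h.phase] at h1
  · refine (reaches_assign ?_).mono (by simp [RExpr.cost]) fun _ h => h
    refine ⟨⟨?_, ?_, ?_, ?_, ?_, ?_, ?_⟩, rfl⟩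
    · simp [h.dim]
    · simp [h.depth]
    · simp [h.samples]
    · simp [h.phase]
    · simp [RExpr.eval, h9]
    · exact h.stack.2.2
    · exact h.drawn
  · simp [RExpr.eval, h9, hv] at h3
  · simp [RExpr.eval, h9] at h2

lemma stepProg_done {d k : ℕ} {σ : RState} (h : IsGrowing d m k 1 ([] : QueryPath n) σ) :
    stepProg.Reaches (fun i => (ω i, f (ω i))) σ (stepTime n d m)
      fun τ => τ.reg 10 = 0 ∧ τ.out = σ.out := by
  refine Reaches.mono (reaches_ite (B := 25) (fun h1 => ?_) fun _ => reaches_ite (B := 21)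
    (fun h2 => ?_) fun _ => ?_) (le_stepTime (by simp [RExpr.cost])) fun _ h => h
  · simp [RExpr.eval, h.phase] at h1
  · simp [RExpr.eval, h.length] at h2
  · exact (reaches_assign ⟨by simp [RExpr.eval], rfl⟩).mono (by simp [RExpr.cost]) fun _ h => h

/-- The number of blocks of examples needed for a tree of height `h`. -/
def blocksNeeded (n : ℕ) : ℕ → ℕ
  | 0 => 2
  | h + 1 => n + 2 * blocksNeeded n h

/-- With `n` added, the recursion becomes exact doubling. -/
lemma blocksNeeded_le (n h : ℕ) : blocksNeeded n h + n ≤ (n + 2) * 2 ^ h := by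
  induction h with
  | zero => simp [blocksNeeded]; omega
  | succ h ih =>
    rw [blocksNeeded, pow_succ]
    linarith

/-- The loop that builds the tree. -/
def growProg : RProg := .while (.reg 10) stepProg

/-- The loop that builds the tree passes from `σ` to `τ` in time `t`. -/
def GrowsTo (ex : ℕ → (Fin n → Bool) × Bool) (σ : RState) (t : ℕ) (τ : RState) : Prop :=
  ∀ B Q, growProg.Reaches ex τ B Q → growProg.Reaches ex σ (t + B) Q

lemma GrowsTo.trans {ex : ℕ → (Fin n → Bool) × Bool} {σ τ υ : RState} {t u : ℕ}
    (h : GrowsTo ex σ t τ) (h' : GrowsTo ex τ u υ) : GrowsTo ex σ (t + u) υ :=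
  fun B Q hQ => by rw [add_assoc]; exact h _ _ (h' _ _ hQ)

lemma exists_growsTo {ex : ℕ → (Fin n → Bool) × Bool} {σ : RState} {B : ℕ} {Q : RState → Prop}
    (h : stepProg.Reaches ex σ B Q) (hσ : σ.reg 10 ≠ 0) :
    ∃ τ, GrowsTo ex σ (B + 2) τ ∧ Q τ := by
  obtain ⟨t, τ, run, ht, hQ⟩ := h
  refine ⟨τ, fun B' Q' hQ' => ?_, hQ⟩
  refine (reaches_while_step (Q' := fun υ => υ = τ) (e := .reg 10) hσ ⟨t, τ, run, ht, rfl⟩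
    (by rintro _ rfl; exact hQ')).mono ?_ fun _ h => h
  simp [RExpr.cost]; omega

/-- The loop simulates the recursion on the height. Of the `4 * 2 ^ h - 3` rounds, one goes to each
of the `2 ^ h` leaves and three (query, flip, pop) to each of the `2 ^ h - 1` inner nodes. Halting
and output hold for every sample and target; only the last clause, about the same tree, uses
monotonicity and accuracy. -/
lemma IsGrowing.grow (hn : 0 < n) {d h : ℕ} :
    ∀ {k : ℕ} {p : QueryPath n} {σ : RState}, IsGrowing d m k 2 p σ → p.length + h = d →
    ∃ (T : DTree n) (τ : RState),
      GrowsTo (fun i => (ω i, f (ω i))) σ ((4 * 2 ^ h - 3) * (stepTime n d m + 2)) τ ∧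
      IsGrowing d m (k + blocksNeeded n h) 1 p τ ∧ τ.out = σ.out ++ T.encode ∧
      ∀ N ρ η, Monotone f → 0 < m → 0 ≤ η → 4 * ρ * 2 ^ d ≤ η → 0 ≤ ρ →
        AccurateSample f N m ρ ω → k + blocksNeeded n h ≤ N → NearGreedy f η h p T := by
  have nz : ∀ {k : ℕ} {p : QueryPath n} {ph : ℕ} {σ : RState}, IsGrowing d m k (ph + 1) p σ →
      σ.reg 10 ≠ 0 := by
    intro k p ph σ hσ
    simp [hσ.phase]
  induction h with
  | zero =>
    intro k p σ hσ hp
    obtain ⟨τ, g, hτ, out⟩ :=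
      exists_growsTo (stepProg_leaf (f := f) (ω := ω) hσ (by omega)) (nz hσ)
    exact ⟨_, τ, by simpa using g, hτ, out, fun N ρ η _ hm hη hρ hρ0 hacc hN =>
      nearGreedy_leaf hm hη hρ hρ0 (by omega) hacc hN⟩
  | succ h ih =>
    intro k p σ hσ hp
    obtain ⟨σ₁, g₁, i, v, hb, h₁, out₁⟩ :=
      exists_growsTo (stepProg_node (f := f) (ω := ω) hn hσ (by omega)) (nz hσ)
    obtain ⟨T₀, σ₂, g₂, h₂, out₂, near₀⟩ := ih h₁ (by simp; omega)
    obtain ⟨σ₃, g₃, h₃, out₃⟩ :=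
      exists_growsTo (stepProg_flip (f := f) (ω := ω) h₂) (nz h₂)
    obtain ⟨T₁, σ₄, g₄, h₄, out₄, near₁⟩ := ih h₃ (by simp; omega)
    obtain ⟨σ₅, g₅, h₅, out₅⟩ :=
      exists_growsTo (stepProg_pop (f := f) (ω := ω) h₄) (nz h₄)
    have hk : k + n + blocksNeeded n h + blocksNeeded n h = k + blocksNeeded n (h + 1) := by
      rw [blocksNeeded]; omega
    refine ⟨.node i T₀ T₁, σ₅, ?_, hk ▸ h₅, ?_, ?_⟩
    · have := (((g₁.trans g₂).trans g₃).trans g₄).trans g₅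
      convert this using 1
      obtain ⟨c, hc⟩ : ∃ c, 4 * 2 ^ h = c + 3 :=
        ⟨4 * 2 ^ h - 3, by have := Nat.one_le_two_pow (n := h); omega⟩
      rw [pow_succ, show 4 * (2 ^ h * 2) - 3 = 2 * c + 3 by omega, hc, Nat.add_sub_cancel]
      ring
    · rw [out₅, out₄, out₃, out₂, out₁]
      simp [DTree.encode]
    · intro N ρ η hf hm hη hρ hρ0 hacc hN
      rw [← hk] at hN
      exact ⟨isBestScore_coef_le hf hm hη hρ hρ0 (by omega) hacc (by omega) i.2 hb,
        near₀ N ρ η hf hm hη hρ hρ0 hacc (by omega), near₁ N ρ η hf hm hη hρ hρ0 hacc (by omega)⟩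

end Growing

/-! ### The learning program -/

section Learner

variable {n : ℕ} {ex : ℕ → (Fin n → Bool) × Bool}

open RProg RState

/-- `τ` differs from `σ` only in the registers of `R`, and the register `r` has the value `v`. -/
def RState.Computes (R : List ℕ) (r v : ℕ) (σ τ : RState) : Prop :=
  Frame R [] σ τ ∧ τ.drawn = σ.drawn ∧ τ.reg r = v

lemma reaches_assign_computes {P : RProg} {σ : RState} {B r v : ℕ} {e : RExpr}
    {Q : RState → Prop} (he : e.eval σ = v)
    (h : ∀ τ, Computes [r] r v σ τ → P.Reaches ex τ B Q) :
    (RProg.assign r e ;; P).Reaches ex σ (e.cost + 1 + B) Q :=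
  reaches_assign_seq (h _ ⟨Frame.refl.setReg (by simp) _, rfl, by simp [he]⟩)

/-- Store in the register `dst` the binary logarithm of the register `src`, rounded up. -/
def clogProg (src dst : ℕ) : RProg :=
  .assign dst (.const 0) ;; .assign 16 (.const 1) ;;
  .while (.sub (.reg src) (.reg 16)) (.assign 16 (.add (.reg 16) (.reg 16)) ;;
    .assign dst (.add (.reg dst) (.const 1)))

lemma clogProg_spec (σ : RState) {src dst : ℕ} (h₁ : src ≠ 16) (h₂ : dst ≠ 16)
    (h₃ : src ≠ dst) :
    (clogProg src dst).Reaches ex σ (Nat.clog 2 (σ.reg src) * 20 + 10)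
      (Computes [dst, 16] dst (Nat.clog 2 (σ.reg src)) σ) := by
  set N := Nat.clog 2 (σ.reg src) with hN
  refine Reaches.mono (reaches_assign_seq (reaches_assign_seq
    (reaches_while (B := 8) N (fun j τ => Frame [dst, 16] [] σ τ ∧ τ.drawn = σ.drawn ∧
      τ.reg 16 = 2 ^ j ∧ τ.reg dst = j) ?_ ?_ ?_))) ?_ ?_
  · exact ⟨(Frame.refl.setReg (by simp) _).setReg (by simp) _, rfl, by simp [RExpr.eval],
      by simp [RExpr.eval, h₂]⟩
  · rintro j hj τ ⟨fr, hd, h16, hdst⟩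
    constructor
    · have := (Nat.lt_clog_iff_pow_lt (by norm_num)).1 hj
      simp only [RExpr.eval, h16, fr.reg src (by simp [h₁, h₃])]
      omega
    · refine (reaches_assign_seq (reaches_assign ?_)).mono (by simp [RExpr.cost]) fun _ h => h
      refine ⟨(fr.setReg (by simp) _).setReg (by simp) _, hd, ?_, ?_⟩
      · simp [RExpr.eval, h16, h₂.symm, pow_succ]; ring
      · simp [RExpr.eval, hdst, h₂]
  · rintro τ ⟨fr, -, h16, -⟩
    have := Nat.le_pow_clog (by norm_num : 1 < 2) (σ.reg src)
    rw [← hN] at this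
    simp only [RExpr.eval, h16, fr.reg src (by simp [h₁, h₃])]
    omega
  · simp only [RExpr.cost]
    omega
  · rintro τ ⟨fr, hd, -, h⟩
    exact ⟨fr, hd, h⟩

/-- Store in the register `dst` the product of the registers `a` and `b`. -/
def mulProg (dst a b : ℕ) : RProg :=
  .assign dst (.const 0) ;; .assign 16 (.reg b) ;;
  .while (.reg 16) (.assign 16 (.sub (.reg 16) (.const 1)) ;;
    .assign dst (.add (.reg dst) (.reg a)))

lemma mulProg_spec (σ : RState) {dst a b : ℕ} (h₁ : a ≠ 16) (h₂ : dst ≠ 16)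
    (h₃ : a ≠ dst) (h₄ : b ≠ dst) :
    (mulProg dst a b).Reaches ex σ (σ.reg b * 20 + 10)
      (Computes [dst, 16] dst (σ.reg b * σ.reg a) σ) := by
  set N := σ.reg b with hN
  refine Reaches.mono (reaches_assign_seq (reaches_assign_seq
    (reaches_while (B := 8) N (fun j τ => Frame [dst, 16] [] σ τ ∧ τ.drawn = σ.drawn ∧
      τ.reg 16 = N - j ∧ τ.reg dst = j * σ.reg a) ?_ ?_ ?_))) ?_ ?_
  · exact ⟨(Frame.refl.setReg (by simp) _).setReg (by simp) _, rfl,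
      by simp [RExpr.eval, h₄, hN], by simp [RExpr.eval, h₂]⟩
  · rintro j hj τ ⟨fr, hd, h16, hdst⟩
    refine ⟨by simp only [RExpr.eval]; omega, ?_⟩
    refine (reaches_assign_seq (reaches_assign ?_)).mono (by simp [RExpr.cost]) fun _ h => h
    refine ⟨(fr.setReg (by simp) _).setReg (by simp) _, hd, ?_, ?_⟩
    · simp [RExpr.eval, h16, h₂.symm]; omega
    · simp [RExpr.eval, hdst, h₂, h₁, fr.reg a (by simp [h₁, h₃])]; ring
  · rintro τ ⟨-, -, h, -⟩
    simp [RExpr.eval, h]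
  · simp only [RExpr.cost]
    omega
  · rintro τ ⟨fr, hd, -, h⟩
    exact ⟨fr, hd, h⟩

/-- Store in `r₂₀` a number slightly larger than the square root of `r₄`. -/
def sqrtProg : RProg :=
  .assign 20 (.const 0) ;; .assign 17 (.const 0) ;;
  .while (.sub (.add (.reg 4) (.const 1)) (.reg 17))
    -- Squares are generated as sums of odd numbers, so no multiplication is needed.
    (.assign 17 (.add (.add (.reg 17) (.const 1)) (.add (.reg 20) (.reg 20))) ;;
      .assign 20 (.add (.reg 20) (.const 1)))

lemma sqrtProg_spec (σ : RState) :
    sqrtProg.Reaches ex σ ((Nat.sqrt (σ.reg 4) + 1) * 20 + 20)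
      (Computes [17, 20] 20 (Nat.sqrt (σ.reg 4) + 1) σ) := by
  set N := Nat.sqrt (σ.reg 4) + 1 with hN
  refine Reaches.mono (reaches_assign_seq (reaches_assign_seq
    (reaches_while (B := 12) N (fun j τ => Frame [17, 20] [] σ τ ∧ τ.drawn = σ.drawn ∧
      τ.reg 17 = j * j ∧ τ.reg 20 = j) ?_ ?_ ?_))) ?_ ?_
  · exact ⟨(Frame.refl.setReg (by simp) _).setReg (by simp) _, rfl, by simp [RExpr.eval],
      by simp [RExpr.eval]⟩
  · rintro j hj τ ⟨fr, hd, h17, h20⟩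
    constructor
    · have := Nat.le_sqrt.1 (by omega : j ≤ Nat.sqrt (σ.reg 4))
      simp only [RExpr.eval, h17, fr.reg 4 (by simp)]
      omega
    · refine (reaches_assign_seq (reaches_assign ?_)).mono (by simp [RExpr.cost]) fun _ h => h
      refine ⟨(fr.setReg (by simp) _).setReg (by simp) _, hd, ?_, ?_⟩
      · simp [RExpr.eval, h17, h20]; ring
      · simp [RExpr.eval, h20]
  · rintro τ ⟨fr, -, h17, -⟩
    have := Nat.lt_succ_sqrt (σ.reg 4)
    simp only [RExpr.eval, h17, fr.reg 4 (by simp)]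
    rw [Nat.succ_eq_add_one, ← hN] at this
    omega
  · simp only [RExpr.cost]
    omega
  · rintro τ ⟨fr, hd, -, h⟩
    exact ⟨fr, hd, h⟩

/-- Double the register `r₈` as often as `r₁₇` says. -/
def doubleProg : RProg :=
  .while (.reg 17) (.assign 17 (.sub (.reg 17) (.const 1)) ;;
    .assign 8 (.add (.reg 8) (.reg 8)))

lemma doubleProg_spec (σ : RState) :
    doubleProg.Reaches ex σ (σ.reg 17 * 20 + 10)
      (Computes [8, 17] 8 (σ.reg 8 * 2 ^ σ.reg 17) σ) := by
  set N := σ.reg 17 with hN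
  refine Reaches.mono (reaches_while (B := 8) N (fun j τ => Frame [8, 17] [] σ τ ∧
    τ.drawn = σ.drawn ∧ τ.reg 17 = N - j ∧ τ.reg 8 = σ.reg 8 * 2 ^ j) ?_ ?_ ?_) ?_ ?_
  · exact ⟨Frame.refl, rfl, by simp [hN], by simp⟩
  · rintro j hj τ ⟨fr, hd, h17, h8⟩
    refine ⟨by simp only [RExpr.eval]; omega, ?_⟩
    refine (reaches_assign_seq (reaches_assign ?_)).mono (by simp [RExpr.cost]) fun _ h => h
    refine ⟨(fr.setReg (by simp) _).setReg (by simp) _, hd, ?_, ?_⟩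
    · simp [RExpr.eval, h17]; omega
    · simp [RExpr.eval, h8]; ring
  · rintro τ ⟨-, -, h, -⟩
    simp [RExpr.eval, h]
  · simp only [RExpr.cost]
    omega
  · rintro τ ⟨fr, hd, -, h⟩
    exact ⟨fr, hd, h⟩

/-- The depth of the tree for logarithms `l` of the size and `e` of the inverse accuracy `E`. -/
def treeDepth (l e E : ℕ) : ℕ := min (2 * l * (l + e + 2) * e) (l * (Nat.sqrt l + 1) * E)

/-- The number of examples in a block. -/
def blockLength (n d q : ℕ) : ℕ := (3 * n + d + q + 4) * 2 ^ (16 * d)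

/-- Compute the parameters. -/
def setupProg : RProg :=
  clogProg 1 4 ;; clogProg 2 5 ;; clogProg 3 6 ;; sqrtProg ;;
  .assign 21 (.add (.add (.reg 4) (.reg 5)) (.const 2)) ;;
  mulProg 22 21 4 ;; mulProg 23 22 5 ;; mulProg 24 20 4 ;; mulProg 25 2 24 ;;
  .assign 23 (.add (.reg 23) (.reg 23)) ;;
  .assign 7 (.sub (.reg 23) (.sub (.reg 23) (.reg 25))) ;;
  .assign 8 (.add (.add (.add (.reg 0) (.add (.reg 0) (.reg 0))) (.reg 7))
    (.add (.reg 6) (.const 4))) ;;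
  -- Four doublings give the exponent `16 * d` of the block length.
  .assign 17 (.add (.reg 7) (.reg 7)) ;; .assign 17 (.add (.reg 17) (.reg 17)) ;;
  .assign 17 (.add (.reg 17) (.reg 17)) ;; .assign 17 (.add (.reg 17) (.reg 17)) ;;
  doubleProg ;; .store 1 (.const 0) (.reg 0) ;; .store 2 (.const 0) (.const 1) ;;
  .assign 9 (.const 1) ;; .assign 10 (.const 2)

/-- A bound for the time of the computation of the parameters. -/
def setupTime (l e q d : ℕ) : ℕ :=
  20 * (3 * l + 2 * e + q + (l + 1) * (Nat.sqrt l + 1) + 16 * d) + 300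

lemma setupProg_spec (σ : RState) (h0 : σ.reg 0 = n) (hd : σ.drawn = 0) {l e q d : ℕ}
    (hl : Nat.clog 2 (σ.reg 1) = l) (he : Nat.clog 2 (σ.reg 2) = e)
    (hq : Nat.clog 2 (σ.reg 3) = q) (hdep : treeDepth l e (σ.reg 2) = d) :
    setupProg.Reaches ex σ (setupTime l e q d) fun τ =>
      IsGrowing d (blockLength n d q) 0 2 ([] : QueryPath n) τ ∧ τ.out = σ.out := by
  refine Reaches.mono (B := (l * 20 + 10) + ((e * 20 + 10) + ((q * 20 + 10) +
    (((Nat.sqrt l + 1) * 20 + 20) + (6 + ((l * 20 + 10) + ((e * 20 + 10) +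
    ((l * 20 + 10) + ((l * (Nat.sqrt l + 1) * 20 + 10) + (16 * d * 20 + 100)))))))))) ?_ ?_
    fun _ h => h
  rotate_left
  · simp only [setupTime]
    have : (l + 1) * (Nat.sqrt l + 1) = l * (Nat.sqrt l + 1) + (Nat.sqrt l + 1) := by ring
    omega
  refine Reaches.seq ((clogProg_spec σ (by norm_num) (by norm_num) (by norm_num)).mono
    (by rw [hl]) fun _ h => h) fun τ₁ h₁ => ?_
  have f₁ := h₁.1
  have v₁ : τ₁.reg 4 = l := h₁.2.2.trans hl
  have he₁ : Nat.clog 2 (τ₁.reg 2) = e := by rw [f₁.reg 2 (by simp), he]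
  refine Reaches.seq ((clogProg_spec τ₁ (by norm_num) (by norm_num) (by norm_num)).mono
    (by rw [he₁]) fun _ h => h) fun τ₂ h₂ => ?_
  have f₂ := h₂.1
  have v₂ : τ₂.reg 5 = e := h₂.2.2.trans he₁
  have hq₂ : Nat.clog 2 (τ₂.reg 3) = q := by rw [f₂.reg 3 (by simp), f₁.reg 3 (by simp), hq]
  refine Reaches.seq ((clogProg_spec τ₂ (by norm_num) (by norm_num) (by norm_num)).mono
    (by rw [hq₂]) fun _ h => h) fun τ₃ h₃ => ?_
  have f₃ := h₃.1
  have v₃ : τ₃.reg 6 = q := h₃.2.2.trans hq₂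
  have l₃ : τ₃.reg 4 = l := by rw [f₃.reg 4 (by simp), f₂.reg 4 (by simp), v₁]
  refine Reaches.seq ((sqrtProg_spec τ₃).mono (by rw [l₃]) fun _ h => h) fun τ₄ h₄ => ?_
  have f₄ := h₄.1
  have v₄ : τ₄.reg 20 = Nat.sqrt l + 1 := by rw [h₄.2.2, l₃]
  refine reaches_assign_seq ?_
  set τ₅ := τ₄.setReg 21 (RExpr.eval τ₄ (.add (.add (.reg 4) (.reg 5)) (.const 2))) with hτ₅
  have f₅ : Frame [21] [] τ₄ τ₅ := Frame.refl.setReg (by simp) _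
  have v₅ : τ₅.reg 21 = l + e + 2 := by
    simp [hτ₅, RExpr.eval, f₄.reg 4, l₃, f₄.reg 5, f₃.reg 5, v₂]
  have l₅ : τ₅.reg 4 = l := by rw [f₅.reg 4 (by simp), f₄.reg 4 (by simp), l₃]
  refine Reaches.seq ((mulProg_spec τ₅ (by norm_num) (by norm_num) (by norm_num)
    (by norm_num)).mono (by rw [l₅]) fun _ h => h) fun τ₆ h₆ => ?_
  have f₆ := h₆.1
  have v₆ : τ₆.reg 22 = l * (l + e + 2) := by rw [h₆.2.2, l₅, v₅]
  have e₆ : τ₆.reg 5 = e := by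
    rw [f₆.reg 5 (by simp), f₅.reg 5 (by simp), f₄.reg 5 (by simp), f₃.reg 5 (by simp), v₂]
  refine Reaches.seq ((mulProg_spec τ₆ (by norm_num) (by norm_num) (by norm_num)
    (by norm_num)).mono (by rw [e₆]) fun _ h => h) fun τ₇ h₇ => ?_
  have f₇ := h₇.1
  have v₇ : τ₇.reg 23 = e * (l * (l + e + 2)) := by rw [h₇.2.2, e₆, v₆]
  have l₇ : τ₇.reg 4 = l := by rw [f₇.reg 4 (by simp), f₆.reg 4 (by simp), l₅]
  have r₇ : τ₇.reg 20 = Nat.sqrt l + 1 := by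
    rw [f₇.reg 20 (by simp), f₆.reg 20 (by simp), f₅.reg 20 (by simp), v₄]
  refine Reaches.seq ((mulProg_spec τ₇ (by norm_num) (by norm_num) (by norm_num)
    (by norm_num)).mono (by rw [l₇]) fun _ h => h) fun τ₈ h₈ => ?_
  have f₈ := h₈.1
  have v₈ : τ₈.reg 24 = l * (Nat.sqrt l + 1) := by rw [h₈.2.2, l₇, r₇]
  have F₈ : Frame [4, 5, 6, 16, 17, 20, 21, 22, 23, 24] [] σ τ₈ := by
    refine ((((((((f₁.mono ?_ ?_).trans (f₂.mono ?_ ?_)).trans (f₃.mono ?_ ?_)).trans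
      (f₄.mono ?_ ?_)).trans (f₅.mono ?_ ?_)).trans (f₆.mono ?_ ?_)).trans
      (f₇.mono ?_ ?_))).trans (f₈.mono ?_ ?_) <;> simp
  refine Reaches.seq ((mulProg_spec τ₈ (by norm_num) (by norm_num) (by norm_num)
    (by norm_num)).mono (by rw [v₈]) fun _ h => h) fun τ₉ h₉ => ?_
  have f₉ := h₉.1
  have v₉ : τ₉.reg 25 = l * (Nat.sqrt l + 1) * σ.reg 2 := by
    rw [h₉.2.2, v₈, F₈.reg 2 (by simp)]
  have n₉ : τ₉.reg 0 = n := by rw [f₉.reg 0 (by simp), F₈.reg 0 (by simp), h0]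
  have q₉ : τ₉.reg 6 = q := by
    rw [f₉.reg 6 (by simp), f₈.reg 6 (by simp), f₇.reg 6 (by simp), f₆.reg 6 (by simp),
      f₅.reg 6 (by simp), f₄.reg 6 (by simp), v₃]
  have p₉ : τ₉.reg 23 = e * (l * (l + e + 2)) := by
    rw [f₉.reg 23 (by simp), f₈.reg 23 (by simp), v₇]
  have d₉ : τ₉.drawn = 0 := by
    rw [h₉.2.1, h₈.2.1, h₇.2.1, h₆.2.1, hτ₅, setReg_drawn, h₄.2.1, h₃.2.1, h₂.2.1, h₁.2.1, hd]
  have o₉ : τ₉.out = σ.out := by rw [f₉.out, F₈.out]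
  -- For truncated subtraction `x - (x - y)` is the minimum of `x` and `y`.
  have dep : e * (l * (l + e + 2)) + e * (l * (l + e + 2)) -
      (e * (l * (l + e + 2)) + e * (l * (l + e + 2)) - l * (Nat.sqrt l + 1) * σ.reg 2) = d := by
    rw [← hdep, treeDepth, show 2 * l * (l + e + 2) * e
      = e * (l * (l + e + 2)) + e * (l * (l + e + 2)) by ring]
    omega
  refine Reaches.mono (B := 4 + (6 + (12 + (4 + (4 + (4 + (4 + (16 * d * 20 + 10 + 15))))))))
    ?_ (by omega) fun _ h => h
  refine reaches_assign_computes rfl fun τ h₁₀ => ?_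
  have a23 : τ.reg 23 = e * (l * (l + e + 2)) + e * (l * (l + e + 2)) := by
    rw [h₁₀.2.2]; simp [RExpr.eval, p₉]
  refine reaches_assign_computes (v := d) ?_ fun τ' h₁₁ => ?_
  · simp only [RExpr.eval, a23, h₁₀.1.reg 25 (by simp), v₉, dep]
  have n' : τ'.reg 0 = n := by rw [h₁₁.1.reg 0 (by simp), h₁₀.1.reg 0 (by simp), n₉]
  have q' : τ'.reg 6 = q := by rw [h₁₁.1.reg 6 (by simp), h₁₀.1.reg 6 (by simp), q₉]
  refine reaches_assign_computes (v := 3 * n + d + q + 4) ?_ fun τ₁₂ h₁₂ => ?_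
  · simp only [RExpr.eval, n', q', h₁₁.2.2]
    omega
  have d₁₂ : τ₁₂.reg 7 = d := by rw [h₁₂.1.reg 7 (by simp), h₁₁.2.2]
  refine reaches_assign_computes (v := 2 * d) ?_ fun τ₁₃ h₁₃ => ?_
  · simp only [RExpr.eval, d₁₂]
    omega
  refine reaches_assign_computes (v := 4 * d) ?_ fun τ₁₄ h₁₄ => ?_
  · simp only [RExpr.eval, h₁₃.2.2]
    omega
  refine reaches_assign_computes (v := 8 * d) ?_ fun τ₁₅ h₁₅ => ?_
  · simp only [RExpr.eval, h₁₄.2.2]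
    omega
  refine reaches_assign_computes (v := 16 * d) ?_ fun τ₁₆ h₁₆ => ?_
  · simp only [RExpr.eval, h₁₅.2.2]
    omega
  have f₁₆ : Frame [17] [] τ₁₂ τ₁₆ :=
    ((h₁₃.1.trans h₁₄.1).trans h₁₅.1).trans h₁₆.1
  refine Reaches.seq ((doubleProg_spec τ₁₆).mono (by rw [h₁₆.2.2]) fun _ h => h) fun υ h₁₇ => ?_
  rw [h₁₆.2.2, f₁₆.reg 8 (by simp), h₁₂.2.2] at h₁₇
  have fu : Frame [7, 8, 17, 23] [] τ₉ υ := by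
    refine ((((h₁₀.1.mono ?_ ?_).trans (h₁₁.1.mono ?_ ?_)).trans (h₁₂.1.mono ?_ ?_)).trans
      (f₁₆.mono ?_ ?_)).trans (h₁₇.1.mono ?_ ?_) <;> simp
  have u0 : υ.reg 0 = n := by rw [fu.reg 0 (by simp), n₉]
  have u7 : υ.reg 7 = d := by rw [h₁₇.1.reg 7 (by simp), f₁₆.reg 7 (by simp), d₁₂]
  have u8 : υ.reg 8 = blockLength n d q := h₁₇.2.2
  have ud : υ.drawn = 0 := by
    rw [h₁₇.2.1, h₁₆.2.1, h₁₅.2.1, h₁₄.2.1, h₁₃.2.1, h₁₂.2.1, h₁₁.2.1, h₁₀.2.1, d₉]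
  refine (reaches_store_seq (reaches_store_seq (reaches_assign_seq (reaches_assign ?_)))).mono
    (by simp [RExpr.cost]) fun _ h => h
  refine ⟨⟨?_, ?_, ?_, ?_, ?_, ?_, ?_⟩, ?_⟩
  · simp [u0]
  · simp [u7]
  · simp [u8]
  · simp [RExpr.eval]
  · simp [RExpr.eval]
  · exact ⟨by simp [RExpr.eval, u0], by simp [RExpr.eval]⟩
  · simp [ud]
  · simp [fu.out, o₉]

/-- Draw one example and write its label. -/
def constantProg : RProg := .draw 0 ;; .emit (.get 0 (.reg 0))

/-- The learner. The input registers `r₀, …, r₃` hold `n`, `s`, `⌈1/ε⌉` and `⌈1/δ⌉`. -/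
def learnProg : RProg :=
  .ite (.reg 0) (.ite (.sub (.reg 1) (.const 1)) (setupProg ;; growProg) constantProg) constantProg

lemma constantProg_spec (f : (Fin n → Bool) → Bool) (ω : ℕ → Fin n → Bool) (σ : RState)
    (h0 : σ.reg 0 = n) (hd : σ.drawn = 0) :
    constantProg.Reaches (fun i => (ω i, f (ω i))) σ (n + 10) fun τ =>
      τ.out = σ.out ++ (DTree.leaf (n := n) (f (ω 0))).encode := by
  refine (reaches_draw_seq (reaches_emit ?_)).mono (by simp [RExpr.cost]) fun _ h => h
  simp only [emit_out, draw_out, RExpr.eval, draw_reg, h0, DTree.encode]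
  rw [draw_arr_self _ _ le_rfl, hd]
  simp [exampleSymbol]

/-- A bound for the running time of the learner. -/
def learnTime (n l e q d : ℕ) : ℕ :=
  n + 20 + setupTime l e q d
    + 4 * 2 ^ d * (stepTime n d (blockLength n d q) + 2) + stepTime n d (blockLength n d q)

lemma learnProg_grow {s E Q l e q d : ℕ} (f : (Fin n → Bool) → Bool)
    (ω : ℕ → Fin n → Bool) (hn : 0 < n) (hs : 2 ≤ s)
    (hl : Nat.clog 2 s = l) (he : Nat.clog 2 E = e) (hq : Nat.clog 2 Q = q)
    (hd : treeDepth l e E = d) :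
    ∃ t T, learnProg.Outputs [n, s, E, Q] f ω t T ∧ t ≤ learnTime n l e q d ∧
      ∀ ρ η, Monotone f → 0 ≤ η → 4 * ρ * 2 ^ d ≤ η → 0 ≤ ρ →
        AccurateSample f ((n + 2) * 2 ^ d) (blockLength n d q) ρ ω → NearGreedy f η d [] T := by
  obtain ⟨m, hm⟩ : ∃ m, m = blockLength n d q := ⟨_, rfl⟩
  have hm0 : 0 < m := by simp [hm, blockLength]
  simp only [learnTime, ← hm]
  obtain ⟨t₁, τ₁, run₁, le₁, g₁, out₁⟩ := setupProg_spec (ex := fun i => (ω i, f (ω i)))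
    (RState.init [n, s, E, Q]) (n := n) (by simp [RState.init]) rfl
    (by simpa [RState.init] using hl) (by simpa [RState.init] using he)
    (by simpa [RState.init] using hq) (by simpa [RState.init] using hd)
  rw [← hm] at g₁
  obtain ⟨T, τ₂, g₂, h₂, out₂, near⟩ := g₁.grow (f := f) (ω := ω) hn (h := d) (by simp)
  -- After the whole tree is written, one more round meets the empty path and sets the phase to `0`,
  -- and the loop test fails.
  have fin : growProg.Reaches (fun i => (ω i, f (ω i))) τ₂ (2 + (stepTime n d m + 2))
      fun τ => τ.out = τ₂.out := by
    refine Reaches.mono (reaches_while_step (e := .reg 10) (by simp [RExpr.eval, h₂.phase])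
      (stepProg_done h₂) (B' := 2) (Q := fun τ => τ.out = τ₂.out) ?_)
      (by simp [RExpr.cost]; omega) fun _ h => h
    rintro τ ⟨h10, ho⟩
    exact (reaches_while_done (by simpa [RExpr.eval] using h10) ho)
  obtain ⟨t₃, τ₃, run₃, le₃, out₃⟩ := g₂ _ _ fin
  refine ⟨_, T, ⟨τ₃, .ite_true ?_ (.ite_true ?_ (.seq run₁ run₃)), ?_⟩, ?_, ?_⟩
  · simp [RExpr.eval, RState.init]; omega
  · simp [RExpr.eval, RState.init]; omega
  · rw [out₃, out₂, out₁]
    simp [RState.init]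
  · simp only [RExpr.cost]
    have : (4 * 2 ^ d - 3) * (stepTime n d m + 2) ≤ 4 * 2 ^ d * (stepTime n d m + 2) :=
      Nat.mul_le_mul_right _ (by omega)
    omega
  · intro ρ η hf hη hρ hρ0 hacc
    exact near _ ρ η hf hm0 hη hρ hρ0 hacc (by have := blocksNeeded_le n d; omega)

/-- In these degenerate cases there is no variable to query, or `log s` gives depth zero. A target
with a tree of size at most `s` is then constant, and one label determines it. -/
lemma learnProg_constant {s E Q : ℕ} (f : (Fin n → Bool) → Bool)
    (ω : ℕ → Fin n → Bool) (h : n = 0 ∨ s ≤ 1) :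
    ∃ t, learnProg.Outputs [n, s, E, Q] f ω t (.leaf (f (ω 0))) ∧ t ≤ n + 20 := by
  obtain ⟨t, τ, run, le, out⟩ := constantProg_spec f ω (RState.init [n, s, E, Q])
    (by simp [RState.init]) rfl
  by_cases hn : n = 0
  · refine ⟨_, ⟨τ, .ite_false ?_ run, ?_⟩, ?_⟩
    · simp [RExpr.eval, RState.init, hn]
    · rw [out]; simp [RState.init]
    · simp only [RExpr.cost]; omega
  · refine ⟨_, ⟨τ, .ite_true ?_ (.ite_false ?_ run), ?_⟩, ?_⟩
    · simpa [RExpr.eval, RState.init] using hn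
    · simp [RExpr.eval, RState.init]; omega
    · rw [out]; simp [RState.init]
    · simp only [RExpr.cost]; omega

end Learner

/-! ### The bounds for the parameters -/

section Bounds

open MeasureTheory

lemma clog_le_logb_add_one (x : ℕ) :
    (Nat.clog 2 x : ℝ) ≤ Real.logb 2 x + 1 := by
  have h := Real.natCeil_logb_natCast 2 x
  rw [← h]
  push_cast
  exact (Nat.ceil_lt_add_one (logb_natCast_nonneg x)).le

lemma logb_le_clog (x : ℕ) : Real.logb 2 x ≤ Nat.clog 2 x := by
  have h := Real.natCeil_logb_natCast 2 x
  rw [← h]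
  push_cast
  exact Nat.le_ceil _

lemma natCast_le_two_pow_clog (x : ℕ) : (x : ℝ) ≤ 2 ^ Nat.clog 2 x := by
  exact_mod_cast Nat.le_pow_clog (by norm_num) x

lemma ceil_inv_le {ε : ℝ} (h0 : 0 < ε) (h1 : ε ≤ 1) : (⌈1 / ε⌉₊ : ℝ) ≤ 2 / ε := by
  have h := (Nat.ceil_lt_add_one (by positivity : 0 ≤ 1 / ε)).le
  have : 1 ≤ 1 / ε := by rw [le_div_iff₀ h0]; linarith
  have e : 2 / ε = 1 / ε + 1 / ε := by ring
  linarith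

lemma one_le_ceil_inv {ε : ℝ} (h0 : 0 < ε) : 1 ≤ ⌈1 / ε⌉₊ :=
  Nat.one_le_iff_ne_zero.2 (Nat.ceil_pos.2 (by positivity)).ne'

lemma clog_ceil_inv_le {ε : ℝ} (h0 : 0 < ε) (h1 : ε ≤ 1) :
    (Nat.clog 2 ⌈1 / ε⌉₊ : ℝ) ≤ Real.logb 2 (1 / ε) + 2 := by
  have h := clog_le_logb_add_one ⌈1 / ε⌉₊
  have hp : (0 : ℝ) < ⌈1 / ε⌉₊ := by exact_mod_cast one_le_ceil_inv h0
  have h' : Real.logb 2 (⌈1 / ε⌉₊ : ℝ) ≤ Real.logb 2 (2 * (1 / ε)) := by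
    apply Real.logb_le_logb_of_le (by norm_num) hp
    have := ceil_inv_le h0 h1
    rwa [show 2 * (1 / ε) = 2 / ε by ring]
  rw [Real.logb_mul (by norm_num) (by positivity), Real.logb_self_eq_one (by norm_num)] at h'
  linarith

lemma inv_two_pow_clog_le {ε : ℝ} (h0 : 0 < ε) : 1 / 2 ^ Nat.clog 2 ⌈1 / ε⌉₊ ≤ ε := by
  have h : 1 / ε ≤ 2 ^ Nat.clog 2 ⌈1 / ε⌉₊ :=
    (Nat.le_ceil _).trans (natCast_le_two_pow_clog _)
  rw [div_le_iff₀ (by positivity)]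
  rw [div_le_iff₀ h0] at h
  linarith

/-! ### Depth, running time and noise in terms of the parameters. -/

variable {n s l e E d : ℕ} {ε δ : ℝ}

lemma le_treeDepth (hl : 1 ≤ l) (he : 2 ≤ e) (heE : e ≤ E) (hd : treeDepth l e E = d) :
    l ≤ d ∧ e ≤ d ∧ 2 ≤ d := by
  have h₁ : 2 * 1 * (l + 2 + 2) * e ≤ 2 * l * (l + e + 2) * e := by gcongr
  have h₂ : l * (0 + 1) * E ≤ l * (Nat.sqrt l + 1) * E := by gcongr; omega
  have h₃ : l * 2 ≤ l * E := by gcongr; omega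
  have h₄ : 1 * E ≤ l * E := by gcongr
  have h₅ : (l + 2 + 2) * 2 ≤ (l + 2 + 2) * e := by gcongr
  have h₆ : 4 * e ≤ (l + 2 + 2) * e := by gcongr; omega
  rw [← hd, treeDepth]
  refine ⟨le_min ?_ ?_, le_min ?_ ?_, le_min ?_ ?_⟩ <;> nlinarith

/-- Here `a` and `b` stand for `log s` and `log (1/ε)`. Both being at least one, the roundings are
absorbed as `l ≤ 2a` and `e ≤ 3b`, which produces the constant `48`. -/
lemma treeDepth_le_logb {a b : ℝ} (ha : 1 ≤ a) (hb : 1 ≤ b)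
    (hl : (l : ℝ) ≤ a + 1) (he : (e : ℝ) ≤ b + 2) :
    (treeDepth l e E : ℝ) ≤ 48 * ((a + b) * b) * a := by
  have h : (treeDepth l e E : ℝ) ≤ 2 * l * (l + e + 2) * e := by
    exact_mod_cast min_le_left _ _
  calc (treeDepth l e E : ℝ) ≤ 2 * l * (l + e + 2) * e := h
    _ ≤ 2 * (2 * a) * (2 * a + 3 * b + 2) * (3 * b) := by gcongr <;> linarith
    _ = 12 * (a * b) * (2 * a + 3 * b + 2) := by ring
    _ ≤ 12 * (a * b) * (4 * a + 4 * b) :=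
        mul_le_mul_of_nonneg_left (by linarith) (by positivity)
    _ = 48 * ((a + b) * b) * a := by ring

lemma treeDepth_le_sqrt {a : ℝ} (ha : 1 ≤ a)
    (hl : (l : ℝ) ≤ a + 1) (hE : (E : ℝ) ≤ 2 / ε) :
    (treeDepth l e E : ℝ) ≤ 12 * (√a / ε) * a := by
  have h : (treeDepth l e E : ℝ) ≤ l * (Nat.sqrt l + 1) * E := by
    exact_mod_cast min_le_right _ _
  have hs : (Nat.sqrt l : ℝ) ≤ 2 * √a := by
    refine Real.nat_sqrt_le_real_sqrt.trans ?_
    rw [show (2 : ℝ) * √a = √(4 * a) by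
      rw [Real.sqrt_mul (by norm_num), show (4 : ℝ) = 2 ^ 2 by norm_num,
        Real.sqrt_sq (by norm_num)]]
    apply Real.sqrt_le_sqrt
    linarith
  have hs' : 1 ≤ √a := Real.one_le_sqrt.2 ha
  calc (treeDepth l e E : ℝ) ≤ l * (Nat.sqrt l + 1) * E := h
    _ ≤ (2 * a) * (2 * √a + √a) * (2 / ε) := by gcongr; linarith
    _ = 12 * (√a / ε) * a := by ring

lemma one_le_sizeBound (hs : 1 ≤ s) (h0 : 0 < ε) (h1 : ε < 1 / 2) :
    1 ≤ sizeBound 48 12 s ε := by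
  have hs' : (1 : ℝ) ≤ s := by exact_mod_cast hs
  have h₁ : 0 ≤ Real.logb 2 (1 / ε) :=
    Real.logb_nonneg (by norm_num) (by rw [le_div_iff₀ h0]; linarith)
  have h₂ : 0 ≤ Real.logb 2 (s / ε) :=
    Real.logb_nonneg (by norm_num) (by rw [le_div_iff₀ h0]; linarith)
  exact le_min (Real.one_le_rpow hs' (by positivity)) (Real.one_le_rpow hs' (by positivity))

lemma one_le_logb_inv (h0 : 0 < ε) (h1 : ε < 1 / 2) : 1 ≤ Real.logb 2 (1 / ε) := by
  rw [Real.le_logb_iff_rpow_le (by norm_num) (by positivity), Real.rpow_one, le_div_iff₀ h0]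
  linarith

/-- Since `s ^ x = 2 ^ (x * log s)`, it is enough to compare the depth with each exponent times `log
s`. -/
lemma two_pow_treeDepth_le (hs : 2 ≤ s) (h0 : 0 < ε) (h1 : ε < 1 / 2) :
    (2 : ℝ) ^ treeDepth (Nat.clog 2 s) (Nat.clog 2 ⌈1 / ε⌉₊) ⌈1 / ε⌉₊ ≤ sizeBound 48 12 s ε := by
  have hs' : (2 : ℝ) ≤ s := by exact_mod_cast hs
  have ha : 1 ≤ Real.logb 2 s := by
    rwa [Real.le_logb_iff_rpow_le (by norm_num) (by positivity), Real.rpow_one]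
  have hb := one_le_logb_inv h0 h1
  have hl := clog_le_logb_add_one s
  have he := clog_ceil_inv_le h0 (by linarith)
  have key : ∀ x : ℝ, (s : ℝ) ^ x = 2 ^ (x * Real.logb 2 s) := by
    intro x
    rw [mul_comm, Real.rpow_mul (by norm_num), Real.rpow_logb (by norm_num) (by norm_num)
      (by positivity)]
  rw [sizeBound, key, key, ← Real.rpow_natCast]
  apply le_min
  · apply Real.rpow_le_rpow_of_exponent_le (by norm_num)
    rw [show (s : ℝ) / ε = s * (1 / ε) by ring, Real.logb_mul (by positivity) (by positivity)]
    exact treeDepth_le_logb ha hb hl he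
  · apply Real.rpow_le_rpow_of_exponent_le (by norm_num)
    exact treeDepth_le_sqrt ha hl (ceil_inv_le h0 (by linarith))

/-- In terms of `X = n + 2 ^ d + q`, a block has order `X ^ 17` examples, a round costs order `X ^
19`, and there are order `2 ^ d ≤ X` rounds. -/
lemma learnTime_le {q : ℕ} (hl : l ≤ d) (he : e ≤ d) (hd : 2 ≤ d) :
    learnTime n l e q d ≤ 10000 * (n + 2 ^ d + q) ^ 20 := by
  have hd' : d < 2 ^ d := Nat.lt_two_pow_self
  obtain ⟨X, hX⟩ : ∃ X, X = n + 2 ^ d + q := ⟨_, rfl⟩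
  have hX2 : 2 ≤ X := by omega
  have hp : 2 ^ d ≤ X := by omega
  have ple : ∀ {i j : ℕ}, i ≤ j → X ^ i ≤ X ^ j := fun h => Nat.pow_le_pow_right (by omega) h
  have m : blockLength n d q ≤ 7 * X ^ 17 := by
    calc blockLength n d q = (3 * n + d + q + 4) * (2 ^ d) ^ 16 := by
          rw [blockLength, mul_comm 16 d, pow_mul]
      _ ≤ (7 * X) * X ^ 16 := by gcongr; omega
      _ = 7 * X ^ 17 := by ring
  have st : stepTime n d (blockLength n d q) ≤ 1300 * X ^ 19 := by
    calc stepTime n d (blockLength n d q)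
        ≤ X * (200 + 30 * X + 7 * X ^ 17 * (X + 110 + 30 * X)) := by
          rw [stepTime]
          gcongr <;> omega
      _ ≤ X * (200 * X + 30 * X + 7 * X ^ 17 * (X + 110 * X + 30 * X)) := by gcongr <;> omega
      _ = 230 * X ^ 2 + 987 * X ^ 19 := by ring
      _ ≤ 230 * X ^ 19 + 987 * X ^ 19 := by
          have := ple (by norm_num : 2 ≤ 19)
          omega
      _ ≤ 1300 * X ^ 19 := by omega
  have su : setupTime l e q d ≤ 1000 * X ^ 2 := by
    calc setupTime l e q d ≤ 20 * (3 * X + 2 * X + X + (X + X) * (X + X) + 16 * X) + 300 := by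
          rw [setupTime]
          have := Nat.sqrt_le_self l
          gcongr <;> omega
      _ = 440 * X ^ 1 + 80 * X ^ 2 + 300 * X ^ 0 := by ring
      _ ≤ 440 * X ^ 2 + 80 * X ^ 2 + 300 * X ^ 2 := by
          have h₁ := ple (by norm_num : 1 ≤ 2)
          have h₂ := ple (by norm_num : 0 ≤ 2)
          omega
      _ ≤ 1000 * X ^ 2 := by omega
  rw [← hX]
  calc learnTime n l e q d
      ≤ X + 20 + 1000 * X ^ 2 + 4 * X * (1300 * X ^ 19 + 2) + 1300 * X ^ 19 := by
        rw [learnTime]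
        gcongr
        omega
    _ = 9 * X ^ 1 + 20 * X ^ 0 + 1000 * X ^ 2 + 5200 * X ^ 20 + 1300 * X ^ 19 := by ring
    _ ≤ 9 * X ^ 20 + 20 * X ^ 20 + 1000 * X ^ 20 + 5200 * X ^ 20 + 1300 * X ^ 20 := by
        have h₁ := ple (by norm_num : 1 ≤ 20)
        have h₂ := ple (by norm_num : 0 ≤ 20)
        have h₃ := ple (by norm_num : 2 ≤ 20)
        have h₄ := ple (by norm_num : 19 ≤ 20)
        omega
    _ ≤ 10000 * X ^ 20 := by omega

/-- Of the accuracy `2 ^ (-8d)`, one factor `2 ^ d` is lost to the path probability and one power is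
kept to reach `ε`; the remaining six dominate the factor linear in `l`. -/
lemma noise_le (hl : l ≤ d) (hd : 2 ≤ d) (hε : 1 / 2 ^ d ≤ ε) :
    (1 + 2 * l) * (4 * (1 / 2 ^ (8 * d)) * 2 ^ d) ≤ ε / 4 := by
  have hd' : (d : ℝ) + 1 ≤ 2 ^ d := by exact_mod_cast Nat.lt_two_pow_self (n := d)
  have hl' : (l : ℝ) ≤ d := by exact_mod_cast hl
  have h4 : (4 : ℝ) ≤ 2 ^ d := by
    calc (4 : ℝ) = 2 ^ 2 := by norm_num
      _ ≤ 2 ^ d := pow_le_pow_right₀ (by norm_num) hd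
  rw [mul_comm 8 d, pow_mul]
  obtain ⟨y, hy⟩ : ∃ y : ℝ, y = 2 ^ d := ⟨_, rfl⟩
  rw [← hy] at hd' h4 hε ⊢
  have hy0 : 0 < y := by linarith
  have e : (1 + 2 * (l : ℝ)) * (4 * (1 / y ^ 8) * y) = (1 + 2 * l) * 16 / y ^ 6 * (1 / y) / 4 := by
    field_simp; ring
  rw [e]
  have : (1 + 2 * (l : ℝ)) * 16 / y ^ 6 ≤ 1 := by
    rw [div_le_one (by positivity)]
    calc (1 + 2 * (l : ℝ)) * 16 ≤ (4 * y) * 16 := by gcongr; linarith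
      _ = y * 4 ^ 3 := by ring
      _ ≤ y * y ^ 3 := by gcongr
      _ ≤ y ^ 6 := by
          rw [← pow_succ']
          exact pow_le_pow_right₀ (by linarith) (by norm_num)
  have h2 : (1 + 2 * (l : ℝ)) * 16 / y ^ 6 * (1 / y) ≤ 1 * ε := by gcongr
  linarith

lemma three_le_ceil_inv (h0 : 0 < ε) (h1 : ε < 1 / 2) : 3 ≤ ⌈1 / ε⌉₊ := by
  have : 2 < ⌈1 / ε⌉₊ := by
    rw [Nat.lt_ceil, lt_div_iff₀ h0]
    push_cast
    linarith
  omega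

lemma two_le_clog {x : ℕ} (hx : 3 ≤ x) : 2 ≤ Nat.clog 2 x := by
  have : 1 < Nat.clog 2 x := by
    rw [Nat.lt_clog_iff_pow_lt (by norm_num)]
    omega
  omega

lemma clog_le_self (x : ℕ) : Nat.clog 2 x ≤ x :=
  Nat.clog_le_of_le_pow Nat.lt_two_pow_self.le

/-- The error of near-greedy trees of the depth that the learner uses. -/
lemma NearGreedy.boolError_le {f : (Fin n → Bool) → Bool} (hf : Monotone f)
    (hs : ∃ T : DTree n, T.size ≤ s ∧ T.eval = f) (hs2 : 2 ≤ s) (h0 : 0 < ε) (h1 : ε < 1 / 2)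
    (hd : treeDepth (Nat.clog 2 s) (Nat.clog 2 ⌈1 / ε⌉₊) ⌈1 / ε⌉₊ = d) {T : DTree n}
    (hT : NearGreedy f (4 * (1 / 2 ^ (8 * d)) * 2 ^ d) d [] T) : boolError T.eval f ≤ ε := by
  obtain ⟨l, hl⟩ : ∃ l, Nat.clog 2 s = l := ⟨_, rfl⟩
  obtain ⟨E, hE⟩ : ∃ E, ⌈1 / ε⌉₊ = E := ⟨_, rfl⟩
  obtain ⟨e, he⟩ : ∃ e, Nat.clog 2 E = e := ⟨_, rfl⟩
  have hE3 : 3 ≤ E := hE ▸ three_le_ceil_inv h0 h1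
  have he2 : 2 ≤ e := he ▸ two_le_clog hE3
  have heE : e ≤ E := he ▸ clog_le_self E
  have hl1 : 1 ≤ l := hl ▸ Nat.clog_pos (by norm_num) hs2
  have hls : Real.logb 2 s ≤ l := hl ▸ logb_le_clog s
  have hsl : (s : ℝ) ≤ 2 ^ l := hl ▸ natCast_le_two_pow_clog s
  have heε : 1 / 2 ^ e ≤ ε := by
    have := inv_two_pow_clog_le h0
    rwa [hE, he] at this
  have hEε : 1 / (E : ℝ) ≤ ε := by
    have := Nat.le_ceil (1 / ε)
    rw [hE, div_le_iff₀ h0] at this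
    rw [div_le_iff₀ (by positivity)]
    linarith
  rw [hE, hl, he] at hd
  obtain ⟨ld, ed, d2⟩ := le_treeDepth hl1 he2 heE hd
  have noise := noise_le ld d2 (le_trans (by gcongr; norm_num) heε)
  have hη : (0 : ℝ) ≤ 4 * (1 / 2 ^ (8 * d)) * 2 ^ d := by positivity
  obtain ⟨η, hη'⟩ : ∃ η : ℝ, η = 4 * (1 / 2 ^ (8 * d)) * 2 ^ d := ⟨_, rfl⟩
  rw [← hη'] at hT noise hη
  rcases min_choice (2 * l * (l + e + 2) * e) (l * (Nat.sqrt l + 1) * E) with h | h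
  -- Depth for `e` halvings with truncation level `k = l + e + 2`: the error budget is `ε/2` for the
  -- halved error, `ε/4` for `s / 2 ^ k` and `ε/4` for noise.
  · rw [treeDepth, h] at hd
    rw [← hd] at hT
    have b := hT.boolError_le_log hf hs hη hls (by omega) hl1
    have c : (s : ℝ) / 2 ^ (l + e + 2) ≤ 1 / 2 ^ e / 4 := by
      rw [pow_add, pow_add]
      calc (s : ℝ) / (2 ^ l * 2 ^ e * 2 ^ 2) ≤ 2 ^ l / (2 ^ l * 2 ^ e * 2 ^ 2) := by gcongr
        _ = 1 / 2 ^ e / 4 := by field_simp; norm_num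
    linarith
  -- Here the depth makes the potential term at most `1 / (2E) ≤ ε/2`, and the noise adds at most
  -- `ε/4`.
  · rw [treeDepth, h] at hd
    have b := hT.boolError_le_sqrt hf hs hη hls (by omega)
    have hl0 : (0 : ℝ) < l := by exact_mod_cast hl1
    have hE0 : (0 : ℝ) < E := by exact_mod_cast (by omega : 0 < E)
    have c : (l : ℝ) * √l / (2 * d) ≤ 1 / E / 2 := by
      have sq : √(l : ℝ) ≤ Nat.sqrt l + 1 := Real.real_sqrt_le_nat_sqrt_succ
      rw [← hd]
      push_cast
      calc (l : ℝ) * √l / (2 * (l * (Nat.sqrt l + 1) * E))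
          ≤ l * (Nat.sqrt l + 1) / (2 * (l * (Nat.sqrt l + 1) * E)) := by gcongr
        _ = 1 / E / 2 := by field_simp
    have : (1 + (l : ℝ)) * η ≤ (1 + 2 * l) * η := by gcongr; linarith
    linarith

/-- The failure probability of the learner. -/
lemma failure_le (h0 : 0 < δ) :
    (((n + 2) * 2 ^ d : ℕ) : ℝ) * 4 ^ n * 4
      * Real.exp (-2 * (blockLength n d (Nat.clog 2 ⌈1 / δ⌉₊) : ℕ) * (1 / 2 ^ (8 * d)) ^ 2)
      ≤ δ := by
  obtain ⟨q, hq⟩ : ∃ q, Nat.clog 2 ⌈1 / δ⌉₊ = q := ⟨_, rfl⟩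
  have hδ : 1 / 2 ^ q ≤ δ := hq ▸ inv_two_pow_clog_le h0
  rw [hq]
  -- The factor `2 ^ (16 * d)` of the block length cancels the squared accuracy. The other factor is
  -- chosen so that `2 ^ (-(3n + d + q + 4))` beats the at most `2 ^ (3n + d + 3)` events of the
  -- union bound.
  have e₁ : -2 * ((blockLength n d q : ℕ) : ℝ) * (1 / 2 ^ (8 * d)) ^ 2
      = ((3 * n + d + q + 4 : ℕ) : ℝ) * (-2) := by
    rw [blockLength, show 16 * d = (8 * d) * 2 by ring, pow_mul]
    push_cast
    field_simp
  rw [e₁, Real.exp_nat_mul]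
  have e₂ : Real.exp (-2) ≤ 1 / 2 := by
    have := Real.add_one_le_exp (2 : ℝ)
    rw [Real.exp_neg, ← one_div]
    gcongr
    linarith
  have e₃ : ((n + 2 : ℕ) : ℝ) ≤ 2 ^ (n + 1) := by
    have : n + 2 ≤ 2 ^ (n + 1) := Nat.lt_two_pow_self (n := n + 1)
    exact_mod_cast this
  calc (((n + 2) * 2 ^ d : ℕ) : ℝ) * 4 ^ n * 4 * Real.exp (-2) ^ (3 * n + d + q + 4)
      ≤ (2 ^ (n + 1) * 2 ^ d) * 4 ^ n * 4 * (1 / 2) ^ (3 * n + d + q + 4) := by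
        rw [Nat.cast_mul, Nat.cast_pow, Nat.cast_ofNat]
        gcongr
    _ = 1 / 2 ^ q * (1 / 2) := by
        have h4 : (4 : ℝ) ^ n = (2 ^ n) ^ 2 := by rw [← pow_mul, mul_comm, pow_mul]; norm_num
        have h2 : (2 : ℝ) ^ (3 * n + d + q + 4) = (2 ^ n) ^ 3 * 2 ^ d * 2 ^ q * 16 := by
          rw [pow_add, pow_add, pow_add, mul_comm 3 n, pow_mul]
          norm_num
        rw [h4, one_div_pow, h2, pow_succ]
        field_simp
        norm_num
    _ ≤ δ := by
        have : (0 : ℝ) < 1 / 2 ^ q := by positivity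
        linarith

end Bounds

/-! ### Assembling the theorem. -/

section Main

open MeasureTheory

variable {n s : ℕ} {ε δ : ℝ} {f : (Fin n → Bool) → Bool}

lemma one_le_learningBound (hs : 1 ≤ s) (h0 : 0 < ε) (h1 : ε < 1 / 2) (hδ0 : 0 < δ)
    (hδ1 : δ < 1) : n + 1 ≤ n + sizeBound 48 12 s ε + Real.logb 2 (1 / δ) := by
  have h₁ := one_le_sizeBound hs h0 h1
  have h₂ : 0 ≤ Real.logb 2 (1 / δ) :=
    Real.logb_nonneg (by norm_num) (by rw [le_div_iff₀ hδ0]; linarith)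
  linarith

lemma constant_time_le {t c : ℕ} (hc : 20 ≤ c) (ht : t ≤ n + 20) {Y : ℝ} (hY : n + 1 ≤ Y) :
    (t : ℝ) ≤ c * Y ^ c := by
  have ht' : (t : ℝ) ≤ n + 20 := by exact_mod_cast ht
  have hc' : (20 : ℝ) ≤ c := by exact_mod_cast hc
  have hn : (0 : ℝ) ≤ n := by positivity
  have h : Y ≤ Y ^ c := le_self_pow₀ (by linarith) (by omega)
  have hY0 : 0 ≤ Y := by linarith
  have h' : 20 * Y ≤ c * Y ^ c := by gcongr
  linarith

lemma learnTime_le_bound {t c : ℕ} (hc : 10000 * 2 ^ 20 ≤ c) (hs : 2 ≤ s) (h0 : 0 < ε)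
    (h1 : ε < 1 / 2) (hδ0 : 0 < δ) (hδ1 : δ < 1)
    (ht : t ≤ learnTime n (Nat.clog 2 s) (Nat.clog 2 ⌈1 / ε⌉₊) (Nat.clog 2 ⌈1 / δ⌉₊)
      (treeDepth (Nat.clog 2 s) (Nat.clog 2 ⌈1 / ε⌉₊) ⌈1 / ε⌉₊)) :
    (t : ℝ) ≤ c * (n + sizeBound 48 12 s ε + Real.logb 2 (1 / δ)) ^ c := by
  obtain ⟨Y, hY⟩ : ∃ Y, Y = n + sizeBound 48 12 s ε + Real.logb 2 (1 / δ) := ⟨_, rfl⟩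
  have hY1 : 1 ≤ Y := by
    have := one_le_learningBound (n := n) (s := s) (by omega) h0 h1 hδ0 hδ1
    have hn : (0 : ℝ) ≤ n := by positivity
    linarith
  have hK := two_pow_treeDepth_le hs h0 h1
  have hq := clog_ceil_inv_le hδ0 hδ1.le
  have hE3 := three_le_ceil_inv h0 h1
  obtain ⟨hl, he, hd⟩ := le_treeDepth (Nat.clog_pos (b := 2) (by norm_num) hs) (two_le_clog hE3)
    (clog_le_self _) rfl
  have ht' := ht.trans (learnTime_le (n := n) (q := Nat.clog 2 ⌈1 / δ⌉₊) hl he hd)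
  generalize treeDepth (Nat.clog 2 s) (Nat.clog 2 ⌈1 / ε⌉₊) ⌈1 / ε⌉₊ = d at *
  generalize Nat.clog 2 ⌈1 / δ⌉₊ = q at *
  have h4 : (4 : ℝ) ≤ 2 ^ d := by
    calc (4 : ℝ) = 2 ^ 2 := by norm_num
      _ ≤ 2 ^ d := pow_le_pow_right₀ (by norm_num) hd
  have h₂ : 0 ≤ Real.logb 2 (1 / δ) :=
    Real.logb_nonneg (by norm_num) (by rw [le_div_iff₀ hδ0]; linarith)
  -- Rounding makes `q` exceed `log (1/δ)` by at most `2`, which is absorbed since the size bound is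
  -- at least `2 ^ d ≥ 4`.
  have hX : ((n : ℝ) + 2 ^ d + q) ≤ 2 * Y := by
    have hn : (0 : ℝ) ≤ n := by positivity
    linarith
  have hc' : (10000 * 2 ^ 20 : ℝ) ≤ c := by exact_mod_cast hc
  rw [← hY]
  calc (t : ℝ) ≤ 10000 * ((n : ℝ) + 2 ^ d + q) ^ 20 := by exact_mod_cast ht'
    _ ≤ 10000 * (2 * Y) ^ 20 := by gcongr
    _ = 10000 * 2 ^ 20 * Y ^ 20 := by rw [mul_pow]; ring
    _ ≤ c * Y ^ c := by
        gcongr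
        omega

lemma eq_const_of_size_le_one (hf : ∃ T : DTree n, T.size ≤ s ∧ T.eval = f)
    (h : n = 0 ∨ s ≤ 1) (x y : Fin n → Bool) : f x = f y := by
  rcases h with rfl | h
  · rw [Subsingleton.elim x y]
  · obtain ⟨T, hT, rfl⟩ := hf
    cases T with
    | leaf b => rfl
    | node i T₀ T₁ =>
      have h₀ := T₀.size_pos
      have h₁ := T₁.size_pos
      simp only [DTree.size] at hT
      omega

theorem theorem7 :
    ∃ (P : RProg) (C₁ C₂ : ℝ) (c : ℕ),
      ∀ (n s : ℕ) (ε δ : ℝ), 0 < ε → ε < 1 / 2 → 0 < δ → δ < 1 →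
      ∀ f : (Fin n → Bool) → Bool,
        Monotone f → (∃ T : DTree n, T.size ≤ s ∧ T.eval = f) →
        (∀ ω : ℕ → Fin n → Bool, ∃ (t : ℕ) (T : DTree n),
          P.Outputs [n, s, ⌈1 / ε⌉₊, ⌈1 / δ⌉₊] f ω t T ∧
            (t : ℝ) ≤ c * (n + sizeBound C₁ C₂ s ε + Real.logb 2 (1 / δ)) ^ c) ∧
        1 - δ ≤ (uniformSeq n).real {ω | ∃ (t : ℕ) (T : DTree n),
          P.Outputs [n, s, ⌈1 / ε⌉₊, ⌈1 / δ⌉₊] f ω t T ∧ boolError T.eval f ≤ ε} := by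
  -- The same constant serves as factor and as exponent: it covers `10000 * (2 * Y) ^ 20` because `Y
  -- ≥ 1`.
  obtain ⟨c, hc⟩ : ∃ c : ℕ, 10000 * 2 ^ 20 ≤ c := ⟨_, le_rfl⟩
  refine ⟨learnProg, 48, 12, c, fun n s ε δ h0 h1 hδ0 hδ1 f hf hs => ?_⟩
  have hs1 : 1 ≤ s := by
    obtain ⟨T, hT, -⟩ := hs
    exact T.size_pos.trans hT
  by_cases hc' : n = 0 ∨ s ≤ 1
  · constructor
    · intro ω
      obtain ⟨t, out, ht⟩ := learnProg_constant (E := ⌈1 / ε⌉₊) (Q := ⌈1 / δ⌉₊) f ω hc'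
      exact ⟨t, _, out, constant_time_le (by omega) ht
        (one_le_learningBound hs1 h0 h1 hδ0 hδ1)⟩
    · have all : {ω : ℕ → Fin n → Bool | ∃ (t : ℕ) (T : DTree n),
          learnProg.Outputs [n, s, ⌈1 / ε⌉₊, ⌈1 / δ⌉₊] f ω t T ∧ boolError T.eval f ≤ ε}
          = Set.univ := by
        refine Set.eq_univ_of_forall fun ω => ?_
        obtain ⟨t, out, -⟩ := learnProg_constant (E := ⌈1 / ε⌉₊) (Q := ⌈1 / δ⌉₊) f ω hc'
        refine ⟨t, _, out, ?_⟩
        have e : (DTree.leaf (f (ω 0)) : DTree n).eval = f :=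
          funext fun x => eq_const_of_size_le_one hs hc' _ _
        rw [e]
        simpa [boolError] using h0.le
      rw [all, probReal_univ]
      linarith
  · have hn : 0 < n := by omega
    have hs2 : 2 ≤ s := by omega
    have run := fun ω => learnProg_grow (E := ⌈1 / ε⌉₊) (Q := ⌈1 / δ⌉₊) f ω hn hs2 rfl rfl rfl rfl
    constructor
    · intro ω
      obtain ⟨t, T, out, ht, -⟩ := run ω
      exact ⟨t, T, out, learnTime_le_bound hc hs2 h0 h1 hδ0 hδ1 ht⟩
    · obtain ⟨d, hd⟩ : ∃ d, treeDepth (Nat.clog 2 s) (Nat.clog 2 ⌈1 / ε⌉₊) ⌈1 / ε⌉₊ = d :=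
        ⟨_, rfl⟩
      rw [hd] at run
      have prob := accurateSample_probability f ((n + 2) * 2 ^ d)
        (blockLength n d (Nat.clog 2 ⌈1 / δ⌉₊)) (by simp [blockLength]) (1 / 2 ^ (8 * d))
        (by positivity)
      have fail := failure_le (n := n) (d := d) hδ0
      -- Success contains the event of an accurate sample, so monotonicity of the measure suffices
      -- and measurability of the success event is not needed.
      refine le_trans (by linarith) (prob.trans (measureReal_mono fun ω hω => ?_))
      obtain ⟨t, T, out, -, near⟩ := run ω
      exact ⟨t, T, out, NearGreedy.boolError_le hf hs hs2 h0 h1 hd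
        (near _ _ hf (by positivity) le_rfl (by positivity) hω)⟩

end Main
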